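/- Let $(M,g)$ be a compact smooth Riemannian 2-manifold without boundary, with volume measure $dv_g$, total area $|M|$ and Riemannian distance $d_g$. Let $E=\{u\in H^1(M):\int_M u\,dv_g=0\}$, with $\|u\|^2=\int_M|\nabla_g u|^2\,dv_g$, and $$\mu_1(M)=\inf_{u\in E\setminus\{0\}}\frac{\int_M|\nabla_g u|^2\,dv_g}{\int_M u^2\,dv_g}.$$ Let $\Lambda$ be the set of all $(\lambda_1,\lambda_2)$ with $\lambda_1,\lambda_2\ge 0$, $\lambda_1+\lambda_2<\mu_1(M)|M|$ and $\max\{\lambda_1,\lambda_2\}>8\pi$. For $u\in E$ put $$I_{\lambda_1,\lambda_2}(u)=\frac12\int_M|\nabla_g u|^2\,dv_g-\lambda_1\ln\Big(\frac1{|M|}\int_M e^u\,dv_g\Big)-\lambda_2\ln\Big(\frac1{|M|}\int_M e^{-u}\,dv_g\Big).$$ Let $(\lambda_1,\lambda_2)\in\Lambda$ and $I=I_{\lambda_1,\lambda_2}$. Then $e^{u}$ and $e^{-u}$ are integrable for every $u\in E$, so that $I$ is well defined on $E$, and $I$ has a mountain pass structure: 1. $u=0$ is a strict nondegenerate local minimum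 of $I$ on $E$: there are $\rho,c>0$ such that $I(u)\ge I(0)+c\|u\|^2$ for all $u\in E$ with $\|u\|<\rho$, and $I(u)>I(0)$ for all nonzero $u\in E$ with $\|u\|<\rho$. 2. $I$ is unbounded below on $E$. 3. There are $\rho>0$, $\alpha>I(0)$ and $e\in E$ with $\|e\|>\rho$ such that $I(u)\ge\alpha$ for all $u\in E$ with $\|u\|=\rho$, and $I(e)<I(0)$. Moreover, for every $p_0\in M$ and every sufficiently small $r_0>0$, let, for $\varepsilon>0$, $$v_\varepsilon(p)=\ln\frac{\varepsilon^2}{(\varepsilon^2+d_g(p,p_0)^2)^2}\ \text{ if } d_g(p,p_0)<r_0,\qquad v_\varepsilon(p)=\ln\frac{\varepsilon^2}{(\varepsilon^2+r_0^2)^2}\ \text{ otherwise,}$$ and $u_\varepsilon=v_\varepsilon-\frac1{|M|}\int_M v_\varepsilon\,dv_g$. Then $u_\varepsilon\in E$ for every $\varepsilon>0$ and, as $\varepsilon\to0^+$, $$I(u_\varepsilon)=2(8\pi-\lambda_1)\ln\frac1\varepsilon+O(1),\qquad I(-u_\varepsilon)=2(8\pi-\lambda_2)\ln\frac1\varepsilon+O(1).$$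 -/

import Mathlib

open MeasureTheory Filter Topology Set Bundle Manifold
open scoped ContDiff ENNReal

namespace MeanField

noncomputable section

/-- The Euclidean plane, the model space of surfaces without boundary. -/
abbrev Plane : Type := EuclideanSpace ℝ (Fin 2)

section Surface

variable (M : Type*) [TopologicalSpace M] [ChartedSpace Plane M] [IsManifold (𝓡 2) ∞ M]
  [RiemannianBundle (fun x : M => TangentSpace (𝓡 2) x)]

variable {M} in
/-- The `i`-th coordinate vector field `∂ᵢ` of the chart `φ` around `x₀`, as a tangent vector at the
point `φ⁻¹ y` with coordinates `y`. -/
def coordVec (x₀ : M) (y : Plane) (i : Fin 2) :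
    TangentSpace (𝓡 2) ((extChartAt (𝓡 2) x₀).symm y) :=
  mfderiv 𝓘(ℝ, Plane) (𝓡 2) (extChartAt (𝓡 2) x₀).symm y (EuclideanSpace.single i (1 : ℝ))

variable {M} in
/-- The matrix `gᵢⱼ = ⟨∂ᵢ, ∂ⱼ⟩` of the metric in the chart around `x₀`. -/
def metricMatrix (x₀ : M) (y : Plane) : Matrix (Fin 2) (Fin 2) ℝ :=
  Matrix.of fun i j => inner ℝ (coordVec x₀ y i) (coordVec x₀ y j)

variable {M} in
/-- The measure `√(det g) dy` of the chart around `x₀`, transported to `M`; it is carried by the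
domain of the chart. -/
def chartVol [MeasurableSpace M] (x₀ : M) : Measure M :=
  ((volume.restrict (extChartAt (𝓡 2) x₀).target).withDensity
    fun y => ENNReal.ofReal (Real.sqrt (metricMatrix x₀ y).det)).map (extChartAt (𝓡 2) x₀).symm

/-- The Riemannian volume measure `dv_g`: the measures `√(det g) dy` of the charts agree on the
overlaps, and their supremum is the measure on `M` that they glue to. -/
def vol [MeasurableSpace M] : Measure M := ⨆ x₀ : M, chartVol x₀

variable {M} in
/-- The gradient of a differentiable function: `⟨∇f, v⟩ = df(v)` for all tangent vectors `v`. -/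
def grad (f : M → ℝ) (x : M) : TangentSpace (𝓡 2) x :=
  haveI : FiniteDimensional ℝ (TangentSpace (𝓡 2) x) :=
    inferInstanceAs (FiniteDimensional ℝ Plane)
  haveI : CompleteSpace (TangentSpace (𝓡 2) x) := FiniteDimensional.complete ℝ _
  (InnerProductSpace.toDual ℝ (TangentSpace (𝓡 2) x)).symm (mfderiv (𝓡 2) 𝓘(ℝ, ℝ) f x)

variable [MeasurableSpace M]

/-- `|M|`. -/
def area : ℝ := (vol M).real univ

variable {M}

/-- `u` lies in `H¹(M)`, the completion of the smooth functions in the norm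
`(∫ u² + ∫ |∇u|²)^{1/2}`, and its (generalized) gradient is the vector field `X`: there are smooth
functions `φ n` with `φ n → u` and `∇(φ n) → X` in `L²`. -/
def HasWeakGrad (u : M → ℝ) (X : ∀ x : M, TangentSpace (𝓡 2) x) : Prop :=
  AEStronglyMeasurable u (vol M) ∧
  ∃ φ : ℕ → M → ℝ,
    (∀ n, ContMDiff (𝓡 2) 𝓘(ℝ, ℝ) ∞ (φ n)) ∧
    (∀ n, AEStronglyMeasurable (fun x => ‖grad (φ n) x - X x‖) (vol M)) ∧
    Tendsto (fun n => eLpNorm (fun x => φ n x - u x) 2 (vol M)) atTop (𝓝 0) ∧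
    Tendsto (fun n => eLpNorm (fun x => ‖grad (φ n) x - X x‖) 2 (vol M)) atTop (𝓝 0)

/-- `u ∈ H¹(M)`. -/
def MemH1 (u : M → ℝ) : Prop := ∃ X : ∀ x : M, TangentSpace (𝓡 2) x, HasWeakGrad u X

open Classical in
/-- The gradient of a function in `H¹(M)` (it is determined up to a null set), and `0` for other
functions. -/
def weakGrad (u : M → ℝ) : ∀ x : M, TangentSpace (𝓡 2) x :=
  if h : MemH1 u then h.choose else fun _ => 0

/-- `u ∈ E`: the function `u` lies in `H¹(M)` and has mean zero. -/
def MemE (u : M → ℝ) : Prop := MemH1 u ∧ ∫ x, u x ∂(vol M) = 0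

/-- The Dirichlet integral `∫ |∇u|²`. -/
def dirichlet (u : M → ℝ) : ℝ := ∫ x, ‖weakGrad u x‖ ^ 2 ∂(vol M)

/-- The norm `‖u‖ = (∫ |∇u|²)^{1/2}` of `E`. -/
def normE (u : M → ℝ) : ℝ := Real.sqrt (dirichlet u)

variable (M) in
/-- `μ₁(M)`: the infimum of `∫ |∇u|² / ∫ u²` over the nonzero elements `u` of `E`. -/
def mu1 : ℝ :=
  sInf {t : ℝ | ∃ u : M → ℝ, MemE u ∧ ¬ (u =ᵐ[vol M] 0) ∧
    t = dirichlet u / ∫ x, u x ^ 2 ∂(vol M)}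

variable (M) in
/-- The set `Λ` of parameters. -/
def Lam : Set (ℝ × ℝ) :=
  {l | 0 ≤ l.1 ∧ 0 ≤ l.2 ∧ l.1 + l.2 < mu1 M * area M ∧ 8 * Real.pi < max l.1 l.2}

/-- The functional `I_{λ₁,λ₂}`. -/
def functional (l₁ l₂ : ℝ) (u : M → ℝ) : ℝ :=
  1 / 2 * dirichlet u
    - l₁ * Real.log (1 / area M * ∫ x, Real.exp (u x) ∂(vol M))
    - l₂ * Real.log (1 / area M * ∫ x, Real.exp (-u x) ∂(vol M))

/-- `0` is a strict local minimum of `J` on `E`. -/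
def IsStrictLocalMinAtZero (J : (M → ℝ) → ℝ) : Prop :=
  ∃ ρ > 0, ∀ u : M → ℝ, MemE u → ¬ (u =ᵐ[vol M] 0) → normE u < ρ → J 0 < J u

/-- The local minimum `0` of `J` on `E` is nondegenerate: `J` grows quadratically away from it. -/
def IsNondegenerateAtZero (J : (M → ℝ) → ℝ) : Prop :=
  ∃ ρ > 0, ∃ c > 0, ∀ u : M → ℝ, MemE u → normE u < ρ → J 0 + c * normE u ^ 2 ≤ J u

/-- `J` is unbounded below on `E`. -/
def IsUnboundedBelow (J : (M → ℝ) → ℝ) : Prop :=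
  ∀ B : ℝ, ∃ u : M → ℝ, MemE u ∧ J u < B

/-- The mountain pass geometry: on some sphere around `0` the functional `J` is bounded below by a
level `α` that exceeds both `J 0` and the value of `J` at some point outside the sphere. -/
def HasMountainPassGeometry (J : (M → ℝ) → ℝ) : Prop :=
  ∃ ρ > 0, ∃ α : ℝ, J 0 < α ∧ (∀ u : M → ℝ, MemE u → normE u = ρ → α ≤ J u) ∧
    ∃ e : M → ℝ, MemE e ∧ ρ < normE e ∧ J e < J 0

/-- The functions `v_ε`, with `d_g` the Riemannian distance. -/
def bubbleV (p₀ : M) (r₀ ε : ℝ) (p : M) : ℝ :=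
  if riemannianEDist (𝓡 2) p p₀ < ENNReal.ofReal r₀ then
    Real.log (ε ^ 2 / (ε ^ 2 + (riemannianEDist (𝓡 2) p p₀).toReal ^ 2) ^ 2)
  else Real.log (ε ^ 2 / (ε ^ 2 + r₀ ^ 2) ^ 2)

/-- The functions `u_ε = v_ε - ⨍ v_ε`. -/
def bubble (p₀ : M) (r₀ ε : ℝ) (p : M) : ℝ :=
  bubbleV p₀ r₀ ε p - 1 / area M * ∫ q, bubbleV p₀ r₀ ε q ∂(vol M)

end Surface

end

end MeanField

/-! Near 0 the functional is governed by its quadratic part. For `u` of mean zero, the logarithm of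
the mean of e^{±u} is at most ∫u²/(2|M|) plus a term of order ‖u‖³, and ∫u² ≤ ‖u‖²/μ₁. Hence I(u) ≥
½(1 − (λ₁+λ₂)/(μ₁|M|))‖u‖² − O(‖u‖³), and the leading coefficient is positive on Λ
(`log_mean_exp_le`, `isNondegenerateAtZero`).

The cubic remainder and the integrability of e^{±u} only need a weak Moser–Trudinger inequality,
without sharp constant. The embedding of W^{1,1} into L², applied to the powers f^{k+1} and combined
with Cauchy–Schwarz, gives ∫f^{2k} ≤ (KH)^k (k!)² |M|, where H is the squared H¹ energy
(`exists_lintegral_pow_le`). Since (k!)² ≤ (2k)!, the series of cosh f is dominated by a geometric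
one when H is small; density of smooth functions and Fatou's lemma extend this to H¹
(`exists_lintegral_cosh_le_of_hasWeakGrad`).

Far from 0 the bubbles decide. With L = ln(1/ε), the energy of v_ε is 32πL + O(1), its mean is −2L +
O(1), and both ∫e^{v_ε} and ε²∫e^{−v_ε} stay between positive constants. So the logarithmic means of
e^{u_ε} and e^{−u_ε} are 2L + O(1) and O(1), whence I(u_ε) = (16π − 2λ₁)L + O(1). Replacing u by −u
exchanges λ₁ and λ₂. Whichever parameter exceeds 8π drives I to −∞, and the mountain pass geometry
follows formally.

The distance function is only used as a Lipschitz function. It agrees with a Euclidean norm up to a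
relative error linear in the distance (`riemannianEDist_near`), its gradient has length one wherever
it exists (`norm_grad_distTo`), it is differentiable almost everywhere by Rademacher, and
mollification identifies the pointwise gradient with the weak one (`hasWeakGrad_chartExt`). A
relative error O(σ) in an energy density of size 16/σ² is O(1/σ), integrable in the plane uniformly
in ε; this makes the coefficient 32π exact (`abs_energy_sub_le`). -/

set_option linter.unusedSectionVars false
set_option linter.style.haveILetI false

namespace MeanField

noncomputable section

/-! ### The metric in charts: Gram matrix, transition law, smoothness. -/

section

variable {M : Type*} [TopologicalSpace M] [ChartedSpace Plane M] [IsManifold (𝓡 2) ∞ M]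
  [RiemannianBundle (fun x : M => TangentSpace (𝓡 2) x)]

/-- The inner product of the tangent space at `p`, on vectors of the model space. -/
def tangentInner (p : M) (v w : Plane) : ℝ :=
  inner ℝ (show TangentSpace (𝓡 2) p from v) (show TangentSpace (𝓡 2) p from w)

theorem inner_grad (f : M → ℝ) (x : M) (v : TangentSpace (𝓡 2) x) :
    inner ℝ (grad f x) v = mfderiv (𝓡 2) 𝓘(ℝ, ℝ) f x v := by
  haveI : FiniteDimensional ℝ (TangentSpace (𝓡 2) x) :=
    inferInstanceAs (FiniteDimensional ℝ Plane)
  haveI : CompleteSpace (TangentSpace (𝓡 2) x) := FiniteDimensional.complete ℝ _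
  exact InnerProductSpace.toDual_symm_apply (𝕜 := ℝ) (x := v) (y := mfderiv (𝓡 2) 𝓘(ℝ, ℝ) f x)

/-- The derivative of the inverse of the chart around `x₀`. -/
def chartLin (x₀ : M) (y : Plane) :
    Plane →L[ℝ] TangentSpace (𝓡 2) ((extChartAt (𝓡 2) x₀).symm y) :=
  mfderiv 𝓘(ℝ, Plane) (𝓡 2) (extChartAt (𝓡 2) x₀).symm y

theorem coordVec_eq (x₀ : M) (y : Plane) (i : Fin 2) :
    coordVec x₀ y i = chartLin x₀ y (EuclideanSpace.single i 1) := rfl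

theorem plane_eq_sum (w : Plane) :
    w = w 0 • EuclideanSpace.single 0 (1 : ℝ) + w 1 • EuclideanSpace.single 1 (1 : ℝ) := by
  ext i; fin_cases i <;> simp

theorem chartLin_apply (x₀ : M) (y w : Plane) :
    chartLin x₀ y w = w 0 • coordVec x₀ y 0 + w 1 • coordVec x₀ y 1 := by
  conv_lhs => rw [plane_eq_sum w]
  rw [map_add, map_smul, map_smul]; rfl

theorem mdifferentiableAt_symm {x₀ : M} {y : Plane} (hy : y ∈ (extChartAt (𝓡 2) x₀).target) :
    MDifferentiableAt 𝓘(ℝ, Plane) (𝓡 2) (extChartAt (𝓡 2) x₀).symm y := by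
  have := mdifferentiableWithinAt_extChartAt_symm (I := 𝓡 2) hy
  rwa [ModelWithCorners.range_eq_univ, mdifferentiableWithinAt_univ] at this

theorem inner_grad_chartLin {f : M → ℝ} {x₀ : M} {y : Plane}
    (hy : y ∈ (extChartAt (𝓡 2) x₀).target)
    (hf : MDifferentiableAt (𝓡 2) 𝓘(ℝ, ℝ) f ((extChartAt (𝓡 2) x₀).symm y)) (w : Plane) :
    inner ℝ (grad f ((extChartAt (𝓡 2) x₀).symm y)) (chartLin x₀ y w) =
      fderiv ℝ (f ∘ (extChartAt (𝓡 2) x₀).symm) y w := by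
  rw [inner_grad, chartLin]
  rw [← mfderiv_eq_fderiv, mfderiv_comp y hf (mdifferentiableAt_symm hy)]
  rfl

theorem chartLin_bijective {x₀ : M} {y : Plane} (hy : y ∈ (extChartAt (𝓡 2) x₀).target) :
    Function.Bijective (chartLin x₀ y) := by
  have := isInvertible_mfderivWithin_extChartAt_symm (I := 𝓡 2) hy
  rw [ModelWithCorners.range_eq_univ, mfderivWithin_univ] at this
  exact this.bijective

theorem isOpen_target (x₀ : M) : IsOpen (extChartAt (𝓡 2) x₀).target :=
  isOpen_extChartAt_target x₀

theorem metricMatrix_apply (x₀ : M) (y : Plane) (i j : Fin 2) :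
    metricMatrix x₀ y i j = inner ℝ (coordVec x₀ y i) (coordVec x₀ y j) := rfl

theorem metricMatrix_symm (x₀ : M) (y : Plane) (i j : Fin 2) :
    metricMatrix x₀ y i j = metricMatrix x₀ y j i := by
  rw [metricMatrix_apply, metricMatrix_apply, real_inner_comm]

theorem inner_chartLin (x₀ : M) (y v w : Plane) :
    inner ℝ (chartLin x₀ y v) (chartLin x₀ y w) =
      v 0 * w 0 * metricMatrix x₀ y 0 0 + (v 0 * w 1 + v 1 * w 0) * metricMatrix x₀ y 0 1
        + v 1 * w 1 * metricMatrix x₀ y 1 1 := by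
  rw [chartLin_apply, chartLin_apply]
  simp only [inner_add_left, inner_add_right, real_inner_smul_left, real_inner_smul_right,
    ← metricMatrix_apply]
  rw [metricMatrix_symm x₀ y 1 0]
  ring

theorem norm_chartLin_sq (x₀ : M) (y w : Plane) :
    ‖chartLin x₀ y w‖ ^ 2 =
      w 0 ^ 2 * metricMatrix x₀ y 0 0 + 2 * (w 0 * w 1) * metricMatrix x₀ y 0 1
        + w 1 ^ 2 * metricMatrix x₀ y 1 1 := by
  rw [← real_inner_self_eq_norm_sq, inner_chartLin]
  ring

theorem det_metricMatrix (x₀ : M) (y : Plane) :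
    (metricMatrix x₀ y).det =
      metricMatrix x₀ y 0 0 * metricMatrix x₀ y 1 1 - metricMatrix x₀ y 0 1 ^ 2 := by
  rw [Matrix.det_fin_two, metricMatrix_symm x₀ y 1 0]
  ring

theorem det_metricMatrix_pos {x₀ : M} {y : Plane} (hy : y ∈ (extChartAt (𝓡 2) x₀).target) :
    0 < (metricMatrix x₀ y).det := by
  have key : ∀ w : Plane, w ≠ 0 → 0 < ‖chartLin x₀ y w‖ ^ 2 := by
    intro w hw
    have : chartLin x₀ y w ≠ 0 := fun h =>
      hw ((chartLin_bijective hy).1 (h.trans (map_zero _).symm))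
    positivity
  have h0 : 0 < metricMatrix x₀ y 0 0 := by
    have := key (EuclideanSpace.single 0 1) (by simp)
    rw [norm_chartLin_sq] at this
    simpa using this
  -- This is g₀₀ times the component of ∂₁ orthogonal to ∂₀; its squared length is g₀₀ det g.
  have h1 := key (!₂[- metricMatrix x₀ y 0 1, metricMatrix x₀ y 0 0]) (by
    intro h
    have := congrArg (fun v : Plane => v 1) h
    simp at this
    exact h0.ne' this)
  rw [norm_chartLin_sq] at h1
  rw [det_metricMatrix]
  simp at h1
  have : 0 < metricMatrix x₀ y 0 0 *
      (metricMatrix x₀ y 0 0 * metricMatrix x₀ y 1 1 - metricMatrix x₀ y 0 1 ^ 2) := by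
    nlinarith
  exact (pos_iff_pos_of_mul_pos this).1 h0

/-- The norm of a tangent vector in terms of its scalar products with the coordinate vectors. -/
theorem det_mul_norm_sq {x₀ : M} {y : Plane} (hy : y ∈ (extChartAt (𝓡 2) x₀).target)
    (v : TangentSpace (𝓡 2) ((extChartAt (𝓡 2) x₀).symm y)) :
    (metricMatrix x₀ y).det * ‖v‖ ^ 2 =
      metricMatrix x₀ y 1 1 * inner ℝ v (coordVec x₀ y 0) ^ 2
      - 2 * metricMatrix x₀ y 0 1 * (inner ℝ v (coordVec x₀ y 0) * inner ℝ v (coordVec x₀ y 1))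
      + metricMatrix x₀ y 0 0 * inner ℝ v (coordVec x₀ y 1) ^ 2 := by
  obtain ⟨w, rfl⟩ := (chartLin_bijective hy).2 v
  rw [norm_chartLin_sq, det_metricMatrix, coordVec_eq, coordVec_eq, inner_chartLin, inner_chartLin]
  simp
  ring

/-- The Gram matrices satisfy G₀ = Dᵀ G₁ D, where D is the derivative of the transition map, so the
determinants differ by (det D)². This is what makes √(det g) dy independent of the chart. -/
theorem metricMatrix_transition {x₀ x₁ : M} {y : Plane} (hy : y ∈ (extChartAt (𝓡 2) x₀).target)
    (hy' : (extChartAt (𝓡 2) x₀).symm y ∈ (extChartAt (𝓡 2) x₁).source) :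
    (metricMatrix x₀ y).det =
      (fderiv ℝ (extChartAt (𝓡 2) x₁ ∘ (extChartAt (𝓡 2) x₀).symm) y).det ^ 2 *
        (metricMatrix x₁ (extChartAt (𝓡 2) x₁ ((extChartAt (𝓡 2) x₀).symm y))).det := by
  set ψ := extChartAt (𝓡 2) x₁ ∘ (extChartAt (𝓡 2) x₀).symm with hψ
  have hψy : ψ y = extChartAt (𝓡 2) x₁ ((extChartAt (𝓡 2) x₀).symm y) := rfl
  have hpt : (extChartAt (𝓡 2) x₁).symm (ψ y) = (extChartAt (𝓡 2) x₀).symm y :=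
    (extChartAt (𝓡 2) x₁).left_inv hy'
  have hev : (extChartAt (𝓡 2) x₀).symm =ᶠ[𝓝 y] (extChartAt (𝓡 2) x₁).symm ∘ ψ := by
    have hc : ContinuousAt (extChartAt (𝓡 2) x₀).symm y := continuousAt_extChartAt_symm'' hy
    filter_upwards [hc.preimage_mem_nhds ((isOpen_extChartAt_source x₁).mem_nhds hy')] with z hz
    exact ((extChartAt (𝓡 2) x₁).left_inv hz).symm
  have hψd : MDifferentiableAt 𝓘(ℝ, Plane) 𝓘(ℝ, Plane) ψ y := by
    apply MDifferentiableAt.comp y (I' := 𝓡 2)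
    · exact mdifferentiableAt_extChartAt (by rwa [extChartAt_source] at hy')
    · exact mdifferentiableAt_symm hy
  have ht : ψ y ∈ (extChartAt (𝓡 2) x₁).target := (extChartAt (𝓡 2) x₁).map_source hy'
  -- The chain rule for φ₀⁻¹ = φ₁⁻¹ ∘ ψ. The two sides lie in tangent spaces at points that are only
  -- propositionally equal, so the identity is stated in the model plane and transferred through
  -- `tangentInner`.
  have hD : ∀ w : Plane, (chartLin x₀ y w : Plane) = (chartLin x₁ (ψ y) (fderiv ℝ ψ y w) : Plane) := by
    intro w
    have h1 := hev.mfderiv_eq (I := 𝓘(ℝ, Plane)) (I' := 𝓡 2)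
    have h2 : mfderiv 𝓘(ℝ, Plane) (𝓡 2) ((extChartAt (𝓡 2) x₁).symm ∘ ψ) y = _ :=
      mfderiv_comp y (mdifferentiableAt_symm ht) hψd
    rw [mfderiv_eq_fderiv] at h2
    have h3 := DFunLike.congr_fun (h1.trans h2) w
    exact h3
  have hG : ∀ v w : Plane, inner ℝ (chartLin x₀ y v) (chartLin x₀ y w) =
      inner ℝ (chartLin x₁ (ψ y) (fderiv ℝ ψ y v)) (chartLin x₁ (ψ y) (fderiv ℝ ψ y w)) := by
    intro v w
    change tangentInner ((extChartAt (𝓡 2) x₀).symm y) (chartLin x₀ y v) (chartLin x₀ y w) =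
      tangentInner ((extChartAt (𝓡 2) x₁).symm (ψ y)) (chartLin x₁ (ψ y) (fderiv ℝ ψ y v))
        (chartLin x₁ (ψ y) (fderiv ℝ ψ y w))
    rw [hD v, hD w, hpt]
  have hdet : (fderiv ℝ ψ y).det =
      fderiv ℝ ψ y (EuclideanSpace.single 0 1) 0 * fderiv ℝ ψ y (EuclideanSpace.single 1 1) 1
      - fderiv ℝ ψ y (EuclideanSpace.single 1 1) 0 * fderiv ℝ ψ y (EuclideanSpace.single 0 1) 1 := by
    rw [ContinuousLinearMap.det, ← LinearMap.det_toMatrix (EuclideanSpace.basisFun (Fin 2) ℝ).toBasis,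
      Matrix.det_fin_two]
    simp [LinearMap.toMatrix_apply]
  rw [← hψy, hdet, det_metricMatrix x₀ y]
  simp only [metricMatrix_apply x₀, coordVec_eq, hG]
  simp only [inner_chartLin, det_metricMatrix]
  ring

/-- Near each point there is a ball of the chart on which a property that holds near the centre
holds. -/
theorem exists_ball_subset (x₀ : M) {P : Plane → Prop}
    (hP : ∀ᶠ y in 𝓝 (extChartAt (𝓡 2) x₀ x₀), P y) :
    ∃ r > 0, Metric.ball (extChartAt (𝓡 2) x₀ x₀) r ⊆ (extChartAt (𝓡 2) x₀).target ∧
      (∀ y ∈ Metric.ball (extChartAt (𝓡 2) x₀ x₀) r, P y) := by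
  obtain ⟨r, hr, h⟩ := Metric.eventually_nhds_iff_ball.1
    (hP.and ((isOpen_target x₀).mem_nhds (mem_extChartAt_target x₀)))
  exact ⟨r, hr, fun y hy => (h y hy).2, fun y hy => (h y hy).1⟩

theorem chart_preimage_mem_nhds (x₀ : M) {B : Set Plane} (hB : B ∈ 𝓝 (extChartAt (𝓡 2) x₀ x₀)) :
    (extChartAt (𝓡 2) x₀).source ∩ extChartAt (𝓡 2) x₀ ⁻¹' B ∈ 𝓝 x₀ :=
  inter_mem (extChartAt_source_mem_nhds x₀) ((continuousAt_extChartAt x₀).preimage_mem_nhds hB)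

variable [IsContMDiffRiemannianBundle (𝓡 2) ∞ Plane (fun x : M => TangentSpace (𝓡 2) x)]

theorem contMDiffOn_coordVec (x₀ : M) (i : Fin 2) :
    ContMDiffOn 𝓘(ℝ, Plane) ((𝓡 2).prod 𝓘(ℝ, Plane)) ∞
      (fun y => (⟨(extChartAt (𝓡 2) x₀).symm y, coordVec x₀ y i⟩ : TangentBundle (𝓡 2) M))
      (extChartAt (𝓡 2) x₀).target := by
  have h1 : ContMDiffOn 𝓘(ℝ, Plane) (𝓡 2) ∞ (extChartAt (𝓡 2) x₀).symm
      (extChartAt (𝓡 2) x₀).target := contMDiffOn_extChartAt_symm x₀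
  have h2 := h1.contMDiffOn_tangentMapWithin (m := ∞) (by simp)
    (isOpen_target x₀).uniqueMDiffOn
  have h3 : ContMDiff 𝓘(ℝ, Plane) (𝓘(ℝ, Plane).prod 𝓘(ℝ, Plane)) ∞
      (fun y => (⟨y, EuclideanSpace.single i (1 : ℝ)⟩ : TangentBundle 𝓘(ℝ, Plane) Plane)) := by
    rw [contMDiff_vectorSpace_iff_contDiff (V := fun _ => EuclideanSpace.single i (1 : ℝ))]
    exact contDiff_const
  have h4 := h2.comp h3.contMDiffOn (s := (extChartAt (𝓡 2) x₀).target) (fun y hy => hy)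
  refine h4.congr fun y hy => ?_
  simp only [Function.comp, tangentMapWithin]
  rw [mfderivWithin_of_isOpen (isOpen_target x₀) hy]
  rfl

theorem contDiffOn_metricMatrix (x₀ : M) (i j : Fin 2) :
    ContDiffOn ℝ ∞ (fun y => metricMatrix x₀ y i j) (extChartAt (𝓡 2) x₀).target := by
  rw [← contMDiffOn_iff_contDiffOn]
  exact (contMDiffOn_coordVec x₀ i).inner_bundle (contMDiffOn_coordVec x₀ j)

theorem continuousOn_det_metricMatrix (x₀ : M) :
    ContinuousOn (fun y => (metricMatrix x₀ y).det) (extChartAt (𝓡 2) x₀).target := by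
  have h := fun i j => (contDiffOn_metricMatrix x₀ i j).continuousOn
  simp only [det_metricMatrix]
  exact ((h 0 0).mul (h 1 1)).sub ((h 0 1).pow 2)

theorem isContinuousRiemannianBundle :
    IsContinuousRiemannianBundle Plane (fun x : M => TangentSpace (𝓡 2) x) := by
  obtain ⟨g, hg, hg'⟩ := IsContMDiffRiemannianBundle.exists_contMDiff (IB := 𝓡 2) (n := ∞)
    (F := Plane) (E := fun x : M => TangentSpace (𝓡 2) x)
  exact ⟨g, hg.continuous, hg'⟩

end

/-! ### The Riemannian volume in charts. -/

section

variable {M : Type*} [TopologicalSpace M] [ChartedSpace Plane M] [IsManifold (𝓡 2) ∞ M]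
  [RiemannianBundle (fun x : M => TangentSpace (𝓡 2) x)]
  [IsContMDiffRiemannianBundle (𝓡 2) ∞ Plane (fun x : M => TangentSpace (𝓡 2) x)]

/-- The density of the Riemannian volume in the chart around `x₀`. -/
def dens (x₀ : M) (y : Plane) : ℝ := Real.sqrt (metricMatrix x₀ y).det

theorem dens_pos {x₀ : M} {y : Plane} (hy : y ∈ (extChartAt (𝓡 2) x₀).target) : 0 < dens x₀ y :=
  Real.sqrt_pos.2 (det_metricMatrix_pos hy)

theorem continuousOn_dens (x₀ : M) : ContinuousOn (dens x₀) (extChartAt (𝓡 2) x₀).target :=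
  (continuousOn_det_metricMatrix x₀).sqrt

theorem aemeasurable_ofReal_dens (x₀ : M) {B : Set Plane}
    (hB : B ⊆ (extChartAt (𝓡 2) x₀).target) :
    AEMeasurable (fun y => ENNReal.ofReal (dens x₀ y)) (volume.restrict B) :=
  (((continuousOn_dens x₀).aemeasurable (isOpen_target x₀).measurableSet).ennreal_ofReal).mono_measure
    (Measure.restrict_mono hB le_rfl)

theorem measurableSet_inter_preimage_of_continuousOn {α β : Type*} [TopologicalSpace α]
    [MeasurableSpace α] [BorelSpace α] [TopologicalSpace β] [MeasurableSpace β] [BorelSpace β]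
    {f : α → β} {s : Set α} (hf : ContinuousOn f s) (hs : MeasurableSet s) {t : Set β}
    (ht : MeasurableSet t) : MeasurableSet (s ∩ f ⁻¹' t) := by
  have h1 : Measurable (s.domRestrict f) :=
    (continuousOn_iff_continuous_domRestrict.1 hf).measurable
  have h2 := hs.subtype_image (h1 ht)
  convert h2 using 1
  ext x
  simp [Set.domRestrict, and_comm]

variable [MeasurableSpace M] [BorelSpace M]

theorem measurableSet_source (x₀ : M) : MeasurableSet (extChartAt (𝓡 2) x₀).source :=
  (isOpen_extChartAt_source x₀).measurableSet

theorem measurableSet_target (x₀ : M) : MeasurableSet (extChartAt (𝓡 2) x₀).target :=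
  (isOpen_target x₀).measurableSet

theorem measurableSet_target_inter (x₀ : M) {A : Set M} (hA : MeasurableSet A) :
    MeasurableSet ((extChartAt (𝓡 2) x₀).target ∩ (extChartAt (𝓡 2) x₀).symm ⁻¹' A) :=
  measurableSet_inter_preimage_of_continuousOn (continuousOn_extChartAt_symm x₀)
    (measurableSet_target x₀) hA

theorem measurableSet_source_inter (x₀ : M) {B : Set Plane} (hB : MeasurableSet B) :
    MeasurableSet ((extChartAt (𝓡 2) x₀).source ∩ extChartAt (𝓡 2) x₀ ⁻¹' B) :=
  measurableSet_inter_preimage_of_continuousOn (continuousOn_extChartAt x₀)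
    (measurableSet_source x₀) hB

theorem aemeasurable_symm (x₀ : M) {B : Set Plane} (hB : B ⊆ (extChartAt (𝓡 2) x₀).target) :
    AEMeasurable (extChartAt (𝓡 2) x₀).symm (volume.restrict B) :=
  ((continuousOn_extChartAt_symm x₀).aemeasurable (measurableSet_target x₀)).mono_measure
    (Measure.restrict_mono hB le_rfl)

theorem aemeasurable_symm' (x₀ : M) {B : Set Plane} (hB : B ⊆ (extChartAt (𝓡 2) x₀).target) :
    AEMeasurable (extChartAt (𝓡 2) x₀).symm
      ((volume.restrict B).withDensity fun y => ENNReal.ofReal (dens x₀ y)) :=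
  (aemeasurable_symm x₀ hB).mono_ac (withDensity_absolutelyContinuous _ _)

theorem chartVol_apply (x₀ : M) {A : Set M} (hA : MeasurableSet A) :
    chartVol x₀ A = ∫⁻ y in (extChartAt (𝓡 2) x₀).target ∩ (extChartAt (𝓡 2) x₀).symm ⁻¹' A,
      ENNReal.ofReal (dens x₀ y) := by
  have hcv : chartVol x₀ = ((volume.restrict (extChartAt (𝓡 2) x₀).target).withDensity
      fun y => ENNReal.ofReal (dens x₀ y)).map (extChartAt (𝓡 2) x₀).symm := rfl
  rw [hcv, Measure.map_apply_of_aemeasurable (aemeasurable_symm' x₀ subset_rfl) hA,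
    withDensity_apply', Measure.restrict_restrict' (measurableSet_target x₀), inter_comm]

/-- Change of variables along the transition map: its Jacobian |det D| is absorbed by the transition
law of √(det g). -/
theorem chartVol_eq_of_subset {x₀ x₁ : M} {A : Set M} (hA : MeasurableSet A)
    (h₀ : A ⊆ (extChartAt (𝓡 2) x₀).source) (h₁ : A ⊆ (extChartAt (𝓡 2) x₁).source) :
    chartVol x₀ A = chartVol x₁ A := by
  rw [chartVol_apply x₀ hA, chartVol_apply x₁ hA]
  set S := (extChartAt (𝓡 2) x₀).target ∩ (extChartAt (𝓡 2) x₀).symm ⁻¹' A with hS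
  set ψ := extChartAt (𝓡 2) x₁ ∘ (extChartAt (𝓡 2) x₀).symm with hψ
  have himg : (extChartAt (𝓡 2) x₁).target ∩ (extChartAt (𝓡 2) x₁).symm ⁻¹' A = ψ '' S := by
    ext z
    constructor
    · rintro ⟨hz, hzA⟩
      refine ⟨extChartAt (𝓡 2) x₀ ((extChartAt (𝓡 2) x₁).symm z), ⟨?_, ?_⟩, ?_⟩
      · exact (extChartAt (𝓡 2) x₀).map_source (h₀ hzA)
      · rw [mem_preimage, (extChartAt (𝓡 2) x₀).left_inv (h₀ hzA)]; exact hzA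
      · simp only [hψ, Function.comp]
        rw [(extChartAt (𝓡 2) x₀).left_inv (h₀ hzA), (extChartAt (𝓡 2) x₁).right_inv hz]
    · rintro ⟨y, ⟨hy, hyA⟩, rfl⟩
      refine ⟨(extChartAt (𝓡 2) x₁).map_source (h₁ hyA), ?_⟩
      rw [mem_preimage]
      simp only [hψ, Function.comp]
      rw [(extChartAt (𝓡 2) x₁).left_inv (h₁ hyA)]
      exact hyA
  have hinj : InjOn ψ S := by
    rintro y ⟨hy, hyA⟩ z ⟨hz, hzA⟩ hyz
    have := (extChartAt (𝓡 2) x₁).injOn (h₁ hyA) (h₁ hzA) hyz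
    exact (extChartAt (𝓡 2) x₀).symm.injOn hy hz this
  have hder : ∀ y ∈ S, HasFDerivWithinAt ψ (fderiv ℝ ψ y) S y := by
    rintro y ⟨hy, hyA⟩
    have : MDifferentiableAt 𝓘(ℝ, Plane) 𝓘(ℝ, Plane) ψ y := by
      apply MDifferentiableAt.comp y (I' := 𝓡 2)
      · have := h₁ hyA
        exact mdifferentiableAt_extChartAt (by rwa [extChartAt_source] at this)
      · exact mdifferentiableAt_symm hy
    exact this.differentiableAt.hasFDerivAt.hasFDerivWithinAt
  rw [himg, lintegral_image_eq_lintegral_abs_det_fderiv_mul volume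
    (measurableSet_target_inter x₀ hA) hder hinj]
  refine setLIntegral_congr_fun (measurableSet_target_inter x₀ hA) ?_
  rintro y ⟨hy, hyA⟩
  simp only
  rw [← ENNReal.ofReal_mul (abs_nonneg _)]
  congr 1
  rw [dens, metricMatrix_transition hy (h₁ hyA), Real.sqrt_mul (sq_nonneg _), Real.sqrt_sq_eq_abs]
  rfl

theorem chartVol_inter_source (x₀ : M) {A : Set M} (hA : MeasurableSet A) :
    chartVol x₀ (A ∩ (extChartAt (𝓡 2) x₀).source) = chartVol x₀ A := by
  rw [chartVol_apply x₀ hA, chartVol_apply x₀ (hA.inter (measurableSet_source x₀))]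
  congr 2
  ext y
  simp only [mem_inter_iff, mem_preimage]
  exact ⟨fun h => ⟨h.1, h.2.1⟩, fun h => ⟨h.1, h.2, (extChartAt (𝓡 2) x₀).map_target h.1⟩⟩

/-- A supremum of measures is not computed set by set, so the upper bound exhibits a measure κ that
dominates every chart measure: `chartVol x₀` plus infinite mass at each point outside the chart
domain. Sets inside the domain are handled by chart independence; on all other sets κ is infinite.
-/
theorem vol_restrict_source (x₀ : M) :
    (vol M).restrict (extChartAt (𝓡 2) x₀).source = chartVol x₀ := by
  apply le_antisymm
  · set κ : Measure M := chartVol x₀ +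
      (⊤ : ℝ≥0∞) • (Measure.count.restrict (extChartAt (𝓡 2) x₀).sourceᶜ) with hκ
    have hle : vol M ≤ κ := by
      refine iSup_le fun x₁ => Measure.le_iff.2 fun A hA => ?_
      by_cases hAU : A ⊆ (extChartAt (𝓡 2) x₀).source
      · calc chartVol x₁ A = chartVol x₁ (A ∩ (extChartAt (𝓡 2) x₁).source) :=
              (chartVol_inter_source x₁ hA).symm
          _ = chartVol x₀ (A ∩ (extChartAt (𝓡 2) x₁).source) :=
              chartVol_eq_of_subset (hA.inter (measurableSet_source x₁)) inter_subset_right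
                (inter_subset_left.trans hAU)
          _ ≤ chartVol x₀ A := measure_mono inter_subset_left
          _ ≤ κ A := by rw [hκ, Measure.add_apply]; exact le_self_add
      · have hne : (A ∩ (extChartAt (𝓡 2) x₀).sourceᶜ).Nonempty := by
          obtain ⟨a, ha, ha'⟩ := not_subset.1 hAU
          exact ⟨a, ha, ha'⟩
        have hm := hA.inter (measurableSet_source x₀).compl
        have : κ A = ⊤ := by
          rw [hκ, Measure.add_apply, Measure.smul_apply, Measure.restrict_apply hA,
            smul_eq_mul, ENNReal.top_mul, add_top]
          rw [Measure.count_ne_zero_iff]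
          exact hne
        rw [this]; exact le_top
    refine (Measure.restrict_mono le_rfl hle).trans ?_
    refine Measure.le_iff.2 fun A hA => ?_
    rw [Measure.restrict_apply hA, hκ, Measure.add_apply, Measure.smul_apply,
      Measure.restrict_apply (hA.inter (measurableSet_source x₀)), inter_assoc, inter_compl_self,
      inter_empty, measure_empty, smul_zero, add_zero]
    exact measure_mono inter_subset_left
  · refine Measure.le_iff.2 fun A hA => ?_
    rw [Measure.restrict_apply hA, ← chartVol_inter_source x₀ hA]
    exact le_iSup (fun x : M => chartVol x) x₀ _

/-- The Riemannian volume in a chart. -/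
theorem vol_restrict_chart (x₀ : M) {B : Set Plane} (hBm : MeasurableSet B)
    (hB : B ⊆ (extChartAt (𝓡 2) x₀).target) :
    (vol M).restrict ((extChartAt (𝓡 2) x₀).source ∩ extChartAt (𝓡 2) x₀ ⁻¹' B) =
      ((volume.restrict B).withDensity fun y => ENNReal.ofReal (dens x₀ y)).map
        (extChartAt (𝓡 2) x₀).symm := by
  have hW := measurableSet_source_inter x₀ hBm
  have h1 : (vol M).restrict ((extChartAt (𝓡 2) x₀).source ∩ extChartAt (𝓡 2) x₀ ⁻¹' B) =
      (chartVol x₀).restrict ((extChartAt (𝓡 2) x₀).source ∩ extChartAt (𝓡 2) x₀ ⁻¹' B) := by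
    rw [← vol_restrict_source, Measure.restrict_restrict hW, inter_assoc, inter_comm _
      (extChartAt (𝓡 2) x₀).source, ← inter_assoc, inter_self]
  rw [h1]
  refine Measure.ext fun A hA => ?_
  rw [Measure.restrict_apply hA, chartVol_apply x₀ (hA.inter hW),
    Measure.map_apply_of_aemeasurable (aemeasurable_symm' x₀ hB) hA,
    withDensity_apply', Measure.restrict_restrict' hBm]
  congr 2
  ext y
  simp only [mem_inter_iff, mem_preimage]
  constructor
  · rintro ⟨hy, hyA, -, hyB⟩
    rw [(extChartAt (𝓡 2) x₀).right_inv hy] at hyB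
    exact ⟨hyA, hyB⟩
  · rintro ⟨hyA, hyB⟩
    refine ⟨hB hyB, hyA, (extChartAt (𝓡 2) x₀).map_target (hB hyB), ?_⟩
    rwa [(extChartAt (𝓡 2) x₀).right_inv (hB hyB)]

theorem lintegral_chart (x₀ : M) {B : Set Plane} (hBm : MeasurableSet B)
    (hB : B ⊆ (extChartAt (𝓡 2) x₀).target) {f : M → ℝ≥0∞} (hf : AEMeasurable f (vol M)) :
    ∫⁻ x in (extChartAt (𝓡 2) x₀).source ∩ extChartAt (𝓡 2) x₀ ⁻¹' B, f x ∂(vol M) =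
      ∫⁻ y in B, ENNReal.ofReal (dens x₀ y) * f ((extChartAt (𝓡 2) x₀).symm y) := by
  have hf' := hf.restrict (s := (extChartAt (𝓡 2) x₀).source ∩ extChartAt (𝓡 2) x₀ ⁻¹' B)
  rw [vol_restrict_chart x₀ hBm hB] at hf' ⊢
  have hs := aemeasurable_symm' x₀ hB
  rw [lintegral_map' hf' hs]
  exact lintegral_withDensity_eq_lintegral_mul₀' (aemeasurable_ofReal_dens x₀ hB)
    (hf'.comp_aemeasurable hs)

theorem ae_withDensity_dens (x₀ : M) {B : Set Plane} (hBm : MeasurableSet B)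
    (hB : B ⊆ (extChartAt (𝓡 2) x₀).target) :
    ae ((volume.restrict B).withDensity fun y => ENNReal.ofReal (dens x₀ y)) =
      ae (volume.restrict B) := by
  apply le_antisymm
  · exact (withDensity_absolutelyContinuous _ _).ae_le
  · refine (withDensity_absolutelyContinuous' (aemeasurable_ofReal_dens x₀ hB) ?_).ae_le
    filter_upwards [ae_restrict_mem hBm] with y hy
    simpa using dens_pos (hB hy)

theorem ae_of_ae_chart (x₀ : M) {B : Set Plane} (hBm : MeasurableSet B)
    (hB : B ⊆ (extChartAt (𝓡 2) x₀).target) {P : M → Prop}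
    (h : ∀ᵐ x ∂(vol M).restrict ((extChartAt (𝓡 2) x₀).source ∩ extChartAt (𝓡 2) x₀ ⁻¹' B), P x) :
    ∀ᵐ y ∂(volume.restrict B), P ((extChartAt (𝓡 2) x₀).symm y) := by
  rw [vol_restrict_chart x₀ hBm hB] at h
  have := ae_of_ae_map (aemeasurable_symm' x₀ hB) h
  rwa [ae_withDensity_dens x₀ hBm hB] at this

theorem ae_chart_of_ae (x₀ : M) {B : Set Plane} (hBm : MeasurableSet B)
    (hB : B ⊆ (extChartAt (𝓡 2) x₀).target) {P : M → Prop}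
    (h : ∀ᵐ y ∂(volume.restrict B), P ((extChartAt (𝓡 2) x₀).symm y)) :
    ∀ᵐ x ∂(vol M).restrict ((extChartAt (𝓡 2) x₀).source ∩ extChartAt (𝓡 2) x₀ ⁻¹' B), P x := by
  have hW := measurableSet_source_inter x₀ hBm
  have hφ : AEMeasurable (extChartAt (𝓡 2) x₀)
      ((vol M).restrict ((extChartAt (𝓡 2) x₀).source ∩ extChartAt (𝓡 2) x₀ ⁻¹' B)) :=
    ((continuousOn_extChartAt x₀).aemeasurable (measurableSet_source x₀)).mono_measure
      (Measure.restrict_mono inter_subset_left le_rfl)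
  have hmap : ((vol M).restrict ((extChartAt (𝓡 2) x₀).source ∩ extChartAt (𝓡 2) x₀ ⁻¹' B)).map
      (extChartAt (𝓡 2) x₀) =
      (volume.restrict B).withDensity fun y => ENNReal.ofReal (dens x₀ y) := by
    rw [vol_restrict_chart x₀ hBm hB] at hφ ⊢
    rw [AEMeasurable.map_map_of_aemeasurable hφ (aemeasurable_symm' x₀ hB)]
    conv_rhs => rw [← Measure.map_id (μ := (volume.restrict B).withDensity
      fun y => ENNReal.ofReal (dens x₀ y))]
    apply Measure.map_congr
    rw [EventuallyEq, ae_withDensity_dens x₀ hBm hB]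
    filter_upwards [ae_restrict_mem hBm] with y hy
    exact (extChartAt (𝓡 2) x₀).right_inv (hB hy)
  have h2 : ∀ᵐ y ∂(((vol M).restrict ((extChartAt (𝓡 2) x₀).source ∩
      extChartAt (𝓡 2) x₀ ⁻¹' B)).map (extChartAt (𝓡 2) x₀)),
      P ((extChartAt (𝓡 2) x₀).symm y) := by
    rw [hmap, ae_withDensity_dens x₀ hBm hB]
    exact h
  filter_upwards [ae_of_ae_map hφ h2, ae_restrict_mem hW] with x hx hxW
  rwa [(extChartAt (𝓡 2) x₀).left_inv hxW.1] at hx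

theorem integral_chart (x₀ : M) {B : Set Plane} (hBm : MeasurableSet B)
    (hB : B ⊆ (extChartAt (𝓡 2) x₀).target) {f : M → ℝ} (hf : AEStronglyMeasurable f (vol M)) :
    ∫ x in (extChartAt (𝓡 2) x₀).source ∩ extChartAt (𝓡 2) x₀ ⁻¹' B, f x ∂(vol M) =
      ∫ y in B, dens x₀ y * f ((extChartAt (𝓡 2) x₀).symm y) := by
  have hf' := hf.restrict (s := (extChartAt (𝓡 2) x₀).source ∩ extChartAt (𝓡 2) x₀ ⁻¹' B)
  rw [vol_restrict_chart x₀ hBm hB] at hf' ⊢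
  have hs := aemeasurable_symm' x₀ hB
  rw [integral_map hs hf']
  rw [integral_withDensity_eq_integral_toReal_smul₀ (aemeasurable_ofReal_dens x₀ hB)
    (Eventually.of_forall fun _ => ENNReal.ofReal_lt_top)]
  refine integral_congr_ae ?_
  filter_upwards [ae_restrict_mem hBm] with y hy
  simp only [smul_eq_mul]
  rw [ENNReal.toReal_ofReal (dens_pos (hB hy)).le]

/-- With compactness this makes `vol M` a finite measure, a fact that later estimates use through
instance search. -/
instance isLocallyFiniteMeasure_vol : IsLocallyFiniteMeasure (vol M) := by
  refine ⟨fun x => ?_⟩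
  have hc := (continuousOn_dens x).continuousAt ((isOpen_target x).mem_nhds (mem_extChartAt_target x))
  obtain ⟨r, hr, hB, h⟩ := exists_ball_subset x
    (hc.eventually_lt (continuousAt_const (y := dens x (extChartAt (𝓡 2) x x) + 1)) (by simp))
  refine ⟨_, chart_preimage_mem_nhds x (Metric.ball_mem_nhds _ hr), ?_⟩
  have h1 := lintegral_chart x Metric.isOpen_ball.measurableSet hB (f := fun _ => 1)
    aemeasurable_const
  rw [setLIntegral_one] at h1
  rw [h1]
  calc ∫⁻ y in Metric.ball (extChartAt (𝓡 2) x x) r, ENNReal.ofReal (dens x y) * 1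
      ≤ ∫⁻ y in Metric.ball (extChartAt (𝓡 2) x x) r,
          ENNReal.ofReal (dens x (extChartAt (𝓡 2) x x) + 1) := by
        refine setLIntegral_mono' Metric.isOpen_ball.measurableSet fun y hy => ?_
        rw [mul_one]
        exact ENNReal.ofReal_le_ofReal (h y hy).le
    _ < ⊤ := by
        rw [setLIntegral_const]
        exact ENNReal.mul_lt_top ENNReal.ofReal_lt_top measure_ball_lt_top

end

/-! ### Gradients, and uniform bounds for the metric in a chart ball. -/

section

variable {M : Type*} [TopologicalSpace M] [ChartedSpace Plane M] [IsManifold (𝓡 2) ∞ M]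
  [RiemannianBundle (fun x : M => TangentSpace (𝓡 2) x)]
  [IsContMDiffRiemannianBundle (𝓡 2) ∞ Plane (fun x : M => TangentSpace (𝓡 2) x)]

theorem exists_chart_point (x : M) :
    ∃ (x₀ : M) (y : Plane), y ∈ (extChartAt (𝓡 2) x₀).target ∧ (extChartAt (𝓡 2) x₀).symm y = x :=
  ⟨x, extChartAt (𝓡 2) x x, mem_extChartAt_target x, extChartAt_to_inv x⟩

theorem mdifferentiableAt_iff_chart {f : M → ℝ} {x₀ : M} {y : Plane}
    (hy : y ∈ (extChartAt (𝓡 2) x₀).target) :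
    MDifferentiableAt (𝓡 2) 𝓘(ℝ, ℝ) f ((extChartAt (𝓡 2) x₀).symm y) ↔
      DifferentiableAt ℝ (f ∘ (extChartAt (𝓡 2) x₀).symm) y := by
  constructor
  · intro h
    exact (h.comp y (mdifferentiableAt_symm hy)).differentiableAt
  · intro h
    have hs := (extChartAt (𝓡 2) x₀).map_target hy
    have h1 : MDifferentiableAt (𝓡 2) 𝓘(ℝ, Plane) (extChartAt (𝓡 2) x₀)
        ((extChartAt (𝓡 2) x₀).symm y) :=
      mdifferentiableAt_extChartAt (by rwa [extChartAt_source] at hs)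
    have h2 : MDifferentiableAt 𝓘(ℝ, Plane) 𝓘(ℝ, ℝ) (f ∘ (extChartAt (𝓡 2) x₀).symm)
        (extChartAt (𝓡 2) x₀ ((extChartAt (𝓡 2) x₀).symm y)) := by
      rw [(extChartAt (𝓡 2) x₀).right_inv hy]
      exact h.mdifferentiableAt
    refine (MDifferentiableAt.comp _ h2 h1).congr_of_eventuallyEq ?_
    filter_upwards [(isOpen_extChartAt_source x₀).mem_nhds hs] with z hz
    simp only [Function.comp]
    rw [(extChartAt (𝓡 2) x₀).left_inv hz]

theorem eq_of_inner_chartLin {x₀ : M} {y : Plane} (hy : y ∈ (extChartAt (𝓡 2) x₀).target)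
    {v v' : TangentSpace (𝓡 2) ((extChartAt (𝓡 2) x₀).symm y)}
    (h : ∀ w, inner ℝ v (chartLin x₀ y w) = inner ℝ v' (chartLin x₀ y w)) : v = v' := by
  refine ext_inner_right ℝ fun z => ?_
  obtain ⟨w, rfl⟩ := (chartLin_bijective hy).2 z
  exact h w

theorem grad_sub {f g : M → ℝ} {x : M} (hf : MDifferentiableAt (𝓡 2) 𝓘(ℝ, ℝ) f x)
    (hg : MDifferentiableAt (𝓡 2) 𝓘(ℝ, ℝ) g x) :
    grad (fun x => f x - g x) x = grad f x - grad g x := by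
  obtain ⟨x₀, y, hy, rfl⟩ := exists_chart_point x
  have hf' := (mdifferentiableAt_iff_chart hy).1 hf
  have hg' := (mdifferentiableAt_iff_chart hy).1 hg
  refine eq_of_inner_chartLin hy fun w => ?_
  rw [inner_sub_left, inner_grad_chartLin hy hf, inner_grad_chartLin hy hg,
    inner_grad_chartLin hy ((mdifferentiableAt_iff_chart (f := fun x => f x - g x) hy).2 (hf'.sub hg'))]
  change fderiv ℝ (f ∘ (extChartAt (𝓡 2) x₀).symm - g ∘ (extChartAt (𝓡 2) x₀).symm) y w = _
  rw [fderiv_sub hf' hg']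
  rfl

/-- The chain rule for gradients. -/
theorem grad_comp {f : M → ℝ} {x : M} (hf : MDifferentiableAt (𝓡 2) 𝓘(ℝ, ℝ) f x) {h : ℝ → ℝ}
    {h' : ℝ} (hh : HasDerivAt h h' (f x)) :
    grad (fun x => h (f x)) x = h' • grad f x := by
  obtain ⟨x₀, y, hy, rfl⟩ := exists_chart_point x
  have hf' := (mdifferentiableAt_iff_chart hy).1 hf
  have hc := hh.comp_hasFDerivAt y (f := f ∘ (extChartAt (𝓡 2) x₀).symm) hf'.hasFDerivAt
  refine eq_of_inner_chartLin hy fun w => ?_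
  rw [real_inner_smul_left, inner_grad_chartLin hy hf,
    inner_grad_chartLin hy ((mdifferentiableAt_iff_chart hy).2 hc.differentiableAt)]
  change fderiv ℝ (h ∘ f ∘ (extChartAt (𝓡 2) x₀).symm) y w = _
  rw [hc.fderiv]
  rfl

theorem grad_eq_of_eventuallyEq {f g : M → ℝ} {x : M} (h : f =ᶠ[𝓝 x] g) : grad f x = grad g x := by
  refine ext_inner_right ℝ fun v => ?_
  rw [inner_grad, inner_grad]
  exact DFunLike.congr_fun h.mfderiv_eq v

theorem grad_of_not_mdifferentiableAt {f : M → ℝ} {x : M}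
    (h : ¬ MDifferentiableAt (𝓡 2) 𝓘(ℝ, ℝ) f x) : grad f x = 0 := by
  refine ext_inner_right ℝ fun v => ?_
  rw [inner_grad, mfderiv_zero_of_not_mdifferentiableAt h, inner_zero_left]
  rfl

theorem grad_const (c : ℝ) (x : M) : grad (fun _ => c) x = 0 := by
  refine ext_inner_right ℝ fun v => ?_
  rw [inner_grad, mfderiv_const, inner_zero_left]
  rfl

/-- Uniform bounds for the metric in a ball of the chart around `x₀`. -/
theorem exists_chart_bounds (x₀ : M) :
    ∃ r > 0, ∃ C : ℝ, 1 ≤ C ∧ Metric.ball (extChartAt (𝓡 2) x₀ x₀) r ⊆ (extChartAt (𝓡 2) x₀).target ∧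
      ∀ y ∈ Metric.ball (extChartAt (𝓡 2) x₀ x₀) r,
        1 ≤ C * dens x₀ y ∧ dens x₀ y ≤ C ∧ (∀ w, ‖chartLin x₀ y w‖ ≤ C * ‖w‖) ∧
        ∀ v : TangentSpace (𝓡 2) ((extChartAt (𝓡 2) x₀).symm y),
          ‖v‖ ≤ C * (|inner ℝ v (coordVec x₀ y 0)| + |inner ℝ v (coordVec x₀ y 1)|) := by
  set y₀ := extChartAt (𝓡 2) x₀ x₀ with hy₀
  have hnhds := (isOpen_target x₀).mem_nhds (mem_extChartAt_target x₀)
  have hd := (continuousOn_dens x₀).continuousAt hnhds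
  have hG := fun i j => ((contDiffOn_metricMatrix x₀ i j).continuousOn.continuousAt hnhds).abs
  have hpos : 0 < dens x₀ y₀ := dens_pos (mem_extChartAt_target x₀)
  set d₀ := dens x₀ y₀
  set K := |metricMatrix x₀ y₀ 0 0| + |metricMatrix x₀ y₀ 0 1| + |metricMatrix x₀ y₀ 1 1| + 1 with hK
  have hK1 : 1 ≤ K := by rw [hK]; have := abs_nonneg (metricMatrix x₀ y₀ 0 0)
                         have := abs_nonneg (metricMatrix x₀ y₀ 0 1)
                         have := abs_nonneg (metricMatrix x₀ y₀ 1 1); linarith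
  have hlt : ∀ i j, |metricMatrix x₀ y₀ i j| < K → ∀ᶠ y in 𝓝 y₀, |metricMatrix x₀ y i j| < K :=
    fun i j h => (hG i j).eventually_lt continuousAt_const h
  have a0 := abs_nonneg (metricMatrix x₀ y₀ 0 0)
  have a1 := abs_nonneg (metricMatrix x₀ y₀ 0 1)
  have a2 := abs_nonneg (metricMatrix x₀ y₀ 1 1)
  obtain ⟨r, hr, hB, h⟩ := exists_ball_subset x₀
    ((((hlt 0 0 (by linarith)).and (hlt 0 1 (by linarith))).and (hlt 1 1 (by linarith))).and
      ((hd.eventually_lt (continuousAt_const (y := 2 * d₀)) (by linarith)).and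
        ((continuousAt_const (y := d₀ / 2)).eventually_lt hd (by linarith))))
  -- `C` majorises the constants for the metric, for the density from above and from below, and for
  -- the inverse metric, whose entries are at most K / det g ≤ 4K / d₀².
  obtain ⟨C, c1, c2, c3, c4⟩ :
      ∃ C : ℝ, K * 4 ≤ C ∧ 2 * d₀ ≤ C ∧ 2 / d₀ ≤ C ∧ 4 * K / d₀ ^ 2 ≤ C := by
    have p1 : 0 < 2 / d₀ := by positivity
    have p2 : 0 < 4 * K / d₀ ^ 2 := by positivity
    exact ⟨K * 4 + 2 * d₀ + 2 / d₀ + 4 * K / d₀ ^ 2, by linarith, by linarith, by linarith,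
      by linarith⟩
  refine ⟨r, hr, C, by linarith, hB, fun y hy => ?_⟩
  obtain ⟨⟨⟨h00, h01⟩, h11⟩, hdu, hdl⟩ := h y hy
  have hyt := hB hy
  have hC1 : 1 ≤ C := by linarith
  refine ⟨?_, by linarith, fun w => ?_, fun v => ?_⟩
  · have : 1 = 2 / d₀ * (d₀ / 2) := by field_simp
    rw [this]
    apply mul_le_mul _ hdl.le (by positivity) (by linarith)
    linarith
  · refine le_of_sq_le_sq ?_ (by positivity)
    rw [norm_chartLin_sq, mul_pow, EuclideanSpace.norm_sq_eq, Fin.sum_univ_two,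
      Real.norm_eq_abs, Real.norm_eq_abs, sq_abs, sq_abs]
    have hCK : 2 * K ≤ C ^ 2 := by nlinarith only [hC1, c1, hK1]
    have e0 := le_abs_self (metricMatrix x₀ y 0 0)
    have e1 := le_abs_self (metricMatrix x₀ y 1 1)
    have e2 := abs_le.1 h01.le
    have t0 : w 0 ^ 2 * metricMatrix x₀ y 0 0 ≤ w 0 ^ 2 * K :=
      mul_le_mul_of_nonneg_left (by linarith) (sq_nonneg _)
    have t1 : w 1 ^ 2 * metricMatrix x₀ y 1 1 ≤ w 1 ^ 2 * K :=
      mul_le_mul_of_nonneg_left (by linarith) (sq_nonneg _)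
    have t2 : 2 * (w 0 * w 1) * metricMatrix x₀ y 0 1 ≤ (w 0 ^ 2 + w 1 ^ 2) * K := by
      nlinarith [mul_nonneg (sq_nonneg (w 0 + w 1)) (by linarith : 0 ≤ K - metricMatrix x₀ y 0 1),
        mul_nonneg (sq_nonneg (w 0 - w 1)) (by linarith : 0 ≤ K + metricMatrix x₀ y 0 1)]
    calc _ ≤ (2 * K) * (w 0 ^ 2 + w 1 ^ 2) := by linarith
      _ ≤ _ := by gcongr
  · have hdet := det_mul_norm_sq hyt v
    set b0 := inner ℝ v (coordVec x₀ y 0)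
    set b1 := inner ℝ v (coordVec x₀ y 1)
    have hdens : (metricMatrix x₀ y).det = dens x₀ y ^ 2 :=
      (Real.sq_sqrt (det_metricMatrix_pos hyt).le).symm
    have hd2 : d₀ ^ 2 / 4 ≤ dens x₀ y ^ 2 := by nlinarith only [hdl, hpos]
    have hup : (metricMatrix x₀ y).det * ‖v‖ ^ 2 ≤ K * (|b0| + |b1|) ^ 2 := by
      rw [hdet]
      have e0 := le_abs_self (metricMatrix x₀ y 0 0)
      have e1 := le_abs_self (metricMatrix x₀ y 1 1)
      have t0 : metricMatrix x₀ y 1 1 * b0 ^ 2 ≤ K * b0 ^ 2 :=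
        mul_le_mul_of_nonneg_right (by linarith) (sq_nonneg _)
      have t1 : metricMatrix x₀ y 0 0 * b1 ^ 2 ≤ K * b1 ^ 2 :=
        mul_le_mul_of_nonneg_right (by linarith) (sq_nonneg _)
      have t2 : - (2 * metricMatrix x₀ y 0 1 * (b0 * b1)) ≤ 2 * K * (|b0| * |b1|) := by
        rw [← abs_mul]
        calc _ ≤ |2 * metricMatrix x₀ y 0 1 * (b0 * b1)| := neg_le_abs _
          _ = 2 * |metricMatrix x₀ y 0 1| * |b0 * b1| := by rw [abs_mul, abs_mul]; simp
          _ ≤ _ := by gcongr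
      have e : K * (|b0| + |b1|) ^ 2 = K * b0 ^ 2 + 2 * K * (|b0| * |b1|) + K * b1 ^ 2 := by
        rw [← sq_abs b0, ← sq_abs b1]; ring
      rw [e]
      linarith only [t0, t1, t2]
    refine le_of_sq_le_sq ?_ (by positivity)
    have h1 : d₀ ^ 2 / 4 * ‖v‖ ^ 2 ≤ K * (|b0| + |b1|) ^ 2 := by
      refine le_trans ?_ hup
      rw [hdens]
      gcongr
    have h2 : ‖v‖ ^ 2 ≤ (4 * K / d₀ ^ 2) * (|b0| + |b1|) ^ 2 := by
      rw [div_mul_eq_mul_div, le_div_iff₀ (by positivity)]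
      linarith only [h1]
    refine h2.trans ?_
    rw [mul_pow]
    gcongr
    exact c4.trans (by nlinarith only [hC1])

theorem abs_inner_coordVec_le {x₀ : M} {y : Plane} {C : ℝ}
    (hC : ∀ w, ‖chartLin x₀ y w‖ ≤ C * ‖w‖)
    (v : TangentSpace (𝓡 2) ((extChartAt (𝓡 2) x₀).symm y)) (i : Fin 2) :
    |inner ℝ v (coordVec x₀ y i)| ≤ C * ‖v‖ := by
  have := hC (EuclideanSpace.single i 1)
  rw [PiLp.norm_single, norm_one, mul_one] at this
  rw [coordVec_eq, mul_comm]
  exact (abs_real_inner_le_norm _ _).trans (mul_le_mul_of_nonneg_left this (norm_nonneg _))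

theorem norm_fderiv_chart_le {x₀ : M} {y : Plane} {C : ℝ} (hC0 : 0 ≤ C)
    (hC : ∀ w, ‖chartLin x₀ y w‖ ≤ C * ‖w‖) {f : M → ℝ}
    (hy : y ∈ (extChartAt (𝓡 2) x₀).target)
    (hf : MDifferentiableAt (𝓡 2) 𝓘(ℝ, ℝ) f ((extChartAt (𝓡 2) x₀).symm y)) :
    ‖fderiv ℝ (f ∘ (extChartAt (𝓡 2) x₀).symm) y‖ ≤
      C * ‖grad f ((extChartAt (𝓡 2) x₀).symm y)‖ := by
  refine ContinuousLinearMap.opNorm_le_bound _ (by positivity) fun w => ?_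
  rw [← inner_grad_chartLin hy hf, Real.norm_eq_abs]
  calc _ ≤ _ := abs_real_inner_le_norm _ _
    _ ≤ ‖grad f ((extChartAt (𝓡 2) x₀).symm y)‖ * (C * ‖w‖) :=
      mul_le_mul_of_nonneg_left (hC w) (norm_nonneg _)
    _ = _ := by ring

theorem contDiffOn_comp_symm {f : M → ℝ} (hf : ContMDiff (𝓡 2) 𝓘(ℝ, ℝ) ∞ f) (x₀ : M) :
    ContDiffOn ℝ ∞ (f ∘ (extChartAt (𝓡 2) x₀).symm) (extChartAt (𝓡 2) x₀).target := by
  rw [← contMDiffOn_iff_contDiffOn]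
  exact hf.comp_contMDiffOn (contMDiffOn_extChartAt_symm x₀)

theorem mdifferentiableAt_of_contMDiff {f : M → ℝ} (hf : ContMDiff (𝓡 2) 𝓘(ℝ, ℝ) ∞ f) (x : M) :
    MDifferentiableAt (𝓡 2) 𝓘(ℝ, ℝ) f x :=
  (hf.mdifferentiable (by simp)) x

theorem continuousOn_fderiv_comp_symm {f : M → ℝ} (hf : ContMDiff (𝓡 2) 𝓘(ℝ, ℝ) ∞ f) (x₀ : M)
    (w : Plane) :
    ContinuousOn (fun y => fderiv ℝ (f ∘ (extChartAt (𝓡 2) x₀).symm) y w)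
      (extChartAt (𝓡 2) x₀).target :=
  ((contDiffOn_comp_symm hf x₀).continuousOn_fderiv_of_isOpen (isOpen_target x₀) (by simp)).clm_apply
    continuousOn_const

/-- In a chart |∇f|² = gⁱʲ ∂ᵢf ∂ⱼf, with the inverse metric written as adjugate over determinant,
and every factor is continuous. It provides measurability and boundedness of the gradient's length.
-/
theorem continuous_norm_grad {f : M → ℝ} (hf : ContMDiff (𝓡 2) 𝓘(ℝ, ℝ) ∞ f) :
    Continuous fun x => ‖grad f x‖ := by
  rw [continuous_iff_continuousAt]
  intro x₀
  set φ := extChartAt (𝓡 2) x₀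
  have hd := fun i => continuousOn_fderiv_comp_symm hf x₀ (EuclideanSpace.single i 1)
  have hG := fun i j => (contDiffOn_metricMatrix x₀ i j).continuousOn
  set h : Plane → ℝ := fun y => Real.sqrt ((metricMatrix x₀ y 1 1 *
      fderiv ℝ (f ∘ φ.symm) y (EuclideanSpace.single 0 1) ^ 2
      - 2 * metricMatrix x₀ y 0 1 * (fderiv ℝ (f ∘ φ.symm) y (EuclideanSpace.single 0 1) *
        fderiv ℝ (f ∘ φ.symm) y (EuclideanSpace.single 1 1))
      + metricMatrix x₀ y 0 0 * fderiv ℝ (f ∘ φ.symm) y (EuclideanSpace.single 1 1) ^ 2) /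
        (metricMatrix x₀ y).det) with hh
  have hc : ContinuousOn h φ.target := by
    refine ContinuousOn.sqrt (ContinuousOn.div ?_ (continuousOn_det_metricMatrix x₀)
      fun y hy => (det_metricMatrix_pos hy).ne')
    exact (((hG 1 1).mul ((hd 0).pow 2)).sub ((continuousOn_const.mul (hG 0 1)).mul
      ((hd 0).mul (hd 1)))).add ((hG 0 0).mul ((hd 1).pow 2))
  have hy₀ : φ x₀ ∈ φ.target := mem_extChartAt_target x₀
  have h1 : ContinuousAt (h ∘ φ) x₀ :=
    ContinuousAt.comp (hc.continuousAt ((isOpen_target x₀).mem_nhds hy₀))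
      (continuousAt_extChartAt x₀)
  refine h1.congr ?_
  filter_upwards [extChartAt_source_mem_nhds (I := 𝓡 2) x₀] with x hx
  obtain ⟨y, hy, rfl⟩ : ∃ y ∈ φ.target, φ.symm y = x := ⟨φ x, φ.map_source hx, φ.left_inv hx⟩
  simp only [Function.comp, hh]
  rw [φ.right_inv hy]
  have hm := mdifferentiableAt_of_contMDiff hf (φ.symm y)
  rw [show (f ∘ φ.symm) = f ∘ (extChartAt (𝓡 2) x₀).symm from rfl,
    ← inner_grad_chartLin hy hm, ← inner_grad_chartLin hy hm]
  have := det_mul_norm_sq hy (grad f (φ.symm y))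
  rw [coordVec_eq, coordVec_eq] at this
  rw [← this, mul_div_cancel_left₀ _ (det_metricMatrix_pos hy).ne', Real.sqrt_sq (norm_nonneg _)]

theorem contDiff_mul_comp_symm {f : M → ℝ} (hf : ContMDiff (𝓡 2) 𝓘(ℝ, ℝ) ∞ f) {x₀ : M}
    {ψ : Plane → ℝ} (hψ : ContDiff ℝ ∞ ψ) (hs : tsupport ψ ⊆ (extChartAt (𝓡 2) x₀).target) :
    ContDiff ℝ ∞ fun y => ψ y * f ((extChartAt (𝓡 2) x₀).symm y) := by
  rw [contDiff_iff_contDiffAt]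
  intro y
  by_cases hy : y ∈ tsupport ψ
  · exact hψ.contDiffAt.mul
      ((contDiffOn_comp_symm hf x₀).contDiffAt ((isOpen_target x₀).mem_nhds (hs hy)))
  · have : (fun y => ψ y * f ((extChartAt (𝓡 2) x₀).symm y)) =ᶠ[𝓝 y] fun _ => 0 := by
      filter_upwards [notMem_tsupport_iff_eventuallyEq.1 hy] with z hz
      rw [hz]; simp
    exact contDiffAt_const.congr_of_eventuallyEq this

end

/-! ### The Sobolev embedding and exponential integrability of smooth functions. -/

section

variable {M : Type*} [TopologicalSpace M] [ChartedSpace Plane M] [IsManifold (𝓡 2) ∞ M]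
  [RiemannianBundle (fun x : M => TangentSpace (𝓡 2) x)]
  [IsContMDiffRiemannianBundle (𝓡 2) ∞ Plane (fun x : M => TangentSpace (𝓡 2) x)]
  [MeasurableSpace M] [BorelSpace M]

theorem aemeasurable_enorm_grad {f : M → ℝ} (hf : ContMDiff (𝓡 2) 𝓘(ℝ, ℝ) ∞ f) :
    AEMeasurable (fun x => ‖grad f x‖ₑ) (vol M) := by
  have : (fun x => ‖grad f x‖ₑ) = fun x => ‖(‖grad f x‖)‖ₑ := by
    ext x; exact (enorm_norm _).symm
  rw [this]
  exact (continuous_norm_grad hf).measurable.enorm.aemeasurable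

/-- The local form of the embedding of `W^{1,1}` into `L²`. -/
theorem exists_nhds_sobolev (x₀ : M) :
    ∃ W ∈ 𝓝 x₀, ∃ K : ℝ≥0∞, K ≠ ⊤ ∧ ∀ f : M → ℝ, ContMDiff (𝓡 2) 𝓘(ℝ, ℝ) ∞ f →
      ∫⁻ x in W, ‖f x‖ₑ ^ 2 ∂(vol M) ≤ K * (∫⁻ x, (‖grad f x‖ₑ + ‖f x‖ₑ) ∂(vol M)) ^ 2 := by
  obtain ⟨r, hr, C, hC1, hB, hbd⟩ := exists_chart_bounds x₀
  set φ := extChartAt (𝓡 2) x₀ with hφ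
  set y₀ := φ x₀
  have hC0 : 0 ≤ C := by linarith
  let χ : ContDiffBump y₀ := ⟨r / 4, r / 2, by positivity, by linarith⟩
  have hχs : tsupport χ ⊆ Metric.ball y₀ r := by
    rw [χ.tsupport_eq]
    exact Metric.closedBall_subset_ball (by change r / 2 < r; linarith)
  have hχd : ContDiff ℝ ∞ χ := χ.contDiff
  obtain ⟨L, hL⟩ : ∃ L, ∀ y, ‖fderiv ℝ χ y‖ ≤ L :=
    (χ.hasCompactSupport.fderiv ℝ).exists_bound_of_continuous (hχd.continuous_fderiv (by simp))
  have hL0 : 0 ≤ L := (norm_nonneg _).trans (hL y₀)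
  set B := Metric.ball y₀ r
  set B' := Metric.ball y₀ (r / 4) with hB'
  have hB'B : B' ⊆ B := Metric.ball_subset_ball (by linarith)
  refine ⟨φ.source ∩ φ ⁻¹' B', chart_preimage_mem_nhds x₀ (Metric.ball_mem_nhds _ (by linarith)),
    ENNReal.ofReal C * (lintegralPowLePowLIntegralFDerivConst (volume : Measure Plane) 2 *
      ENNReal.ofReal ((C + L) * C) ^ 2), ?_, fun f hf => ?_⟩
  · exact ENNReal.mul_ne_top ENNReal.ofReal_ne_top (ENNReal.mul_ne_top ENNReal.coe_ne_top
      (ENNReal.pow_ne_top ENNReal.ofReal_ne_top))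
  set F : Plane → ℝ := fun y => χ y * f (φ.symm y) with hF
  have hFd : ContDiff ℝ ∞ F := contDiff_mul_comp_symm hf hχd (hχs.trans hB)
  have hFs : HasCompactSupport F := χ.hasCompactSupport.mul_right
  have hg : AEMeasurable (fun x => ‖grad f x‖ₑ + ‖f x‖ₑ) (vol M) :=
    (aemeasurable_enorm_grad hf).add hf.continuous.measurable.enorm.aemeasurable
  -- Gagliardo–Nirenberg–Sobolev in dimension n = 2, where the exponent n/(n−1) equals 2.
  have hGNS : ∫⁻ y, ‖F y‖ₑ ^ 2 ≤ lintegralPowLePowLIntegralFDerivConst (volume : Measure Plane) 2 *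
      (∫⁻ y, ‖fderiv ℝ F y‖ₑ) ^ 2 := by
    have := lintegral_pow_le_pow_lintegral_fderiv (volume : Measure Plane) (hFd.of_le (by simp)) hFs
      (p := 2) (by simpa using Real.HolderConjugate.two_two)
    simpa only [ENNReal.rpow_two] using this
  have hder : ∫⁻ y, ‖fderiv ℝ F y‖ₑ ≤ ENNReal.ofReal ((C + L) * C) *
      ∫⁻ x, (‖grad f x‖ₑ + ‖f x‖ₑ) ∂(vol M) := by
    have hsupp : ∀ y ∉ B, ‖fderiv ℝ F y‖ₑ = 0 := by
      intro y hy
      have : fderiv ℝ F y = 0 := by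
        have h1 : y ∉ tsupport F := fun h => hy (hχs (closure_mono (by
          intro z hz
          simp only [hF, Function.mem_support] at hz ⊢
          exact left_ne_zero_of_mul hz) h))
        have h2 : y ∉ tsupport (fderiv ℝ F) := fun h => h1 (tsupport_fderiv_subset ℝ h)
        exact image_eq_zero_of_notMem_tsupport h2
      rw [← ofReal_norm, this, norm_zero, ENNReal.ofReal_zero]
    rw [← setLIntegral_eq_of_support_subset (s := B) (fun y hy => by
      by_contra h; exact hy (hsupp y h))]
    calc ∫⁻ y in B, ‖fderiv ℝ F y‖ₑ
        ≤ ∫⁻ y in B, ENNReal.ofReal ((C + L) * C) * (ENNReal.ofReal (dens x₀ y) *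
            (‖grad f (φ.symm y)‖ₑ + ‖f (φ.symm y)‖ₑ)) := by
          refine setLIntegral_mono' Metric.isOpen_ball.measurableSet fun y hy => ?_
          obtain ⟨hd1, -, hlin, -⟩ := hbd y hy
          have hyt := hB hy
          have hmd := mdifferentiableAt_of_contMDiff hf (φ.symm y)
          have hfd := (mdifferentiableAt_iff_chart hyt).1 hmd
          have e1 : fderiv ℝ F y = χ y • fderiv ℝ (f ∘ φ.symm) y + f (φ.symm y) • fderiv ℝ χ y :=
            fderiv_mul (hχd.differentiable (by simp) y) hfd
          have e2 : ‖fderiv ℝ F y‖ ≤ (C + L) * (‖grad f (φ.symm y)‖ + ‖f (φ.symm y)‖) := by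
            rw [e1]
            have b1 : ‖χ y • fderiv ℝ (f ∘ φ.symm) y‖ ≤ C * ‖grad f (φ.symm y)‖ := by
              rw [norm_smul, Real.norm_eq_abs, abs_of_nonneg χ.nonneg]
              calc _ ≤ 1 * ‖fderiv ℝ (f ∘ φ.symm) y‖ := by gcongr; exact χ.le_one
                _ ≤ _ := by rw [one_mul]; exact norm_fderiv_chart_le hC0 hlin hyt hmd
            have b2 : ‖f (φ.symm y) • fderiv ℝ χ y‖ ≤ ‖f (φ.symm y)‖ * L := by
              rw [norm_smul]; gcongr; exact hL y
            have := norm_nonneg (grad f (φ.symm y))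
            have := norm_nonneg (f (φ.symm y))
            refine (norm_add_le _ _).trans ?_
            nlinarith [mul_nonneg hL0 (norm_nonneg (grad f (φ.symm y))),
              mul_nonneg hC0 (norm_nonneg (f (φ.symm y)))]
          have e3 : ‖fderiv ℝ F y‖ ≤ ((C + L) * C) * (dens x₀ y *
              (‖grad f (φ.symm y)‖ + ‖f (φ.symm y)‖)) := by
            refine e2.trans ?_
            have : 0 ≤ (C + L) * (‖grad f (φ.symm y)‖ + ‖f (φ.symm y)‖) := by positivity
            calc _ ≤ (C + L) * (‖grad f (φ.symm y)‖ + ‖f (φ.symm y)‖) * (C * dens x₀ y) :=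
                  le_mul_of_one_le_right this hd1
              _ = _ := by ring
          have hdp := (dens_pos hyt).le
          rw [← ofReal_norm, ← ofReal_norm, ← ofReal_norm,
            ← ENNReal.ofReal_add (norm_nonneg _) (norm_nonneg _), ← ENNReal.ofReal_mul hdp,
            ← ENNReal.ofReal_mul (by positivity)]
          exact ENNReal.ofReal_le_ofReal e3
      _ = ENNReal.ofReal ((C + L) * C) * ∫⁻ x in φ.source ∩ φ ⁻¹' B,
            (‖grad f x‖ₑ + ‖f x‖ₑ) ∂(vol M) := by
          rw [lintegral_const_mul' _ _ ENNReal.ofReal_ne_top,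
            lintegral_chart x₀ Metric.isOpen_ball.measurableSet hB hg]
      _ ≤ _ := by gcongr; exact Measure.restrict_le_self
  rw [lintegral_chart x₀ Metric.isOpen_ball.measurableSet (hB'B.trans hB)
    (hf.continuous.measurable.enorm.aemeasurable.pow_const 2)]
  calc ∫⁻ y in B', ENNReal.ofReal (dens x₀ y) * ‖f (φ.symm y)‖ₑ ^ 2
      ≤ ∫⁻ y in B', ENNReal.ofReal C * ‖F y‖ₑ ^ 2 := by
        refine setLIntegral_mono' Metric.isOpen_ball.measurableSet fun y hy => ?_
        have : χ y = 1 := χ.one_of_mem_closedBall (Metric.ball_subset_closedBall hy)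
        simp only [hF, this, one_mul]
        gcongr
        exact (hbd y (hB'B hy)).2.1
    _ ≤ ENNReal.ofReal C * ∫⁻ y, ‖F y‖ₑ ^ 2 := by
        rw [lintegral_const_mul' _ _ ENNReal.ofReal_ne_top]
        gcongr
        exact Measure.restrict_le_self
    _ ≤ ENNReal.ofReal C * (lintegralPowLePowLIntegralFDerivConst (volume : Measure Plane) 2 *
        (ENNReal.ofReal ((C + L) * C) * ∫⁻ x, (‖grad f x‖ₑ + ‖f x‖ₑ) ∂(vol M)) ^ 2) := by
        gcongr
        exact hGNS.trans (by gcongr)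
    _ = _ := by rw [mul_pow]; ring

variable [CompactSpace M]

variable (M) in
/-- The embedding of `W^{1,1}` into `L²`. -/
theorem exists_sobolev :
    ∃ K : ℝ≥0∞, K ≠ ⊤ ∧ ∀ f : M → ℝ, ContMDiff (𝓡 2) 𝓘(ℝ, ℝ) ∞ f →
      ∫⁻ x, ‖f x‖ₑ ^ 2 ∂(vol M) ≤ K * (∫⁻ x, (‖grad f x‖ₑ + ‖f x‖ₑ) ∂(vol M)) ^ 2 := by
  -- The right-hand side is already global, so local bounds simply add up over a finite cover.
  have := isCompact_univ (X := M).induction_on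
    (p := fun W => ∃ K : ℝ≥0∞, K ≠ ⊤ ∧ ∀ f : M → ℝ, ContMDiff (𝓡 2) 𝓘(ℝ, ℝ) ∞ f →
      ∫⁻ x in W, ‖f x‖ₑ ^ 2 ∂(vol M) ≤ K * (∫⁻ x, (‖grad f x‖ₑ + ‖f x‖ₑ) ∂(vol M)) ^ 2)
    ⟨0, by simp⟩ ?_ ?_ ?_
  · simpa using this
  · rintro s t hst ⟨K, hK, h⟩
    exact ⟨K, hK, fun f hf => (lintegral_mono_set hst).trans (h f hf)⟩
  · rintro s t ⟨K, hK, h⟩ ⟨K', hK', h'⟩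
    refine ⟨K + K', ENNReal.add_ne_top.2 ⟨hK, hK'⟩, fun f hf => ?_⟩
    rw [add_mul]
    exact (lintegral_union_le _ _ _).trans (add_le_add (h f hf) (h' f hf))
  · intro x _
    obtain ⟨W, hW, K, hK, h⟩ := exists_nhds_sobolev x
    exact ⟨W, mem_nhdsWithin_of_mem_nhds hW, K, hK, h⟩

theorem lintegral_mul_sq_le {α : Type*} [MeasurableSpace α] {μ : Measure α} {f g : α → ℝ≥0∞}
    (hf : AEMeasurable f μ) (hg : AEMeasurable g μ) :
    (∫⁻ x, f x * g x ∂μ) ^ 2 ≤ (∫⁻ x, f x ^ 2 ∂μ) * ∫⁻ x, g x ^ 2 ∂μ := by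
  have h := ENNReal.lintegral_mul_le_Lp_mul_Lq μ Real.HolderConjugate.two_two hf hg
  simp only [Pi.mul_apply, ENNReal.rpow_two] at h
  calc _ ≤ ((∫⁻ x, f x ^ 2 ∂μ) ^ (1 / 2 : ℝ) * (∫⁻ x, g x ^ 2 ∂μ) ^ (1 / 2 : ℝ)) ^ 2 := by gcongr
    _ = _ := by
      rw [mul_pow, ← ENNReal.rpow_two, ← ENNReal.rpow_two, ← ENNReal.rpow_mul, ← ENNReal.rpow_mul]
      norm_num

variable (M) in
-- The W^{1,1} embedding is iterated on powers: ∇(f^{k+1}) = (k+1) f^k ∇f, and Cauchy–Schwarz splits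
-- the L¹ norm into ∫f^{2k} and the energy H, so each step costs a factor K H (k+1)². The resulting
-- growth (k!)² is beaten by the coefficients 1/(2k)! of cosh.
theorem exists_lintegral_pow_le :
    ∃ K : ℝ≥0∞, K ≠ ⊤ ∧ ∀ f : M → ℝ, ContMDiff (𝓡 2) 𝓘(ℝ, ℝ) ∞ f → ∀ k : ℕ,
      ∫⁻ x, ‖f x‖ₑ ^ (2 * k) ∂(vol M) ≤
        (K * ∫⁻ x, (‖grad f x‖ₑ + ‖f x‖ₑ) ^ 2 ∂(vol M)) ^ k * (k.factorial : ℝ≥0∞) ^ 2 *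
          vol M univ := by
  obtain ⟨K, hK, hsob⟩ := exists_sobolev M
  refine ⟨K, hK, fun f hf k => ?_⟩
  set H := ∫⁻ x, (‖grad f x‖ₑ + ‖f x‖ₑ) ^ 2 ∂(vol M)
  have hfm : AEMeasurable (fun x => ‖f x‖ₑ) (vol M) := hf.continuous.measurable.enorm.aemeasurable
  have hgm : AEMeasurable (fun x => ‖grad f x‖ₑ + ‖f x‖ₑ) (vol M) :=
    (aemeasurable_enorm_grad hf).add hfm
  induction k with
  | zero => simp
  | succ k ih =>
    have h1 := hsob (fun x => f x ^ (k + 1)) (hf.pow (k + 1))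
    have h2 : ∀ x, ‖grad (fun x => f x ^ (k + 1)) x‖ₑ + ‖f x ^ (k + 1)‖ₑ ≤
        ((k + 1 : ℕ) : ℝ≥0∞) * (‖f x‖ₑ ^ k * (‖grad f x‖ₑ + ‖f x‖ₑ)) := by
      intro x
      rw [grad_comp (mdifferentiableAt_of_contMDiff hf x) (hasDerivAt_pow (k + 1) (f x)),
        enorm_smul, enorm_mul, enorm_pow, enorm_pow, mul_add, mul_add]
      have e : ‖((k + 1 : ℕ) : ℝ)‖ₑ = ((k + 1 : ℕ) : ℝ≥0∞) := by
        rw [Real.enorm_eq_ofReal (by positivity), ENNReal.ofReal_natCast]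
      rw [e, Nat.add_sub_cancel, mul_assoc, pow_succ]
      exact add_le_add le_rfl
        (le_mul_of_one_le_left zero_le (by exact_mod_cast Nat.le_add_left 1 k))
    have h3 : ∫⁻ x, (‖grad (fun x => f x ^ (k + 1)) x‖ₑ + ‖f x ^ (k + 1)‖ₑ) ∂(vol M) ≤
        ((k + 1 : ℕ) : ℝ≥0∞) * ∫⁻ x, ‖f x‖ₑ ^ k * (‖grad f x‖ₑ + ‖f x‖ₑ) ∂(vol M) := by
      rw [← lintegral_const_mul' _ _ (ENNReal.natCast_ne_top _)]
      exact lintegral_mono h2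
    have h4 := lintegral_mul_sq_le (hfm.pow_const k) hgm
    simp only [← pow_mul] at h4
    rw [mul_comm k 2] at h4
    calc ∫⁻ x, ‖f x‖ₑ ^ (2 * (k + 1)) ∂(vol M) = ∫⁻ x, ‖f x ^ (k + 1)‖ₑ ^ 2 ∂(vol M) := by
          simp only [enorm_pow, ← pow_mul, mul_comm 2]
      _ ≤ K * (((k + 1 : ℕ) : ℝ≥0∞) * ∫⁻ x, ‖f x‖ₑ ^ k * (‖grad f x‖ₑ + ‖f x‖ₑ) ∂(vol M)) ^ 2 :=
          h1.trans (by gcongr)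
      _ ≤ K * (((k + 1 : ℕ) : ℝ≥0∞) ^ 2 * ((∫⁻ x, ‖f x‖ₑ ^ (2 * k) ∂(vol M)) * H)) := by
          rw [mul_pow]; gcongr
      _ ≤ K * (((k + 1 : ℕ) : ℝ≥0∞) ^ 2 * (((K * H) ^ k * (k.factorial : ℝ≥0∞) ^ 2 *
            vol M univ) * H)) := by gcongr
      _ = _ := by
          rw [Nat.factorial_succ, Nat.cast_mul]; ring

variable (M) in
/-- A weak form of the Moser-Trudinger inequality: exponential integrability for smooth functions
of small energy. -/
theorem exists_lintegral_cosh_le :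
    ∃ κ : ℝ≥0∞, 0 < κ ∧ ∀ f : M → ℝ, ContMDiff (𝓡 2) 𝓘(ℝ, ℝ) ∞ f →
      ∫⁻ x, (‖grad f x‖ₑ + ‖f x‖ₑ) ^ 2 ∂(vol M) ≤ κ →
      ∫⁻ x, ENNReal.ofReal (Real.cosh (f x)) ∂(vol M) ≤ 2 * vol M univ := by
  obtain ⟨K, hK, h⟩ := exists_lintegral_pow_le M
  -- This threshold makes K H ≤ 1/2, so the moments are dominated by a geometric series with sum 2.
  -- If K = 0 the threshold is ⊤ and no smallness is needed.
  refine ⟨(2 * K)⁻¹, ENNReal.inv_pos.2 (ENNReal.mul_ne_top (by simp) hK), fun f hf hH => ?_⟩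
  have hfm : AEMeasurable (fun x => ‖f x‖ₑ) (vol M) := hf.continuous.measurable.enorm.aemeasurable
  set H := ∫⁻ x, (‖grad f x‖ₑ + ‖f x‖ₑ) ^ 2 ∂(vol M)
  have hKH : K * H ≤ 2⁻¹ := by
    rcases eq_or_ne K 0 with rfl | hK0
    · simp
    calc K * H ≤ K * (2 * K)⁻¹ := by gcongr
      _ = 2⁻¹ := by
        rw [ENNReal.mul_inv (by simp) (by simp), mul_comm, mul_assoc, ENNReal.inv_mul_cancel hK0 hK,
          mul_one]
  have hexp : ∀ x, ENNReal.ofReal (Real.cosh (f x)) =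
      ∑' k : ℕ, ‖f x‖ₑ ^ (2 * k) / ((2 * k).factorial : ℝ≥0∞) := by
    intro x
    have hs := Real.hasSum_cosh (f x)
    have hnn : ∀ k : ℕ, 0 ≤ f x ^ (2 * k) / ((2 * k).factorial : ℝ) := fun k => by
      rw [pow_mul]; positivity
    rw [← hs.tsum_eq, ENNReal.ofReal_tsum_of_nonneg hnn hs.summable]
    congr 1
    ext k
    rw [ENNReal.ofReal_div_of_pos (by positivity), ENNReal.ofReal_natCast, ← enorm_pow,
      Real.enorm_eq_ofReal (by rw [pow_mul]; positivity)]
  calc ∫⁻ x, ENNReal.ofReal (Real.cosh (f x)) ∂(vol M)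
      = ∑' k : ℕ, ∫⁻ x, ‖f x‖ₑ ^ (2 * k) / ((2 * k).factorial : ℝ≥0∞) ∂(vol M) := by
        simp only [hexp]
        exact lintegral_tsum fun k => (hfm.pow_const _).div_const _
    _ ≤ ∑' k : ℕ, (2⁻¹ : ℝ≥0∞) ^ k * vol M univ := by
        refine ENNReal.tsum_le_tsum fun k => ?_
        simp only [div_eq_mul_inv]
        have hfac : ((2 * k).factorial : ℝ≥0∞)⁻¹ ≠ ⊤ :=
          ENNReal.inv_ne_top.2 (by exact_mod_cast (2 * k).factorial_ne_zero)
        rw [lintegral_mul_const' _ _ hfac]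
        have hle : ((k.factorial : ℝ≥0∞)) ^ 2 * ((2 * k).factorial : ℝ≥0∞)⁻¹ ≤ 1 := by
          rw [← div_eq_mul_inv]
          refine ENNReal.div_le_of_le_mul ?_
          rw [one_mul, two_mul, sq]
          exact_mod_cast Nat.le_of_dvd (Nat.factorial_pos _) (Nat.factorial_mul_factorial_dvd_factorial_add k k)
        calc _ ≤ (K * H) ^ k * (k.factorial : ℝ≥0∞) ^ 2 * vol M univ *
              ((2 * k).factorial : ℝ≥0∞)⁻¹ := by gcongr; exact h f hf k
          _ = (K * H) ^ k * vol M univ *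
              ((k.factorial : ℝ≥0∞) ^ 2 * ((2 * k).factorial : ℝ≥0∞)⁻¹) := by ring
          _ ≤ 2⁻¹ ^ k * vol M univ * 1 := by gcongr
          _ = _ := mul_one _
    _ = 2 * vol M univ := by
        rw [ENNReal.tsum_mul_right, ENNReal.tsum_geometric, ENNReal.one_sub_inv_two, inv_inv]

end

/-! ### Weak gradients: integration by parts and uniqueness. -/

section

variable {M : Type*} [TopologicalSpace M] [ChartedSpace Plane M] [IsManifold (𝓡 2) ∞ M]
  [RiemannianBundle (fun x : M => TangentSpace (𝓡 2) x)]
  [IsContMDiffRiemannianBundle (𝓡 2) ∞ Plane (fun x : M => TangentSpace (𝓡 2) x)]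
  [MeasurableSpace M] [BorelSpace M] [CompactSpace M]

theorem exists_subseq_tendsto_ae {α : Type*} [MeasurableSpace α] {μ : Measure α} {f : ℕ → α → ℝ}
    (hf : ∀ n, AEStronglyMeasurable (f n) μ)
    (h : Tendsto (fun n => eLpNorm (f n) 2 μ) atTop (𝓝 0)) :
    ∃ ns : ℕ → ℕ, StrictMono ns ∧ ∀ᵐ x ∂μ, Tendsto (fun k => f (ns k) x) atTop (𝓝 0) := by
  have h1 : TendstoInMeasure μ f atTop (fun _ => 0) := by
    refine tendstoInMeasure_of_tendsto_eLpNorm (p := 2) (by simp) hf aestronglyMeasurable_const ?_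
    refine h.congr fun n => ?_
    congr 1
    ext x
    simp
  exact h1.exists_seq_tendsto_ae

theorem aestronglyMeasurable_of_contMDiff {f : M → ℝ} (hf : ContMDiff (𝓡 2) 𝓘(ℝ, ℝ) ∞ f) :
    AEStronglyMeasurable f (vol M) :=
  hf.continuous.measurable.aestronglyMeasurable

/-- An approximating sequence of a Sobolev function that converges almost everywhere. -/
theorem HasWeakGrad.exists_seq {u : M → ℝ} {X : ∀ x : M, TangentSpace (𝓡 2) x}
    (h : HasWeakGrad u X) :
    ∃ φ : ℕ → M → ℝ,
      (∀ n, ContMDiff (𝓡 2) 𝓘(ℝ, ℝ) ∞ (φ n)) ∧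
      (∀ n, AEStronglyMeasurable (fun x => ‖grad (φ n) x - X x‖) (vol M)) ∧
      Tendsto (fun n => eLpNorm (fun x => φ n x - u x) 2 (vol M)) atTop (𝓝 0) ∧
      Tendsto (fun n => eLpNorm (fun x => ‖grad (φ n) x - X x‖) 2 (vol M)) atTop (𝓝 0) ∧
      (∀ᵐ x ∂(vol M), Tendsto (fun n => φ n x) atTop (𝓝 (u x))) ∧
      ∀ᵐ x ∂(vol M), Tendsto (fun n => ‖grad (φ n) x - X x‖) atTop (𝓝 0) := by
  obtain ⟨hu, φ, hφ, hm, h1, h2⟩ := h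
  obtain ⟨ns, hns, hae⟩ := exists_subseq_tendsto_ae
    (fun n => (aestronglyMeasurable_of_contMDiff (hφ n)).sub hu) h1
  have h2' := h2.comp hns.tendsto_atTop
  obtain ⟨ms, hms, hae'⟩ := exists_subseq_tendsto_ae (fun n => hm (ns n)) h2'
  refine ⟨fun n => φ (ns (ms n)), fun n => hφ _, fun n => hm _,
    h1.comp (hns.comp hms).tendsto_atTop, h2.comp (hns.comp hms).tendsto_atTop, ?_, hae'⟩
  filter_upwards [hae] with x hx
  have := (hx.comp hms.tendsto_atTop).add_const (u x)
  simpa using this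

theorem integrable_and_tendsto_of_lintegral {α : Type*} [MeasurableSpace α] {μ : Measure α}
    {F : ℕ → α → ℝ} {f : α → ℝ} (hF : ∀ n, Integrable (F n) μ) (hf : AEStronglyMeasurable f μ)
    (h : Tendsto (fun n => ∫⁻ x, ‖F n x - f x‖ₑ ∂μ) atTop (𝓝 0)) :
    Integrable f μ ∧ Tendsto (fun n => ∫ x, F n x ∂μ) atTop (𝓝 (∫ x, f x ∂μ)) := by
  have hfi : Integrable f μ := by
    obtain ⟨n, hn⟩ := (h.eventually (gt_mem_nhds ENNReal.zero_lt_top)).exists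
    have h1 : Integrable (fun x => F n x - f x) μ := ⟨(hF n).1.sub hf, hn⟩
    have h2 := (hF n).sub h1
    refine h2.congr (Eventually.of_forall fun x => ?_)
    simp
  exact ⟨hfi, tendsto_integral_of_L1 f hfi.1 (Eventually.of_forall hF) h⟩

theorem exists_bound_of_continuous {f : M → ℝ} (hf : Continuous f) : ∃ K, ∀ x, |f x| ≤ K := by
  obtain ⟨K, hK⟩ := isCompact_univ.exists_bound_of_continuousOn hf.continuousOn
  exact ⟨K, fun x => hK x (mem_univ x)⟩

/-- Convergence in `L²(M)` implies convergence in `L¹` of a ball of a chart. -/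
theorem tendsto_lintegral_chart {x₀ : M} {B : Set Plane} (hBm : MeasurableSet B)
    (hB : B ⊆ (extChartAt (𝓡 2) x₀).target) {C : ℝ} (hC : ∀ y ∈ B, 1 ≤ C * dens x₀ y)
    (hC0 : 0 ≤ C) {e : ℕ → M → ℝ} (he : ∀ n, AEStronglyMeasurable (e n) (vol M))
    (h : Tendsto (fun n => eLpNorm (e n) 2 (vol M)) atTop (𝓝 0)) :
    Tendsto (fun n => ∫⁻ y in B, ‖e n ((extChartAt (𝓡 2) x₀).symm y)‖ₑ) atTop (𝓝 0) := by
  -- The Hölder factor |M|^{1/2} that passes from L² to L¹ on `M`.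
  set V := (vol M univ) ^ (1 / (1 : ℝ≥0∞).toReal - 1 / (2 : ℝ≥0∞).toReal) with hV
  have hVt : V ≠ ⊤ := by
    rw [hV]
    exact ENNReal.rpow_ne_top_of_nonneg (by norm_num) (measure_ne_top _ _)
  have hle : ∀ n, ∫⁻ y in B, ‖e n ((extChartAt (𝓡 2) x₀).symm y)‖ₑ ≤
      ENNReal.ofReal C * (eLpNorm (e n) 2 (vol M) * V) := by
    intro n
    calc ∫⁻ y in B, ‖e n ((extChartAt (𝓡 2) x₀).symm y)‖ₑ
        ≤ ∫⁻ y in B, ENNReal.ofReal C * (ENNReal.ofReal (dens x₀ y) *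
            ‖e n ((extChartAt (𝓡 2) x₀).symm y)‖ₑ) := by
          refine setLIntegral_mono' hBm fun y hy => ?_
          rw [← mul_assoc, ← ENNReal.ofReal_mul hC0]
          exact le_mul_of_one_le_left zero_le (by simpa using hC y hy)
      _ = ENNReal.ofReal C * ∫⁻ x in (extChartAt (𝓡 2) x₀).source ∩
            extChartAt (𝓡 2) x₀ ⁻¹' B, ‖e n x‖ₑ ∂(vol M) := by
          rw [lintegral_const_mul' _ _ ENNReal.ofReal_ne_top,
            lintegral_chart x₀ hBm hB (he n).enorm]
      _ ≤ ENNReal.ofReal C * ∫⁻ x, ‖e n x‖ₑ ∂(vol M) := by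
          gcongr; exact Measure.restrict_le_self
      _ ≤ ENNReal.ofReal C * (eLpNorm (e n) 2 (vol M) * V) := by
          rw [← eLpNorm_one_eq_lintegral_enorm]
          gcongr
          exact eLpNorm_le_eLpNorm_mul_rpow_measure_univ (by norm_num) (he n)
  have hlim : Tendsto (fun n => ENNReal.ofReal C * (eLpNorm (e n) 2 (vol M) * V)) atTop (𝓝 0) := by
    have h1 := ENNReal.Tendsto.mul_const h (Or.inr hVt)
    have h2 := ENNReal.Tendsto.const_mul h1 (Or.inr (ENNReal.ofReal_ne_top (r := C)))
    simpa using h2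
  exact tendsto_of_tendsto_of_tendsto_of_le_of_le tendsto_const_nhds hlim (fun _ => zero_le) hle

/-- Integration by parts in a ball of a chart. -/
theorem HasWeakGrad.chart {u : M → ℝ} {X : ∀ x : M, TangentSpace (𝓡 2) x} (h : HasWeakGrad u X)
    {x₀ : M} {y₀ : Plane} {r C : ℝ}
    (hB : Metric.ball y₀ r ⊆ (extChartAt (𝓡 2) x₀).target) (hC1 : 1 ≤ C)
    (hbd : ∀ y ∈ Metric.ball y₀ r, 1 ≤ C * dens x₀ y ∧ (∀ w, ‖chartLin x₀ y w‖ ≤ C * ‖w‖))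
    (i : Fin 2) :
    IntegrableOn (fun y => inner ℝ (X ((extChartAt (𝓡 2) x₀).symm y)) (coordVec x₀ y i))
      (Metric.ball y₀ r) ∧
    ∀ ψ : Plane → ℝ, ContDiff ℝ ∞ ψ → HasCompactSupport ψ → tsupport ψ ⊆ Metric.ball y₀ r →
      ∫ y in Metric.ball y₀ r,
        ψ y * inner ℝ (X ((extChartAt (𝓡 2) x₀).symm y)) (coordVec x₀ y i) =
      - ∫ y in Metric.ball y₀ r,
        u ((extChartAt (𝓡 2) x₀).symm y) * fderiv ℝ ψ y (EuclideanSpace.single i 1) := by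
  obtain ⟨f, hf, hm, h1, h2, hae1, hae2⟩ := h.exists_seq
  have hu := h.1
  set φ := extChartAt (𝓡 2) x₀ with hφ
  set B := Metric.ball y₀ r with hBdef
  have hBm : MeasurableSet B := Metric.isOpen_ball.measurableSet
  have hC0 : 0 ≤ C := by linarith
  have hd := fun y hy => (hbd y hy).1
  set b : Plane → ℝ := fun y => inner ℝ (X (φ.symm y)) (coordVec x₀ y i) with hb
  set D : ℕ → Plane → ℝ := fun n y => fderiv ℝ (f n ∘ φ.symm) y (EuclideanSpace.single i 1) with hD
  have hDm : ∀ n, AEStronglyMeasurable (D n) (volume.restrict B) := fun n =>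
    ((continuousOn_fderiv_comp_symm (hf n) x₀ _).mono hB).aestronglyMeasurable hBm
  have hDb : ∀ n, ∀ y ∈ B, |D n y - b y| ≤ C * ‖grad (f n) (φ.symm y) - X (φ.symm y)‖ := by
    intro n y hy
    have e : D n y = inner ℝ (grad (f n) (φ.symm y)) (coordVec x₀ y i) := by
      rw [coordVec_eq]
      exact (inner_grad_chartLin (hB hy) (mdifferentiableAt_of_contMDiff (hf n) _) _).symm
    rw [e, hb, ← inner_sub_left]
    exact abs_inner_coordVec_le (hbd y hy).2 _ i
  have hae2' : ∀ᵐ y ∂(volume.restrict B),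
      Tendsto (fun n => ‖grad (f n) (φ.symm y) - X (φ.symm y)‖) atTop (𝓝 0) :=
    ae_of_ae_chart x₀ hBm hB (P := fun x => Tendsto (fun n => ‖grad (f n) x - X x‖) atTop (𝓝 0))
      (ae_restrict_of_ae hae2)
  have hbm : AEStronglyMeasurable b (volume.restrict B) := by
    refine aestronglyMeasurable_of_tendsto_ae atTop hDm ?_
    filter_upwards [hae2', ae_restrict_mem hBm] with y hy hyB
    rw [tendsto_iff_norm_sub_tendsto_zero]
    refine squeeze_zero (fun n => norm_nonneg _) (fun n => hDb n y hyB) ?_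
    simpa using hy.const_mul C
  have hfin : volume B ≠ ⊤ := measure_ball_lt_top.ne
  haveI : IsFiniteMeasure (volume.restrict B) := ⟨by simpa using measure_ball_lt_top⟩
  have hDi : ∀ n, Integrable (D n) (volume.restrict B) := by
    intro n
    obtain ⟨K, hK⟩ := exists_bound_of_continuous (continuous_norm_grad (hf n))
    refine Integrable.of_bound (hDm n) (C * K) ?_
    filter_upwards [ae_restrict_mem hBm] with y hy
    have h3 := norm_fderiv_chart_le hC0 (hbd y hy).2 (hB hy)
      (mdifferentiableAt_of_contMDiff (hf n) (φ.symm y))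
    have h4 := (fderiv ℝ (f n ∘ φ.symm) y).le_opNorm (EuclideanSpace.single i 1)
    rw [PiLp.norm_single, norm_one, mul_one] at h4
    refine h4.trans (h3.trans ?_)
    gcongr
    exact (le_abs_self _).trans (hK _)
  have hDl : Tendsto (fun n => ∫⁻ y in B, ‖D n y - b y‖ₑ) atTop (𝓝 0) := by
    have h3 := tendsto_lintegral_chart hBm hB hd hC0 hm h2
    have h4 := ENNReal.Tendsto.const_mul h3 (Or.inr (ENNReal.ofReal_ne_top (r := C)))
    rw [mul_zero] at h4
    refine tendsto_of_tendsto_of_tendsto_of_le_of_le tendsto_const_nhds h4 (fun _ => zero_le)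
      fun n => ?_
    simp only
    rw [← lintegral_const_mul' _ _ ENNReal.ofReal_ne_top]
    refine setLIntegral_mono' hBm fun y hy => ?_
    rw [← ofReal_norm, ← ofReal_norm, ← ENNReal.ofReal_mul hC0, norm_norm]
    exact ENNReal.ofReal_le_ofReal (hDb n y hy)
  have hbi := (integrable_and_tendsto_of_lintegral hDi hbm hDl).1
  refine ⟨hbi, fun ψ hψ hψc hψs => ?_⟩
  have hψd : Continuous (fun y => fderiv ℝ ψ y (EuclideanSpace.single i 1)) :=
    (hψ.continuous_fderiv (by simp)).clm_apply continuous_const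
  obtain ⟨K, hK⟩ := hψc.exists_bound_of_continuous hψ.continuous
  obtain ⟨K', hK'⟩ := (hψc.fderiv_apply ℝ (EuclideanSpace.single i 1)).exists_bound_of_continuous hψd
  -- the limits of the two sides
  have lim_bound : ∀ (F : ℕ → Plane → ℝ) (g η : Plane → ℝ) (K : ℝ),
      (∀ n, Integrable (F n) (volume.restrict B)) → AEStronglyMeasurable g (volume.restrict B) →
      Continuous η → (∀ y, ‖η y‖ ≤ K) →
      Tendsto (fun n => ∫⁻ y in B, ‖F n y - g y‖ₑ) atTop (𝓝 0) →
      Tendsto (fun n => ∫ y in B, η y * F n y) atTop (𝓝 (∫ y in B, η y * g y)) := by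
    intro F g η K hF hg hη hηK hFg
    refine (integrable_and_tendsto_of_lintegral
      (fun n => (hF n).bdd_mul hη.aestronglyMeasurable (Eventually.of_forall hηK))
      (hη.aestronglyMeasurable.mul hg) ?_).2
    have h4 := ENNReal.Tendsto.const_mul hFg (Or.inr (ENNReal.ofReal_ne_top (r := K)))
    rw [mul_zero] at h4
    refine tendsto_of_tendsto_of_tendsto_of_le_of_le tendsto_const_nhds h4 (fun _ => zero_le)
      fun n => ?_
    simp only
    rw [← lintegral_const_mul' _ _ ENNReal.ofReal_ne_top]
    refine lintegral_mono fun y => ?_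
    rw [Pi.mul_apply, ← mul_sub, enorm_mul]
    gcongr
    rw [← ofReal_norm]
    exact ENNReal.ofReal_le_ofReal (hηK y)
  have L1 := lim_bound D b ψ K hDi hbm hψ.continuous hK hDl
  have hU : ∀ n, Integrable (fun y => f n (φ.symm y)) (volume.restrict B) := by
    intro n
    obtain ⟨K, hK⟩ := exists_bound_of_continuous (hf n).continuous
    exact Integrable.of_bound (((contDiffOn_comp_symm (hf n) x₀).continuousOn.mono
      hB).aestronglyMeasurable hBm) K (Eventually.of_forall fun y => hK _)
  have hum : AEStronglyMeasurable (fun y => u (φ.symm y)) (volume.restrict B) := by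
    refine aestronglyMeasurable_of_tendsto_ae atTop (fun n => (hU n).1) ?_
    exact ae_of_ae_chart x₀ hBm hB (P := fun x => Tendsto (fun n => f n x) atTop (𝓝 (u x)))
      (ae_restrict_of_ae hae1)
  have L2 := lim_bound (fun n y => f n (φ.symm y)) (fun y => u (φ.symm y)) _ K' hU hum hψd hK'
    (tendsto_lintegral_chart hBm hB hd hC0
      (fun n => (aestronglyMeasurable_of_contMDiff (hf n)).sub hu) h1)
  -- Classical integration by parts for the smooth approximants. `f n ∘ φ.symm` is smooth only on
  -- the target, which suffices because the other factor is supported there.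
  have hparts : ∀ n, ∫ y in B, ψ y * D n y =
      - ∫ y in B, fderiv ℝ ψ y (EuclideanSpace.single i 1) * f n (φ.symm y) := by
    intro n
    have z1 : ∀ y ∉ B, ψ y = 0 := fun y hy => image_eq_zero_of_notMem_tsupport fun h => hy (hψs h)
    have z2 : ∀ y ∉ B, fderiv ℝ ψ y (EuclideanSpace.single i 1) = 0 := fun y hy => by
      rw [image_eq_zero_of_notMem_tsupport fun h => hy (hψs (tsupport_fderiv_subset ℝ h))]
      rfl
    have e1 : ∫ y in B, ψ y * D n y = ∫ y, ψ y * D n y :=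
      setIntegral_eq_integral_of_forall_compl_eq_zero fun y hy => by rw [z1 y hy, zero_mul]
    have e2 : ∫ y in B, fderiv ℝ ψ y (EuclideanSpace.single i 1) * f n (φ.symm y) =
        ∫ y, fderiv ℝ ψ y (EuclideanSpace.single i 1) * f n (φ.symm y) :=
      setIntegral_eq_integral_of_forall_compl_eq_zero fun y hy => by rw [z2 y hy, zero_mul]
    have toGlobal : ∀ g : Plane → ℝ, (∀ y ∉ B, g y = 0) → Integrable g (volume.restrict B) →
        Integrable g := fun g hg hgi =>
      (integrableOn_iff_integrable_of_support_subset (s := B) (fun y hy => by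
        by_contra hyB; exact hy (hg y hyB))).1 hgi
    rw [e1, e2]
    refine integral_mul_fderiv_eq_neg_fderiv_mul_of_integrable (f := ψ) (g := f n ∘ φ.symm)
      (toGlobal _ (fun y hy => by rw [z2 y hy, zero_mul])
        ((hU n).bdd_mul hψd.aestronglyMeasurable (Eventually.of_forall hK')))
      (toGlobal _ (fun y hy => by rw [z1 y hy, zero_mul])
        ((hDi n).bdd_mul hψ.continuous.aestronglyMeasurable (Eventually.of_forall hK)))
      (toGlobal _ (fun y hy => by rw [z1 y hy, zero_mul])
        ((hU n).bdd_mul hψ.continuous.aestronglyMeasurable (Eventually.of_forall hK))) ?_ ?_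
    · intro y _
      exact hψ.differentiable (by simp) y
    · intro y hy
      exact (mdifferentiableAt_iff_chart (hB (hψs hy))).1 (mdifferentiableAt_of_contMDiff (hf n) _)
  have L3 := tendsto_nhds_unique L1 ((L2.neg).congr fun n => (hparts n).symm)
  rw [L3]
  congr 2
  ext y
  rw [mul_comm]

/-- The weak gradient is unique up to null sets. -/
theorem HasWeakGrad.ae_eq {u : M → ℝ} {X Y : ∀ x : M, TangentSpace (𝓡 2) x}
    (hX : HasWeakGrad u X) (hY : HasWeakGrad u Y) : ∀ᵐ x ∂(vol M), X x = Y x := by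
  have := isCompact_univ (X := M).induction_on
    (p := fun W => ∀ᵐ x ∂(vol M).restrict W, X x = Y x) (by simp) ?_ ?_ ?_
  · simpa using this
  · intro s t hst h
    exact ae_restrict_of_ae_restrict_of_subset hst h
  · intro s t hs ht
    exact (ae_restrict_union_iff s t _).2 ⟨hs, ht⟩
  · intro x₀ _
    obtain ⟨r, hr, C, hC1, hB, hbd⟩ := exists_chart_bounds x₀
    refine ⟨_, mem_nhdsWithin_of_mem_nhds
      (chart_preimage_mem_nhds x₀ (Metric.ball_mem_nhds _ hr)), ?_⟩
    refine ae_chart_of_ae x₀ Metric.isOpen_ball.measurableSet hB ?_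
    have hcoord : ∀ i : Fin 2, ∀ᵐ y ∂(volume.restrict (Metric.ball (extChartAt (𝓡 2) x₀ x₀) r)),
        inner ℝ (X ((extChartAt (𝓡 2) x₀).symm y)) (coordVec x₀ y i) -
          inner ℝ (Y ((extChartAt (𝓡 2) x₀).symm y)) (coordVec x₀ y i) = 0 := by
      intro i
      obtain ⟨iX, pX⟩ := hX.chart hB hC1 (fun y hy => ⟨(hbd y hy).1, (hbd y hy).2.2.1⟩) i
      obtain ⟨iY, pY⟩ := hY.chart hB hC1 (fun y hy => ⟨(hbd y hy).1, (hbd y hy).2.2.1⟩) i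
      rw [ae_restrict_iff' Metric.isOpen_ball.measurableSet]
      -- The fundamental lemma of the calculus of variations: the components of both fields satisfy
      -- the same integration by parts identity, so their difference integrates to zero against
      -- every test function.
      refine Metric.isOpen_ball.ae_eq_zero_of_integral_contDiff_smul_eq_zero
        (iX.sub iY).locallyIntegrableOn fun ψ hψ hψc hψs => ?_
      obtain ⟨K, hK⟩ := hψc.exists_bound_of_continuous hψ.continuous
      have b1 := iX.bdd_mul hψ.continuous.aestronglyMeasurable (Eventually.of_forall hK)
      have b2 := iY.bdd_mul hψ.continuous.aestronglyMeasurable (Eventually.of_forall hK)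
      rw [← setIntegral_eq_integral_of_forall_compl_eq_zero (s := Metric.ball
        (extChartAt (𝓡 2) x₀ x₀) r) (fun y hy => by
          rw [image_eq_zero_of_notMem_tsupport fun h => hy (hψs h), zero_smul])]
      simp only [smul_eq_mul, mul_sub]
      rw [integral_sub b1 b2, pX ψ hψ hψc hψs, pY ψ hψ hψc hψs, sub_self]
    filter_upwards [hcoord 0, hcoord 1, ae_restrict_mem Metric.isOpen_ball.measurableSet]
      with y h0 h1 hy
    have := (hbd y hy).2.2.2 (X ((extChartAt (𝓡 2) x₀).symm y) - Y ((extChartAt (𝓡 2) x₀).symm y))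
    rw [inner_sub_left, inner_sub_left, h0, h1] at this
    simp only [abs_zero, add_zero, mul_zero] at this
    exact sub_eq_zero.1 (norm_le_zero_iff.1 this)

end

/-! ### Calculus of weak gradients and exponential integrability on H¹. -/

section

variable {M : Type*} [TopologicalSpace M] [ChartedSpace Plane M] [IsManifold (𝓡 2) ∞ M]
  [RiemannianBundle (fun x : M => TangentSpace (𝓡 2) x)]
  [IsContMDiffRiemannianBundle (𝓡 2) ∞ Plane (fun x : M => TangentSpace (𝓡 2) x)]
  [MeasurableSpace M] [BorelSpace M] [CompactSpace M]

theorem memLp_of_continuous {f : M → ℝ} (hf : Continuous f) (p : ℝ≥0∞) : MemLp f p (vol M) := by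
  obtain ⟨K, hK⟩ := exists_bound_of_continuous hf
  exact MemLp.of_bound hf.measurable.aestronglyMeasurable K (Eventually.of_forall hK)

theorem norm_le_norm_add_norm_sub {E : Type*} [NormedAddCommGroup E] (v w : E) :
    ‖(‖v‖)‖ ≤ ‖(‖w‖ + ‖v - w‖)‖ := by
  rw [norm_norm, Real.norm_of_nonneg (by positivity)]
  calc ‖v‖ = ‖w + (v - w)‖ := by rw [add_sub_cancel]
    _ ≤ _ := norm_add_le _ _

namespace HasWeakGrad

variable {u : M → ℝ} {X : ∀ x : M, TangentSpace (𝓡 2) x}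

theorem memLp (h : HasWeakGrad u X) : MemLp u 2 (vol M) := by
  obtain ⟨hu, φ, hφ, hm, h1, h2⟩ := h
  obtain ⟨n, hn⟩ := (h1.eventually (gt_mem_nhds ENNReal.zero_lt_top)).exists
  have e1 : MemLp (fun x => φ n x - u x) 2 (vol M) :=
    ⟨(aestronglyMeasurable_of_contMDiff (hφ n)).sub hu, hn⟩
  have e2 := (memLp_of_continuous (hφ n).continuous 2).sub e1
  convert e2 using 1
  ext x
  simp

theorem memLp_norm (h : HasWeakGrad u X) : MemLp (fun x => ‖X x‖) 2 (vol M) := by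
  obtain ⟨φ, hφ, hm, h1, h2, hae1, hae2⟩ := h.exists_seq
  have hXm : AEStronglyMeasurable (fun x => ‖X x‖) (vol M) := by
    refine aestronglyMeasurable_of_tendsto_ae atTop
      (fun n => (continuous_norm_grad (hφ n)).measurable.aestronglyMeasurable) ?_
    filter_upwards [hae2] with x hx
    exact (tendsto_iff_norm_sub_tendsto_zero.2 hx).norm
  obtain ⟨n, hn⟩ := (h2.eventually (gt_mem_nhds ENNReal.zero_lt_top)).exists
  have e1 : MemLp (fun x => ‖grad (φ n) x - X x‖) 2 (vol M) := ⟨hm n, hn⟩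
  have e2 := (memLp_of_continuous (continuous_norm_grad (hφ n)) 2).add e1
  refine e2.mono hXm (Eventually.of_forall fun x => ?_)
  have := norm_le_norm_add_norm_sub (X x) (grad (φ n) x)
  rwa [norm_sub_rev (X x)] at this

theorem sub_smooth (h : HasWeakGrad u X) {g : M → ℝ} (hg : ContMDiff (𝓡 2) 𝓘(ℝ, ℝ) ∞ g) :
    HasWeakGrad (fun x => u x - g x) (fun x => X x - grad g x) := by
  obtain ⟨hu, φ, hφ, hm, h1, h2⟩ := h
  have e : ∀ n x, grad (fun x => φ n x - g x) x - (X x - grad g x) = grad (φ n) x - X x := by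
    intro n x
    rw [grad_sub (mdifferentiableAt_of_contMDiff (hφ n) x) (mdifferentiableAt_of_contMDiff hg x)]
    abel
  refine ⟨hu.sub (aestronglyMeasurable_of_contMDiff hg), fun n x => φ n x - g x,
    fun n => (hφ n).sub hg, fun n => ?_, ?_, ?_⟩
  · simp only [e]; exact hm n
  · refine h1.congr fun n => ?_
    congr 1; ext x; ring
  · simp only [e]; exact h2

theorem sub_const (h : HasWeakGrad u X) (c : ℝ) : HasWeakGrad (fun x => u x - c) X := by
  have := h.sub_smooth (g := fun _ => c) contMDiff_const
  simpa only [grad_const, sub_zero] using this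

theorem const_mul (h : HasWeakGrad u X) (c : ℝ) :
    HasWeakGrad (fun x => c * u x) (fun x => c • X x) := by
  obtain ⟨hu, φ, hφ, hm, h1, h2⟩ := h
  have e : ∀ n x, ‖grad (fun x => c * φ n x) x - c • X x‖ = |c| * ‖grad (φ n) x - X x‖ := by
    intro n x
    have hd : HasDerivAt (fun t : ℝ => c * t) c (φ n x) := by
      simpa using (hasDerivAt_id (φ n x)).const_mul c
    rw [grad_comp (mdifferentiableAt_of_contMDiff (hφ n) x) hd, ← smul_sub, norm_smul,
      Real.norm_eq_abs]
  have hlim : ∀ {s : ℕ → ℝ≥0∞} {k : ℝ}, Tendsto s atTop (𝓝 0) →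
      Tendsto (fun n => ‖k‖ₑ * s n) atTop (𝓝 0) := by
    intro s k hs
    have := ENNReal.Tendsto.const_mul hs (Or.inr (enorm_ne_top (x := k)))
    rwa [mul_zero] at this
  refine ⟨hu.const_mul c, fun n x => c * φ n x, fun n => contMDiff_const.mul (hφ n), fun n => ?_,
    ?_, ?_⟩
  · simp only [e]; exact (hm n).const_mul _
  · refine (hlim h1 (k := c)).congr fun n => ?_
    rw [← eLpNorm_const_smul]
    congr 1; ext x; simp [mul_sub]
  · refine (hlim h2 (k := |c|)).congr fun n => ?_
    simp only [e]
    rw [← eLpNorm_const_smul]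
    congr 1

/-- `weakGrad` is an arbitrary choice; uniqueness almost everywhere lets the energy be computed with
any weak gradient at hand. -/
theorem dirichlet_eq (h : HasWeakGrad u X) : dirichlet u = ∫ x, ‖X x‖ ^ 2 ∂(vol M) := by
  have hH : MemH1 u := ⟨X, h⟩
  have hw : HasWeakGrad u (weakGrad u) := by
    rw [weakGrad, dif_pos hH]
    exact hH.choose_spec
  refine integral_congr_ae ?_
  filter_upwards [hw.ae_eq h] with x hx
  rw [hx]

theorem dirichlet_const_mul (h : HasWeakGrad u X) (c : ℝ) :
    dirichlet (fun x => c * u x) = c ^ 2 * dirichlet u := by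
  rw [(h.const_mul c).dirichlet_eq, h.dirichlet_eq, ← integral_const_mul]
  congr 1
  ext x
  rw [norm_smul, mul_pow, Real.norm_eq_abs, sq_abs]

end HasWeakGrad

theorem eLpNorm_two_eq_ofReal {α : Type*} [MeasurableSpace α] {μ : Measure α} {f : α → ℝ}
    (hf : MemLp f 2 μ) : eLpNorm f 2 μ = ENNReal.ofReal (Real.sqrt (∫ x, f x ^ 2 ∂μ)) := by
  rw [hf.eLpNorm_eq_integral_rpow_norm (by simp) (by simp), Real.sqrt_eq_rpow]
  simp

theorem lintegral_energy_le {f : M → ℝ} (hf : ContMDiff (𝓡 2) 𝓘(ℝ, ℝ) ∞ f) :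
    ∫⁻ x, (‖grad f x‖ₑ + ‖f x‖ₑ) ^ 2 ∂(vol M) ≤
      (eLpNorm f 2 (vol M) + eLpNorm (fun x => ‖grad f x‖) 2 (vol M)) ^ 2 := by
  have m1 := memLp_of_continuous hf.continuous 2
  have m2 := memLp_of_continuous (continuous_norm_grad hf) 2
  have e0 : ∀ x, ‖grad f x‖ₑ + ‖f x‖ₑ = ‖(‖grad f x‖ + ‖f x‖)‖ₑ := by
    intro x
    rw [Real.enorm_eq_ofReal (add_nonneg (norm_nonneg _) (norm_nonneg _)),
      ENNReal.ofReal_add (norm_nonneg _) (norm_nonneg _), ofReal_norm, ofReal_norm]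
  have e1 : ∫⁻ x, (‖grad f x‖ₑ + ‖f x‖ₑ) ^ 2 ∂(vol M) =
      eLpNorm (fun x => ‖grad f x‖ + ‖f x‖) 2 (vol M) ^ 2 := by
    simp only [e0]
    rw [eLpNorm_eq_lintegral_rpow_enorm_toReal (by simp) (by simp), ← ENNReal.rpow_two,
      ← ENNReal.rpow_mul]
    simp only [ENNReal.toReal_ofNat, ENNReal.rpow_two]
    rw [one_div, inv_mul_cancel₀ (by norm_num), ENNReal.rpow_one]
  rw [e1]
  gcongr
  refine le_trans (eLpNorm_add_le m2.1 m1.norm.1 (by norm_num)) ?_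
  rw [eLpNorm_norm, add_comm]

variable (M) in
/-- Exponential integrability for Sobolev functions of small energy. -/
theorem exists_lintegral_cosh_le_of_hasWeakGrad :
    ∃ κ : ℝ≥0∞, 0 < κ ∧ ∀ (u : M → ℝ) (X : ∀ x : M, TangentSpace (𝓡 2) x), HasWeakGrad u X →
      eLpNorm u 2 (vol M) + eLpNorm (fun x => ‖X x‖) 2 (vol M) < κ →
      ∫⁻ x, ENNReal.ofReal (Real.cosh (u x)) ∂(vol M) ≤ 2 * vol M univ := by
  obtain ⟨κ, hκ, hcosh⟩ := exists_lintegral_cosh_le M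
  -- The smallness here concerns a sum of norms, while the smooth statement bounds its square; (min
  -- κ 1)² ≤ κ reconciles the two.
  refine ⟨min κ 1, lt_min hκ one_pos, fun u X h hlt => ?_⟩
  obtain ⟨φ, hφ, hm, h1, h2, hae1, hae2⟩ := h.exists_seq
  have hsm : ∀ n, eLpNorm (φ n) 2 (vol M) + eLpNorm (fun x => ‖grad (φ n) x‖) 2 (vol M) ≤ min κ 1 →
      ∫⁻ x, ENNReal.ofReal (Real.cosh (φ n x)) ∂(vol M) ≤ 2 * vol M univ := by
    intro n hn
    refine hcosh (φ n) (hφ n) ((lintegral_energy_le (hφ n)).trans ?_)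
    calc _ ≤ (min κ 1) ^ 2 := by gcongr
      _ = min κ 1 * min κ 1 := sq _
      _ ≤ κ * 1 := by gcongr <;> simp
      _ = κ := mul_one κ
  have hev : ∀ᶠ n in atTop,
      eLpNorm (φ n) 2 (vol M) + eLpNorm (fun x => ‖grad (φ n) x‖) 2 (vol M) ≤ min κ 1 := by
    have hlim : Tendsto (fun n => (eLpNorm u 2 (vol M) + eLpNorm (fun x => φ n x - u x) 2 (vol M)) +
        (eLpNorm (fun x => ‖X x‖) 2 (vol M) + eLpNorm (fun x => ‖grad (φ n) x - X x‖) 2 (vol M)))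
        atTop (𝓝 ((eLpNorm u 2 (vol M) + 0) + (eLpNorm (fun x => ‖X x‖) 2 (vol M) + 0))) :=
      (tendsto_const_nhds.add h1).add (tendsto_const_nhds.add h2)
    rw [add_zero, add_zero] at hlim
    filter_upwards [hlim.eventually (gt_mem_nhds hlt)] with n hn
    refine le_trans (add_le_add ?_ ?_) hn.le
    · refine le_trans (le_of_eq ?_) (eLpNorm_add_le h.1
        ((aestronglyMeasurable_of_contMDiff (hφ n)).sub h.1) (by norm_num))
      congr 1; ext x; simp
    · exact le_trans (eLpNorm_mono fun x => norm_le_norm_add_norm_sub (grad (φ n) x) (X x))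
        (eLpNorm_add_le h.memLp_norm.1 (hm n) (by norm_num))
  -- Fatou's lemma along smooth approximants that converge almost everywhere.
  calc ∫⁻ x, ENNReal.ofReal (Real.cosh (u x)) ∂(vol M)
      = ∫⁻ x, liminf (fun n => ENNReal.ofReal (Real.cosh (φ n x))) atTop ∂(vol M) := by
        refine lintegral_congr_ae ?_
        filter_upwards [hae1] with x hx
        refine (Tendsto.liminf_eq ?_).symm
        exact (ENNReal.continuous_ofReal.comp Real.continuous_cosh).continuousAt.tendsto.comp hx
    _ ≤ liminf (fun n => ∫⁻ x, ENNReal.ofReal (Real.cosh (φ n x)) ∂(vol M)) atTop :=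
        lintegral_liminf_le' fun n =>
          (Real.continuous_cosh.comp (hφ n).continuous).measurable.ennreal_ofReal.aemeasurable
    _ ≤ 2 * vol M univ :=
        liminf_le_of_frequently_le' ((hev.mono fun n hn => hsm n hn).frequently)

theorem exp_le_two_mul_cosh (t : ℝ) : Real.exp |t| ≤ 2 * Real.cosh t := by
  rw [← Real.cosh_abs, Real.cosh_eq]
  have := Real.exp_pos (-|t|)
  linarith

/-- The exponential of a Sobolev function is integrable. -/
theorem HasWeakGrad.integrable_exp_abs {u : M → ℝ} {X : ∀ x : M, TangentSpace (𝓡 2) x}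
    (h : HasWeakGrad u X) : Integrable (fun x => Real.exp |u x|) (vol M) := by
  obtain ⟨κ, hκ, hcosh⟩ := exists_lintegral_cosh_le_of_hasWeakGrad M
  obtain ⟨hu, φ, hφ, hm, h1, h2⟩ := id h
  have hlim := h1.add h2
  rw [add_zero] at hlim
  obtain ⟨n, hn⟩ := (hlim.eventually (gt_mem_nhds hκ)).exists
  -- No smallness of `u` is needed: it differs from a smooth, hence bounded, function by one of
  -- small energy, and e^{|u|} ≤ e^K e^{|u − φ n|}.
  have hc := hcosh _ _ (h.sub_smooth (hφ n)) (by
    refine lt_of_eq_of_lt ?_ hn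
    congr 1
    · rw [← eLpNorm_neg]
      congr 1; ext x; simp
    · congr 1; ext x; exact norm_sub_rev _ _)
  have hci : Integrable (fun x => Real.cosh (u x - φ n x)) (vol M) := by
    refine ⟨Real.continuous_cosh.comp_aestronglyMeasurable
      (hu.sub (aestronglyMeasurable_of_contMDiff (hφ n))), ?_⟩
    rw [hasFiniteIntegral_iff_ofReal (Eventually.of_forall fun x => (Real.cosh_pos _).le)]
    exact hc.trans_lt (ENNReal.mul_lt_top (by simp) (measure_lt_top _ _))
  obtain ⟨K, hK⟩ := exists_bound_of_continuous (hφ n).continuous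
  refine (hci.const_mul (Real.exp K * 2)).mono'
    (Real.continuous_exp.comp_aestronglyMeasurable
      (continuous_abs.comp_aestronglyMeasurable hu)) (Eventually.of_forall fun x => ?_)
  rw [Real.norm_of_nonneg (Real.exp_pos _).le, mul_assoc]
  calc Real.exp |u x| ≤ Real.exp (K + |u x - φ n x|) := by
        apply Real.exp_le_exp.2
        have := abs_add_le (φ n x) (u x - φ n x)
        rw [add_sub_cancel] at this
        linarith [hK x]
    _ = Real.exp K * Real.exp |u x - φ n x| := Real.exp_add _ _
    _ ≤ _ := by gcongr; exact exp_le_two_mul_cosh _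

theorem HasWeakGrad.integrable_exp {u : M → ℝ} {X : ∀ x : M, TangentSpace (𝓡 2) x}
    (h : HasWeakGrad u X) : Integrable (fun x => Real.exp (u x)) (vol M) :=
  h.integrable_exp_abs.mono' (Real.continuous_exp.comp_aestronglyMeasurable h.1)
    (Eventually.of_forall fun x => by
      rw [Real.norm_of_nonneg (Real.exp_pos _).le]
      exact Real.exp_le_exp.2 (le_abs_self _))

theorem HasWeakGrad.integrable_exp_neg {u : M → ℝ} {X : ∀ x : M, TangentSpace (𝓡 2) x}
    (h : HasWeakGrad u X) : Integrable (fun x => Real.exp (-u x)) (vol M) :=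
  h.integrable_exp_abs.mono' (Real.continuous_exp.comp_aestronglyMeasurable h.1.neg)
    (Eventually.of_forall fun x => by
      rw [Real.norm_of_nonneg (Real.exp_pos _).le]
      exact Real.exp_le_exp.2 (neg_le_abs _))

end

/-! ### The Poincaré inequality and the nondegenerate local minimum. -/

section

variable {M : Type*} [TopologicalSpace M] [ChartedSpace Plane M] [IsManifold (𝓡 2) ∞ M]
  [RiemannianBundle (fun x : M => TangentSpace (𝓡 2) x)]
  [IsContMDiffRiemannianBundle (𝓡 2) ∞ Plane (fun x : M => TangentSpace (𝓡 2) x)]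
  [MeasurableSpace M] [BorelSpace M] [CompactSpace M]

theorem hasWeakGrad_of_contMDiff {f : M → ℝ} (hf : ContMDiff (𝓡 2) 𝓘(ℝ, ℝ) ∞ f) :
    HasWeakGrad f (grad f) := by
  refine ⟨aestronglyMeasurable_of_contMDiff hf, fun _ => f, fun _ => hf, fun n => ?_, ?_, ?_⟩
  · simp only [sub_self, norm_zero]; exact aestronglyMeasurable_const
  · simp
  · simp

theorem dirichlet_nonneg (u : M → ℝ) : 0 ≤ dirichlet u :=
  integral_nonneg fun _ => by positivity

theorem normE_sq (u : M → ℝ) : normE u ^ 2 = dirichlet u := Real.sq_sqrt (dirichlet_nonneg u)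

/-- The Poincaré inequality, with the constant `μ₁(M)`. -/
theorem mu1_mul_le {u : M → ℝ} (hu : MemE u) :
    mu1 M * ∫ x, u x ^ 2 ∂(vol M) ≤ dirichlet u := by
  obtain ⟨⟨X, hX⟩, -⟩ := id hu
  by_cases h0 : u =ᵐ[vol M] 0
  · have : ∫ x, u x ^ 2 ∂(vol M) = 0 := by
      rw [integral_congr_ae (g := fun _ => (0 : ℝ)) (by
        filter_upwards [h0] with x hx; rw [hx]; simp)]
      simp
    rw [this, mul_zero]
    exact dirichlet_nonneg u
  · have hpos : 0 < ∫ x, u x ^ 2 ∂(vol M) := by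
      refine lt_of_le_of_ne (integral_nonneg fun x => sq_nonneg _) fun h => h0 ?_
      have := (integral_eq_zero_iff_of_nonneg (fun x => sq_nonneg (u x)) hX.memLp.integrable_sq).1
        h.symm
      filter_upwards [this] with x hx
      simpa using hx
    rw [← le_div_iff₀ hpos]
    refine csInf_le ⟨0, ?_⟩ ⟨u, hu, h0, rfl⟩
    rintro t ⟨w, -, -, rfl⟩
    exact div_nonneg (dirichlet_nonneg w) (integral_nonneg fun x => sq_nonneg _)

theorem ae_eq_zero_of_normE {u : M → ℝ} (hmu : 0 < mu1 M) (hu : MemE u) (h : normE u = 0) :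
    u =ᵐ[vol M] 0 := by
  have h1 := mu1_mul_le hu
  rw [← normE_sq, h] at h1
  have h2 : ∫ x, u x ^ 2 ∂(vol M) = 0 :=
    le_antisymm (by nlinarith) (integral_nonneg fun x => sq_nonneg _)
  obtain ⟨X, hX⟩ := hu.1
  filter_upwards [(integral_eq_zero_iff_of_nonneg (fun x => sq_nonneg (u x))
    hX.memLp.integrable_sq).1 h2] with x hx
  simpa using hx

theorem functional_of_ae_eq_zero {u : M → ℝ} (hA : 0 < area M) (hD : dirichlet u = 0)
    (h : u =ᵐ[vol M] 0) (l₁ l₂ : ℝ) : functional l₁ l₂ u = 0 := by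
  have e1 : ∫ x, Real.exp (u x) ∂(vol M) = area M := by
    rw [integral_congr_ae (g := fun _ => (1 : ℝ)) (by filter_upwards [h] with x hx; simp [hx])]
    simp [area]
  have e2 : ∫ x, Real.exp (-u x) ∂(vol M) = area M := by
    rw [integral_congr_ae (g := fun _ => (1 : ℝ)) (by filter_upwards [h] with x hx; simp [hx])]
    simp [area]
  rw [functional, e1, e2, hD, one_div_mul_cancel hA.ne']
  simp

theorem functional_zero (hA : 0 < area M) (l₁ l₂ : ℝ) : functional (M := M) l₁ l₂ 0 = 0 := by
  refine functional_of_ae_eq_zero hA ?_ (Eventually.of_forall fun _ => rfl) l₁ l₂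
  have : HasWeakGrad (0 : M → ℝ) (grad (0 : M → ℝ)) := hasWeakGrad_of_contMDiff contMDiff_const
  rw [this.dirichlet_eq]
  have e : ∀ x : M, grad (0 : M → ℝ) x = 0 := fun x => grad_const 0 x
  simp [e]

/-- By Poincaré the L² norms of `u` and of its gradient add up to at most Q‖u‖. Rescaling to
Dirichlet norm `s` therefore puts every nonzero `u` below the threshold of exponential
integrability, with one bound for all of them. -/
theorem exists_integral_cosh_le (hmu : 0 < mu1 M) :
    ∃ s > 0, ∀ u : M → ℝ, MemE u → 0 < normE u →
      Integrable (fun x => Real.cosh (s / normE u * u x)) (vol M) ∧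
      ∫ x, Real.cosh (s / normE u * u x) ∂(vol M) ≤ 2 * area M := by
  obtain ⟨κ, hκ, hcosh⟩ := exists_lintegral_cosh_le_of_hasWeakGrad M
  obtain ⟨k, hk0, hkκ⟩ : ∃ k : ℝ, 0 < k ∧ ENNReal.ofReal k < κ := by
    obtain ⟨k, hk0, hk⟩ := ENNReal.lt_iff_exists_nnreal_btwn.1 hκ
    exact ⟨k, by exact_mod_cast hk0, by simpa using hk⟩
  set Q := 1 / Real.sqrt (mu1 M) + 1 with hQ
  have hQ0 : 0 < Q := by positivity
  refine ⟨k / Q, by positivity, fun u hu hN => ?_⟩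
  obtain ⟨⟨X, hX⟩, hmean⟩ := id hu
  set N := normE u
  set t := k / Q / N with ht
  have ht0 : 0 < t := by positivity
  have hw := hX.const_mul t
  have hsqrtu : Real.sqrt (∫ x, u x ^ 2 ∂(vol M)) ≤ N / Real.sqrt (mu1 M) := by
    rw [le_div_iff₀ (Real.sqrt_pos.2 hmu), ← Real.sqrt_mul (integral_nonneg fun x => sq_nonneg _)]
    refine Real.sqrt_le_sqrt ?_
    rw [mul_comm]
    exact mu1_mul_le hu
  have n1 : eLpNorm (fun x => t * u x) 2 (vol M) ≤ ENNReal.ofReal (t * (N / Real.sqrt (mu1 M))) := by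
    rw [eLpNorm_two_eq_ofReal hw.memLp]
    refine ENNReal.ofReal_le_ofReal ?_
    simp only [mul_pow]
    rw [integral_const_mul, Real.sqrt_mul (sq_nonneg _), Real.sqrt_sq ht0.le]
    gcongr
  have n2 : eLpNorm (fun x => ‖t • X x‖) 2 (vol M) = ENNReal.ofReal (t * N) := by
    rw [eLpNorm_two_eq_ofReal hw.memLp_norm, ← hw.dirichlet_eq, hX.dirichlet_const_mul,
      Real.sqrt_mul (sq_nonneg _), Real.sqrt_sq ht0.le]
    rfl
  have hle := hcosh _ _ hw (by
    refine lt_of_le_of_lt (add_le_add n1 n2.le) ?_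
    rw [← ENNReal.ofReal_add (by positivity) (by positivity)]
    have : t * (N / Real.sqrt (mu1 M)) + t * N = k := by
      have e : t * (N / Real.sqrt (mu1 M)) + t * N = (t * N) * Q := by rw [hQ]; ring
      rw [e, ht]; field_simp
    rw [this]
    exact hkκ)
  have hm : AEStronglyMeasurable (fun x => Real.cosh (t * u x)) (vol M) :=
    Real.continuous_cosh.comp_aestronglyMeasurable hw.1
  have hnn : 0 ≤ᵐ[vol M] fun x => Real.cosh (t * u x) :=
    Eventually.of_forall fun x => (Real.cosh_pos _).le
  refine ⟨⟨hm, ?_⟩, ?_⟩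
  · rw [hasFiniteIntegral_iff_ofReal hnn]
    exact hle.trans_lt (ENNReal.mul_lt_top (by simp) (measure_lt_top _ _))
  · rw [integral_eq_lintegral_of_nonneg_ae hnn hm]
    have h3 := ENNReal.toReal_mono (ENNReal.mul_ne_top (by simp) (measure_ne_top (vol M) univ)) hle
    rwa [ENNReal.toReal_mul, ENNReal.toReal_ofNat] at h3

theorem abs_exp_sub_le (t : ℝ) :
    Real.exp t ≤ 1 + t + t ^ 2 / 2 + |t| ^ 3 * Real.exp |t| := by
  have h := Complex.norm_exp_sub_sum_le_norm_mul_exp (t : ℂ) 3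
  have e : Complex.exp t - ∑ m ∈ Finset.range 3, (t : ℂ) ^ m / (m.factorial : ℂ) =
      ((Real.exp t - (1 + t + t ^ 2 / 2) : ℝ) : ℂ) := by
    simp [Finset.sum_range_succ, Nat.factorial]
  rw [e, Complex.norm_real, Complex.norm_real, Real.norm_eq_abs, Real.norm_eq_abs] at h
  linarith [le_abs_self (Real.exp t - (1 + t + t ^ 2 / 2))]

/-- With x = s|t|/(2N), the condition N ≤ s/2 gives |t| ≤ x. The cube is traded for a second factor
eˣ through x³ ≤ 6eˣ, and e^{2x} ≤ 2 cosh(st/N). The gain is the factor (N/s)³ in front of a function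
whose integral is bounded independently of `u`. -/
theorem cube_mul_exp_le {s N : ℝ} (hs : 0 < s) (hN : 0 < N) (hNs : N ≤ s / 2) (t : ℝ) :
    |t| ^ 3 * Real.exp |t| ≤ 96 * (N / s) ^ 3 * Real.cosh (s / N * t) := by
  set x := s / N * |t| / 2 with hx
  have hx0 : 0 ≤ x := by positivity
  have h1 : |t| ≤ x := by
    rw [hx]
    have : 2 ≤ s / N := by rw [le_div_iff₀ hN]; linarith
    nlinarith [abs_nonneg t]
  have h2 : x ^ 3 ≤ 6 * Real.exp x := by
    have := Real.pow_div_factorial_le_exp x hx0 3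
    rw [div_le_iff₀ (by positivity)] at this
    norm_num [Nat.factorial] at this
    linarith
  have h3 : |t| = 2 * (N / s) * x := by rw [hx]; field_simp
  have h4 : Real.exp (x + x) ≤ 2 * Real.cosh (s / N * t) := by
    refine le_trans (le_of_eq ?_) (exp_le_two_mul_cosh (s / N * t))
    rw [abs_mul, abs_of_pos (by positivity : 0 < s / N)]
    congr 1
    rw [hx]; ring
  calc |t| ^ 3 * Real.exp |t| ≤ |t| ^ 3 * Real.exp x := by gcongr
    _ = 8 * (N / s) ^ 3 * (x ^ 3 * Real.exp x) := by rw [h3]; ring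
    _ ≤ 8 * (N / s) ^ 3 * ((6 * Real.exp x) * Real.exp x) := by gcongr
    _ = 48 * (N / s) ^ 3 * Real.exp (x + x) := by rw [Real.exp_add]; ring
    _ ≤ 48 * (N / s) ^ 3 * (2 * Real.cosh (s / N * t)) := by gcongr
    _ = _ := by ring

/-- Mean zero removes the linear term of the expansion of eᵘ, the quadratic term gives ∫u²/(2|M|),
the cubic remainder is absorbed by the cosh bound, and ln x ≤ x − 1 concludes. -/
theorem log_mean_exp_le (hA : 0 < area M) {s : ℝ} (hs : 0 < s) {u : M → ℝ} (hu : MemE u)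
    (hN : 0 < normE u) (hNs : normE u ≤ s / 2)
    (hc : Integrable (fun x => Real.cosh (s / normE u * u x)) (vol M))
    (hc' : ∫ x, Real.cosh (s / normE u * u x) ∂(vol M) ≤ 2 * area M) :
    Real.log (1 / area M * ∫ x, Real.exp (u x) ∂(vol M)) ≤
      (∫ x, u x ^ 2 ∂(vol M)) / (2 * area M) + 192 * (normE u / s) ^ 3 := by
  obtain ⟨⟨X, hX⟩, hmean⟩ := hu
  set N := normE u
  haveI : NeZero (vol M) := ⟨fun h => by simp [area, h] at hA⟩
  have hpos : 0 < ∫ x, Real.exp (u x) ∂(vol M) := integral_exp_pos hX.integrable_exp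
  have hui : Integrable u (vol M) := hX.memLp.integrable (by norm_num)
  have i0 : Integrable (fun x => 1 + u x) (vol M) := (integrable_const 1).add hui
  have i1 : Integrable (fun x => 1 + u x + u x ^ 2 / 2) (vol M) :=
    i0.add (hX.memLp.integrable_sq.div_const 2)
  have i2 := hc.const_mul (96 * (N / s) ^ 3)
  have hint : ∫ x, Real.exp (u x) ∂(vol M) ≤
      area M + (∫ x, u x ^ 2 ∂(vol M)) / 2 + 96 * (N / s) ^ 3 * (2 * area M) := by
    calc ∫ x, Real.exp (u x) ∂(vol M)
        ≤ ∫ x, ((1 + u x + u x ^ 2 / 2) + 96 * (N / s) ^ 3 * Real.cosh (s / N * u x)) ∂(vol M) := by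
          refine integral_mono hX.integrable_exp (i1.add i2) fun x => ?_
          have h1 := abs_exp_sub_le (u x)
          have h2 := cube_mul_exp_le hs hN hNs (u x)
          simp only
          linarith
      _ = area M + (∫ x, u x ^ 2 ∂(vol M)) / 2 +
            96 * (N / s) ^ 3 * ∫ x, Real.cosh (s / N * u x) ∂(vol M) := by
          rw [integral_add i1 i2, integral_add i0 (hX.memLp.integrable_sq.div_const 2),
            integral_add (integrable_const 1) hui, hmean, integral_div, integral_const_mul]
          simp [area]
      _ ≤ _ := by gcongr
  have hlog := Real.log_le_sub_one_of_pos (x := 1 / area M * ∫ x, Real.exp (u x) ∂(vol M))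
    (by positivity)
  refine hlog.trans ?_
  rw [sub_le_iff_le_add, one_div, inv_mul_le_iff₀ hA]
  refine hint.trans (le_of_eq ?_)
  field_simp
  ring

theorem MemE.neg {u : M → ℝ} (hu : MemE u) : MemE (fun x => -u x) := by
  obtain ⟨⟨X, hX⟩, hm⟩ := hu
  have h := hX.const_mul (-1)
  simp only [neg_one_mul] at h
  exact ⟨⟨_, h⟩, by rw [integral_neg, hm, neg_zero]⟩

theorem dirichlet_neg {u : M → ℝ} (hu : MemH1 u) : dirichlet (fun x => -u x) = dirichlet u := by
  obtain ⟨X, hX⟩ := hu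
  have h := hX.dirichlet_const_mul (-1)
  simpa using h

/-- `0` is a nondegenerate local minimum. -/
theorem isNondegenerateAtZero (hmu : 0 < mu1 M) (hA : 0 < area M) {l₁ l₂ : ℝ} (h₁ : 0 ≤ l₁)
    (h₂ : 0 ≤ l₂) (hl : l₁ + l₂ < mu1 M * area M) :
    IsNondegenerateAtZero (functional (M := M) l₁ l₂) := by
  obtain ⟨s, hs, hcosh⟩ := exists_integral_cosh_le hmu
  set mu := mu1 M
  set A := area M
  -- The quadratic part of the functional is at least θ‖u‖². Half of it is spent on the cubic
  -- remainder T‖u‖³, which is why the radius below makes T‖u‖ ≤ θ/2.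
  set θ := (1 - (l₁ + l₂) / (mu * A)) / 2 with hθ
  have hθ0 : 0 < θ := by
    have : (l₁ + l₂) / (mu * A) < 1 := by rw [div_lt_one (by positivity)]; exact hl
    rw [hθ]; linarith
  set T := 192 * (l₁ + l₂) / s ^ 3 with hT
  have hT0 : 0 ≤ T := by positivity
  refine ⟨min (s / 2) (θ / 2 / (T + 1)), by positivity, θ / 2, by positivity, fun u hu hN => ?_⟩
  rw [functional_zero hA, zero_add]
  rcases (Real.sqrt_nonneg (dirichlet u)).eq_or_lt with h0 | h0
  · have h0' : normE u = 0 := h0.symm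
    rw [functional_of_ae_eq_zero hA (by rw [← normE_sq, h0']; norm_num)
      (ae_eq_zero_of_normE hmu hu h0'), h0']
    simp
  change 0 < normE u at h0
  obtain ⟨c1, c2⟩ := hcosh u hu h0
  have hNs : normE u ≤ s / 2 := hN.le.trans (min_le_left _ _)
  have hNT : normE u * (T + 1) ≤ θ / 2 := by
    rw [← le_div_iff₀ (by positivity)]; exact hN.le.trans (min_le_right _ _)
  have b1 := log_mean_exp_le hA hs hu h0 hNs c1 c2
  have hneg : normE (fun x => -u x) = normE u := by rw [normE, dirichlet_neg hu.1]; rfl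
  have b2 := log_mean_exp_le hA hs hu.neg (by rwa [hneg]) (by rwa [hneg])
    (by simpa only [hneg, mul_neg, Real.cosh_neg] using c1)
    (by simpa only [hneg, mul_neg, Real.cosh_neg] using c2)
  simp only [hneg, neg_sq] at b2
  have hP := mu1_mul_le hu
  rw [← normE_sq] at hP
  set N := normE u
  set S := ∫ x, u x ^ 2 ∂(vol M)
  have hS : S / (2 * A) ≤ N ^ 2 / (2 * (mu * A)) := by
    rw [div_le_div_iff₀ (by positivity) (by positivity)]
    have := mul_le_mul_of_nonneg_left hP (by positivity : 0 ≤ 2 * A)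
    linarith
  have hkey : (l₁ + l₂) * (S / (2 * A) + 192 * (N / s) ^ 3) ≤
      (l₁ + l₂) / (mu * A) * N ^ 2 / 2 + T * N * N ^ 2 := by
    calc _ ≤ (l₁ + l₂) * (N ^ 2 / (2 * (mu * A)) + 192 * (N / s) ^ 3) := by gcongr
      _ = _ := by rw [hT]; field_simp
  have hTN : T * N * N ^ 2 ≤ θ / 2 * N ^ 2 := by
    gcongr
    nlinarith
  have hb1 := mul_le_mul_of_nonneg_left b1 h₁
  have hb2 := mul_le_mul_of_nonneg_left b2 h₂
  rw [functional, ← normE_sq]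
  have e : θ * N ^ 2 = N ^ 2 / 2 - (l₁ + l₂) / (mu * A) * N ^ 2 / 2 := by rw [hθ]; ring
  linarith

/-- A nondegenerate local minimum is strict. -/
theorem IsNondegenerateAtZero.isStrictLocalMinAtZero (hmu : 0 < mu1 M) {J : (M → ℝ) → ℝ}
    (h : IsNondegenerateAtZero J) : IsStrictLocalMinAtZero J := by
  obtain ⟨ρ, hρ, c, hc, h⟩ := h
  refine ⟨ρ, hρ, fun u hu h0 hN => ?_⟩
  have hpos : 0 < normE u := lt_of_le_of_ne (Real.sqrt_nonneg _)
    fun h => h0 (ae_eq_zero_of_normE hmu hu h.symm)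
  have := h u hu hN
  have : 0 < c * normE u ^ 2 := by positivity
  linarith

/-- A nondegenerate local minimum of a functional that is unbounded below yields the mountain pass
geometry. -/
theorem IsNondegenerateAtZero.hasMountainPassGeometry {J : (M → ℝ) → ℝ}
    (h : IsNondegenerateAtZero J) (hJ : IsUnboundedBelow J) : HasMountainPassGeometry J := by
  obtain ⟨ρ, hρ, c, hc, h⟩ := h
  obtain ⟨e, he, hlt⟩ := hJ (J 0)
  -- The quadratic bound holds on the open ball of radius ρ only, so the sphere is taken at ρ/2. A
  -- point with value below `J 0` cannot lie in that ball, hence lies outside the sphere.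
  refine ⟨ρ / 2, by positivity, J 0 + c * (ρ / 2) ^ 2, by linarith [show 0 < c * (ρ / 2) ^ 2 by positivity],
    fun u hu hN => ?_, e, he, ?_, hlt⟩
  · have := h u hu (by linarith)
    rwa [hN] at this
  · by_contra hle
    have := h e he (by linarith)
    have : 0 ≤ c * normE e ^ 2 := by positivity
    linarith

end

/-! ### The Riemannian distance compared with chart coordinates. -/

section

variable {M : Type*} [TopologicalSpace M] [ChartedSpace Plane M] [IsManifold (𝓡 2) ∞ M]
  [RiemannianBundle (fun x : M => TangentSpace (𝓡 2) x)]
  [IsContMDiffRiemannianBundle (𝓡 2) ∞ Plane (fun x : M => TangentSpace (𝓡 2) x)]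

/-- A linear coordinate change that makes the metric Euclidean at one point. -/
theorem exists_linear_isometry {x₀ : M} {y : Plane} (hy : y ∈ (extChartAt (𝓡 2) x₀).target) :
    ∃ A : Plane ≃L[ℝ] Plane, (∀ w, ‖A w‖ = ‖chartLin x₀ y w‖) ∧
      LinearMap.det (A : Plane →ₗ[ℝ] Plane) = dens x₀ y := by
  set a := metricMatrix x₀ y 0 0 with ha
  set b := metricMatrix x₀ y 0 1 with hb
  set c := metricMatrix x₀ y 1 1 with hc
  have hdet := det_metricMatrix x₀ y
  rw [← ha, ← hb, ← hc] at hdet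
  have hdp := det_metricMatrix_pos hy
  have ha0 : 0 < a := by
    have h1 : chartLin x₀ y (EuclideanSpace.single 0 1) ≠ 0 := fun h => by
      have := (chartLin_bijective hy).1 (h.trans (map_zero _).symm)
      simp at this
    have h2 := norm_chartLin_sq x₀ y (EuclideanSpace.single 0 1)
    simp at h2
    rw [ha, ← h2]
    exact pow_pos (norm_pos_iff.2 h1) 2
  set s := Real.sqrt a with hs
  have hs0 : 0 < s := Real.sqrt_pos.2 ha0
  have hss : s ^ 2 = a := Real.sq_sqrt ha0.le
  set d := dens x₀ y with hd
  have hd0 : 0 < d := dens_pos hy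
  have hdd : d ^ 2 = a * c - b ^ 2 := by rw [← hdet]; exact Real.sq_sqrt hdp.le
  -- The Cholesky factor of the metric: mᵀ m = g, with determinant √(det g).
  set m : Matrix (Fin 2) (Fin 2) ℝ := !![s, b / s; 0, d / s] with hm
  set L : Plane →ₗ[ℝ] Plane := Matrix.toLin (EuclideanSpace.basisFun (Fin 2) ℝ).toBasis
    (EuclideanSpace.basisFun (Fin 2) ℝ).toBasis m with hL
  have hdetL : LinearMap.det L = d := by
    rw [hL, LinearMap.det_toLin, hm, Matrix.det_fin_two]
    simp
    field_simp
  have hne : (LinearMap.toContinuousLinearMap L).det ≠ 0 := by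
    change LinearMap.det L ≠ 0
    rw [hdetL]
    exact hd0.ne'
  refine ⟨(LinearMap.toContinuousLinearMap L).toContinuousLinearEquivOfDetNeZero hne,
    fun w => ?_, ?_⟩
  · have e0 : ((LinearMap.toContinuousLinearMap L).toContinuousLinearEquivOfDetNeZero hne w) =
        L w := rfl
    have h0 : (L w) 0 = s * w 0 + b / s * w 1 := by
      simp [hL, Matrix.toLin_apply, hm, Matrix.mulVec, dotProduct, Fin.sum_univ_two]
    have h1 : (L w) 1 = d / s * w 1 := by
      simp [hL, Matrix.toLin_apply, hm, Matrix.mulVec, dotProduct, Fin.sum_univ_two]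
    rw [e0, ← sq_eq_sq₀ (norm_nonneg _) (norm_nonneg _), norm_chartLin_sq,
      EuclideanSpace.norm_sq_eq, Fin.sum_univ_two, Real.norm_eq_abs, Real.norm_eq_abs, sq_abs,
      sq_abs, h0, h1, ← ha, ← hb, ← hc]
    have e1 : (d / s * w 1) ^ 2 = (a * c - b ^ 2) / a * w 1 ^ 2 := by
      rw [mul_pow, div_pow, hdd, hss]
    have e2 : (s * w 0 + b / s * w 1) ^ 2 = a * w 0 ^ 2 + 2 * b * (w 0 * w 1) + b ^ 2 / a * w 1 ^ 2 := by
      rw [← hss]; field_simp; ring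
    rw [e1, e2]
    field_simp
    ring
  · exact hdetL

theorem pathELength_symm_comp {x₀ : M} {c : ℝ → Plane} {a b : ℝ} (hab : a < b)
    (hc : ContDiffOn ℝ 1 c (Icc a b)) (hct : ∀ t ∈ Icc a b, c t ∈ (extChartAt (𝓡 2) x₀).target) :
    pathELength (𝓡 2) ((extChartAt (𝓡 2) x₀).symm ∘ c) a b =
      ∫⁻ t in Icc a b, ‖chartLin x₀ (c t) (derivWithin c (Icc a b) t)‖ₑ := by
  rw [pathELength_eq_lintegral_mfderivWithin_Icc]
  refine setLIntegral_congr_fun measurableSet_Icc fun t ht => ?_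
  have h1 : mfderivWithin 𝓘(ℝ, ℝ) (𝓡 2) ((extChartAt (𝓡 2) x₀).symm ∘ c) (Icc a b) t =
      (mfderiv 𝓘(ℝ, Plane) (𝓡 2) (extChartAt (𝓡 2) x₀).symm (c t)) ∘L
        (mfderivWithin 𝓘(ℝ, ℝ) 𝓘(ℝ, Plane) c (Icc a b) t) := by
    apply mfderiv_comp_mfderivWithin
    · exact mdifferentiableAt_symm (hct t ht)
    · exact ((hc.differentiableOn one_ne_zero) t ht).mdifferentiableWithinAt
    · rw [uniqueMDiffWithinAt_iff_uniqueDiffWithinAt]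
      exact uniqueDiffOn_Icc hab t ht
  have h2 : mfderivWithin 𝓘(ℝ, ℝ) (𝓡 2) ((extChartAt (𝓡 2) x₀).symm ∘ c) (Icc a b) t 1 =
      chartLin x₀ (c t) (derivWithin c (Icc a b) t) := by
    rw [h1, mfderivWithin_eq_fderivWithin, ← fderivWithin_derivWithin]
    rfl
  rw [h2]

theorem contMDiffOn_symm_comp {x₀ : M} {c : ℝ → Plane} {a b : ℝ}
    (hc : ContDiffOn ℝ 1 c (Icc a b)) (hct : ∀ t ∈ Icc a b, c t ∈ (extChartAt (𝓡 2) x₀).target) :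
    ContMDiffOn 𝓘(ℝ, ℝ) (𝓡 2) 1 ((extChartAt (𝓡 2) x₀).symm ∘ c) (Icc a b) :=
  (contMDiffOn_extChartAt_symm (n := 1) x₀).comp (contMDiffOn_iff_contDiffOn.2 hc) hct

/-- Points that are close in the chart are close for the Riemannian distance. -/
theorem riemannianEDist_symm_le {x₀ : M} {V : Set Plane} (hV : Convex ℝ V)
    (hVt : V ⊆ (extChartAt (𝓡 2) x₀).target) {A : Plane ≃L[ℝ] Plane} {k : ℝ}
    (hk : ∀ z ∈ V, ∀ w, ‖chartLin x₀ z w‖ ≤ k * ‖A w‖) {p q : Plane} (hp : p ∈ V) (hq : q ∈ V) :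
    riemannianEDist (𝓡 2) ((extChartAt (𝓡 2) x₀).symm p) ((extChartAt (𝓡 2) x₀).symm q) ≤
      ENNReal.ofReal (k * ‖A (q - p)‖) := by
  set c : ℝ → Plane := fun t => p + t • (q - p) with hc
  have hcd : ∀ t, HasDerivAt c (q - p) t := fun t => by
    have h := ((hasDerivAt_id t).smul_const (q - p)).const_add p
    rw [one_smul] at h
    exact h
  have hcc : ContDiff ℝ 1 c := contDiff_const.add (contDiff_id.smul contDiff_const)
  have hcV : ∀ t ∈ Icc (0 : ℝ) 1, c t ∈ V := fun t ht => hV.add_smul_sub_mem hp hq ht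
  refine (riemannianEDist_le_pathELength
    (contMDiffOn_symm_comp hcc.contDiffOn fun t ht => hVt (hcV t ht)) (by simp [hc])
    (by simp [hc]) zero_le_one).trans ?_
  rw [pathELength_symm_comp zero_lt_one hcc.contDiffOn fun t ht => hVt (hcV t ht)]
  calc ∫⁻ t in Icc (0 : ℝ) 1, ‖chartLin x₀ (c t) (derivWithin c (Icc 0 1) t)‖ₑ
      ≤ ∫⁻ t in Icc (0 : ℝ) 1, ENNReal.ofReal (k * ‖A (q - p)‖) := by
        refine setLIntegral_mono' measurableSet_Icc fun t ht => ?_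
        rw [(hcd t).hasDerivWithinAt.derivWithin (uniqueDiffOn_Icc zero_lt_one t ht), ← ofReal_norm]
        exact ENNReal.ofReal_le_ofReal (hk _ (hcV t ht) _)
    _ = _ := by simp

variable [T2Space M]

/-- Points that are close for the Riemannian distance are close in the chart. -/
theorem norm_sub_lt_of_riemannianEDist_lt {x₀ : M} {A : Plane ≃L[ℝ] Plane} {a : Plane} {ρ k : ℝ}
    (hρ : 0 < ρ) (hk : 0 < k)
    (hS : ∀ z, ‖A (z - a)‖ ≤ ρ → z ∈ (extChartAt (𝓡 2) x₀).target)
    (hlow : ∀ z, ‖A (z - a)‖ ≤ ρ → ∀ w, k * ‖A w‖ ≤ ‖chartLin x₀ z w‖) {q : M}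
    (hq : riemannianEDist (𝓡 2) ((extChartAt (𝓡 2) x₀).symm a) q < ENNReal.ofReal (k * ρ)) :
    q ∈ (extChartAt (𝓡 2) x₀).source ∧ ‖A (extChartAt (𝓡 2) x₀ q - a)‖ < ρ := by
  set φ := extChartAt (𝓡 2) x₀ with hφ
  set S : Set Plane := {z | ‖A (z - a)‖ ≤ ρ} with hSdef
  have hSt : S ⊆ φ.target := hS
  have hScomp : IsCompact S := by
    have h1 : S = (fun z => A.symm z + a) '' Metric.closedBall 0 ρ := by
      ext z
      constructor
      · intro hz
        exact ⟨A (z - a), mem_closedBall_zero_iff.2 hz, by simp⟩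
      · rintro ⟨w, hw, rfl⟩
        simpa [hSdef] using hw
    rw [h1]
    exact (isCompact_closedBall 0 ρ).image (A.symm.continuous.add continuous_const)
  set u := φ.symm '' S with hu
  -- Here the Hausdorff property enters: the compact image of the coordinate disk is closed, so a
  -- path cannot leave the chart domain without its coordinates first reaching the boundary of the
  -- disk.
  have hucl : IsClosed u :=
    (hScomp.image_of_continuousOn ((continuousOn_extChartAt_symm x₀).mono hSt)).isClosed
  have hus : u ⊆ φ.source := by
    rintro _ ⟨z, hz, rfl⟩
    exact φ.map_target (hSt hz)
  have huS : ∀ x ∈ u, ‖A (φ x - a)‖ ≤ ρ := by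
    rintro _ ⟨z, hz, rfl⟩
    rw [φ.right_inv (hSt hz)]; exact hz
  set v := φ.source ∩ φ ⁻¹' {z | ‖A (z - a)‖ < ρ} with hv
  have hvo : IsOpen v := (continuousOn_extChartAt x₀).isOpen_inter_preimage
    (isOpen_extChartAt_source x₀)
    (isOpen_lt (A.continuous.comp (continuous_id.sub continuous_const)).norm continuous_const)
  have hvu : v ⊆ u := fun x hx => by
    have h : ‖A (φ x - a)‖ < ρ := hx.2
    exact ⟨φ x, show ‖A (φ x - a)‖ ≤ ρ from h.le, φ.left_inv hx.1⟩
  obtain ⟨γ, hγ0, hγ1, hγs, hγ, -⟩ := exists_lt_locally_constant_of_riemannianEDist_lt hq zero_lt_one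
  have haS : a ∈ S := by simp [hSdef, hρ.le]
  -- A continuity argument: as long as the path has stayed in `u`, its coordinate displacement is at
  -- most length/k < ρ, so it lies in the open subset `v` and stays in `u` a little longer.
  have key : ∀ t ∈ Icc (0 : ℝ) 1, (∀ s ∈ Icc 0 t, γ s ∈ u) → γ t ∈ v := by
    intro t ht hsub
    refine ⟨hus (hsub t ⟨ht.1, le_rfl⟩), ?_⟩
    rcases ht.1.eq_or_lt with rfl | ht0
    · rw [hγ0, mem_preimage, φ.right_inv (hSt haS)]
      simpa using hρ
    set c := φ ∘ γ with hc
    have hcs : ContDiffOn ℝ 1 c (Icc 0 t) := by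
      rw [← contMDiffOn_iff_contDiffOn]
      refine contMDiffOn_extChartAt.comp (I' := 𝓡 2) (t := (chartAt Plane x₀).source)
        hγs.contMDiffOn fun s hs => ?_
      have := hus (hsub s hs)
      rwa [hφ, extChartAt_source] at this
    have hct : ∀ s ∈ Icc 0 t, c s ∈ φ.target := fun s hs => φ.map_source (hus (hsub s hs))
    have hlen : pathELength (𝓡 2) γ 0 t = pathELength (𝓡 2) (φ.symm ∘ c) 0 t :=
      pathELength_congr fun s hs => (φ.left_inv (hus (hsub s hs))).symm
    have hAc : ContDiffOn ℝ 1 (A ∘ c) (Icc 0 t) := A.contDiff.comp_contDiffOn hcs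
    have h1 : ‖(A ∘ c) t - (A ∘ c) 0‖ₑ ≤ ∫⁻ s in Icc 0 t, ‖derivWithin (A ∘ c) (Icc 0 t) s‖ₑ :=
      enorm_sub_le_lintegral_derivWithin_Icc_of_contDiffOn_Icc hAc ht0.le
    have h2 : ENNReal.ofReal k * ∫⁻ s in Icc 0 t, ‖derivWithin (A ∘ c) (Icc 0 t) s‖ₑ ≤
        pathELength (𝓡 2) γ 0 t := by
      rw [hlen, pathELength_symm_comp ht0 hcs hct, ← lintegral_const_mul' _ _ ENNReal.ofReal_ne_top]
      refine setLIntegral_mono' measurableSet_Icc fun s hs => ?_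
      have hd : HasDerivWithinAt c (derivWithin c (Icc 0 t) s) (Icc 0 t) s :=
        ((hcs.differentiableOn one_ne_zero) s hs).hasDerivWithinAt
      have hd' : derivWithin (A ∘ c) (Icc 0 t) s = A (derivWithin c (Icc 0 t) s) :=
        (A.hasFDerivAt.comp_hasDerivWithinAt s hd).derivWithin (uniqueDiffOn_Icc ht0 s hs)
      rw [hd', ← ofReal_norm, ← ofReal_norm, ← ENNReal.ofReal_mul hk.le]
      exact ENNReal.ofReal_le_ofReal (hlow _ (huS _ (hsub s hs)) _)
    have h3 : ENNReal.ofReal k * ‖(A ∘ c) t - (A ∘ c) 0‖ₑ < ENNReal.ofReal (k * ρ) :=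
      calc _ ≤ _ := by gcongr
        _ ≤ _ := h2
        _ ≤ pathELength (𝓡 2) γ 0 1 := pathELength_mono le_rfl ht.2
        _ < _ := hγ
    rw [← ofReal_norm, ← ENNReal.ofReal_mul hk.le, ENNReal.ofReal_lt_ofReal_iff (by positivity)] at h3
    have h4 := lt_of_mul_lt_mul_left h3 hk.le
    have h5 : (A ∘ c) t - (A ∘ c) 0 = A (φ (γ t) - a) := by
      simp only [hc, Function.comp, hγ0, φ.right_inv (hSt haS), map_sub]
    rwa [h5] at h4
  have hall : Icc (0 : ℝ) 1 ⊆ γ ⁻¹' u := by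
    have hcl : IsClosed (γ ⁻¹' u ∩ Icc 0 1) := (hucl.preimage hγs.continuous).inter isClosed_Icc
    refine hcl.Icc_subset_of_forall_mem_nhdsGT_of_Icc_subset ?_ ?_
    · rw [mem_preimage, hγ0]; exact ⟨a, haS, rfl⟩
    · rintro t ⟨ht0, ht1⟩ hsub
      have := key t ⟨ht0, ht1.le⟩ hsub
      exact hγs.continuous.continuousWithinAt <| mem_of_superset (hvo.mem_nhds this) hvu
  have := key 1 ⟨zero_le_one, le_rfl⟩ hall
  rw [hγ1] at this
  exact this

end

/-! ### Nearly isometric coordinates and first-order comparison of distances. -/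

section

variable {M : Type*} [TopologicalSpace M] [ChartedSpace Plane M] [IsManifold (𝓡 2) ∞ M]
  [RiemannianBundle (fun x : M => TangentSpace (𝓡 2) x)]
  [IsContMDiffRiemannianBundle (𝓡 2) ∞ Plane (fun x : M => TangentSpace (𝓡 2) x)]
  [T2Space M]

theorem abs_norm_chartLin_sq_sub_le (x₀ : M) (y z w : Plane) {c : ℝ}
    (h : ∀ i j, |metricMatrix x₀ z i j - metricMatrix x₀ y i j| ≤ c) :
    |‖chartLin x₀ z w‖ ^ 2 - ‖chartLin x₀ y w‖ ^ 2| ≤ 2 * c * ‖w‖ ^ 2 := by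
  rw [norm_chartLin_sq, norm_chartLin_sq, EuclideanSpace.norm_sq_eq, Fin.sum_univ_two,
    Real.norm_eq_abs, Real.norm_eq_abs, sq_abs, sq_abs]
  obtain ⟨a1, a2⟩ := abs_le.1 (h 0 0)
  obtain ⟨b1, b2⟩ := abs_le.1 (h 0 1)
  obtain ⟨d1, d2⟩ := abs_le.1 (h 1 1)
  set a := metricMatrix x₀ z 0 0 - metricMatrix x₀ y 0 0 with ha
  set b := metricMatrix x₀ z 0 1 - metricMatrix x₀ y 0 1 with hb
  set d := metricMatrix x₀ z 1 1 - metricMatrix x₀ y 1 1 with hd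
  have e : w 0 ^ 2 * metricMatrix x₀ z 0 0 + 2 * (w 0 * w 1) * metricMatrix x₀ z 0 1
      + w 1 ^ 2 * metricMatrix x₀ z 1 1 - (w 0 ^ 2 * metricMatrix x₀ y 0 0
      + 2 * (w 0 * w 1) * metricMatrix x₀ y 0 1 + w 1 ^ 2 * metricMatrix x₀ y 1 1) =
      w 0 ^ 2 * a + 2 * (w 0 * w 1) * b + w 1 ^ 2 * d := by rw [ha, hb, hd]; ring
  rw [e, abs_le]
  have s0 := sq_nonneg (w 0)
  have s1 := sq_nonneg (w 1)
  have p1 := mul_nonneg (sq_nonneg (w 0 + w 1)) (by linarith : 0 ≤ c - b)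
  have p2 := mul_nonneg (sq_nonneg (w 0 - w 1)) (by linarith : 0 ≤ c + b)
  have p3 := mul_nonneg (sq_nonneg (w 0 + w 1)) (by linarith : 0 ≤ c + b)
  have p4 := mul_nonneg (sq_nonneg (w 0 - w 1)) (by linarith : 0 ≤ c - b)
  constructor
  · nlinarith only [mul_nonneg s0 (by linarith : 0 ≤ c + a), mul_nonneg s1 (by linarith : 0 ≤ c + d),
      p3, p4]
  · nlinarith only [mul_nonneg s0 (by linarith : 0 ≤ c - a), mul_nonneg s1 (by linarith : 0 ≤ c - d),
      p1, p2]

theorem bounds_of_abs_sq_sub_le {N n c : ℝ} (hN : 0 ≤ N) (hn : 0 ≤ n) (hc0 : 0 ≤ c) (hc : c ≤ 1)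
    (h : |N ^ 2 - n ^ 2| ≤ c * n ^ 2) : (1 - c) * n ≤ N ∧ N ≤ (1 + c) * n := by
  obtain ⟨h1, h2⟩ := abs_le.1 h
  have hn2 := sq_nonneg n
  constructor
  · refine le_of_sq_le_sq ?_ hN
    nlinarith [mul_nonneg hn2 (mul_nonneg hc0 (sub_nonneg.2 hc))]
  · refine le_of_sq_le_sq ?_ (by positivity)
    nlinarith [mul_nonneg hn2 hc0, mul_nonneg hn2 (mul_nonneg hc0 hc0)]

/-- After a linear change of coordinates the metric is Euclidean up to a linear error. -/
theorem exists_near_isometry {x₀ : M} {a : Plane} (ha : a ∈ (extChartAt (𝓡 2) x₀).target) :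
    ∃ (A : Plane ≃L[ℝ] Plane) (C ρ : ℝ), 0 ≤ C ∧ 0 < ρ ∧ C * ρ ≤ 1 / 2 ∧
      (∀ w, ‖A w‖ = ‖chartLin x₀ a w‖) ∧ LinearMap.det (A : Plane →ₗ[ℝ] Plane) = dens x₀ a ∧
      ∀ z, ‖A (z - a)‖ ≤ ρ → z ∈ (extChartAt (𝓡 2) x₀).target ∧
        ∀ w, (1 - C * ‖A (z - a)‖) * ‖A w‖ ≤ ‖chartLin x₀ z w‖ ∧
          ‖chartLin x₀ z w‖ ≤ (1 + C * ‖A (z - a)‖) * ‖A w‖ := by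
  obtain ⟨A, hA, hdet⟩ := exists_linear_isometry ha
  have hnhds := (isOpen_target x₀).mem_nhds ha
  have hO : ∀ i j, ∃ c : ℝ, 0 ≤ c ∧
      ∀ᶠ z in 𝓝 a, |metricMatrix x₀ z i j - metricMatrix x₀ a i j| ≤ c * ‖z - a‖ := by
    intro i j
    have hd : DifferentiableAt ℝ (fun y => metricMatrix x₀ y i j) a :=
      ((contDiffOn_metricMatrix x₀ i j).contDiffAt hnhds).differentiableAt (by simp)
    obtain ⟨c, hc, h⟩ := hd.isBigO_sub.exists_nonneg
    exact ⟨c, hc, h.bound⟩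
  choose c hc0 hc using hO
  set K := c 0 0 + c 0 1 + c 1 0 + c 1 1 with hK
  have hK0 : 0 ≤ K := by have := hc0 0 0; have := hc0 0 1; have := hc0 1 0; have := hc0 1 1; linarith
  have hcK : ∀ i j, c i j ≤ K := by
    have := hc0 0 0; have := hc0 0 1; have := hc0 1 0; have := hc0 1 1
    intro i j
    fin_cases i <;> fin_cases j <;> simp <;> linarith
  have hev : ∀ᶠ z in 𝓝 a, z ∈ (extChartAt (𝓡 2) x₀).target ∧
      ∀ i j, |metricMatrix x₀ z i j - metricMatrix x₀ a i j| ≤ K * ‖z - a‖ := by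
    filter_upwards [hnhds, hc 0 0, hc 0 1, hc 1 0, hc 1 1] with z h0 h1 h2 h3 h4
    refine ⟨h0, fun i j => ?_⟩
    have : |metricMatrix x₀ z i j - metricMatrix x₀ a i j| ≤ c i j * ‖z - a‖ := by
      fin_cases i <;> fin_cases j <;> assumption
    exact this.trans (mul_le_mul_of_nonneg_right (hcK i j) (norm_nonneg _))
  obtain ⟨r, hr, hball⟩ := Metric.eventually_nhds_iff_ball.1 hev
  set κ := ‖(A.symm : Plane →L[ℝ] Plane)‖ + 1 with hκ
  have hκ0 : 0 < κ := by positivity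
  have hinv : ∀ w, ‖w‖ ≤ κ * ‖A w‖ := by
    intro w
    have := (A.symm : Plane →L[ℝ] Plane).le_opNorm (A w)
    simp only [ContinuousLinearEquiv.coe_coe, ContinuousLinearEquiv.symm_apply_apply] at this
    nlinarith [norm_nonneg (A w)]
  -- The metric matrix moves by at most K‖z − a‖, with ‖z − a‖ ≤ κ‖A(z − a)‖ and ‖w‖ ≤ κ‖A w‖; the
  -- quadratic form then moves by at most 2Kκ³ ‖A(z − a)‖ ‖A w‖².
  set C := 2 * K * κ ^ 3 with hC
  have hC0 : 0 ≤ C := by positivity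
  refine ⟨A, C, min (r / (2 * κ)) (1 / (2 * (C + 1))), hC0, by positivity, ?_, hA, hdet, ?_⟩
  · calc C * min (r / (2 * κ)) (1 / (2 * (C + 1))) ≤ C * (1 / (2 * (C + 1))) := by
          gcongr; exact min_le_right _ _
      _ ≤ 1 / 2 := by
        rw [mul_one_div, div_le_div_iff₀ (by positivity) (by norm_num)]; linarith
  · intro z hz
    set t := ‖A (z - a)‖
    have ht0 : 0 ≤ t := norm_nonneg _
    have ht1 : t * κ ≤ r / 2 := by
      have := hz.trans (min_le_left _ _)
      rw [le_div_iff₀ (by positivity)] at this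
      linarith
    have ht2 : C * t ≤ 1 := by
      have := hz.trans (min_le_right _ _)
      rw [le_div_iff₀ (by positivity)] at this
      nlinarith
    have hzr : z ∈ Metric.ball a r := by
      rw [mem_ball_iff_norm]
      have := hinv (z - a)
      linarith
    obtain ⟨hzt, hG⟩ := hball z hzr
    refine ⟨hzt, fun w => ?_⟩
    refine bounds_of_abs_sq_sub_le (norm_nonneg _) (norm_nonneg _) (by positivity) ht2 ?_
    have h1 := abs_norm_chartLin_sq_sub_le x₀ a z w hG
    rw [← hA] at h1
    refine h1.trans ?_
    calc 2 * (K * ‖z - a‖) * ‖w‖ ^ 2 ≤ 2 * (K * (κ * t)) * (κ * ‖A w‖) ^ 2 := by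
          gcongr
          · exact hinv _
          · exact hinv _
      _ = _ := by rw [hC]; ring

theorem convex_setOf_norm_le (A : Plane ≃L[ℝ] Plane) (a : Plane) (s : ℝ) :
    Convex ℝ {z | ‖A (z - a)‖ ≤ s} := by
  have h : {z : Plane | ‖A (z - a)‖ ≤ s} =
      (A : Plane →L[ℝ] Plane) ⁻¹' Metric.closedBall (A a) s := by
    ext z
    simp [dist_eq_norm]
  rw [h]
  exact (convex_closedBall _ _).linear_preimage (A : Plane →ₗ[ℝ] Plane)

/-- The comparison of the Riemannian distance with the Euclidean one near a point. -/
theorem riemannianEDist_near {x₀ : M} {a : Plane} {A : Plane ≃L[ℝ] Plane} {C ρ : ℝ} (hC : 0 ≤ C)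
    (hCρ : C * ρ ≤ 1 / 2)
    (hnear : ∀ z, ‖A (z - a)‖ ≤ ρ → z ∈ (extChartAt (𝓡 2) x₀).target ∧
        ∀ w, (1 - C * ‖A (z - a)‖) * ‖A w‖ ≤ ‖chartLin x₀ z w‖ ∧
          ‖chartLin x₀ z w‖ ≤ (1 + C * ‖A (z - a)‖) * ‖A w‖) {z : Plane}
    (hz : ‖A (z - a)‖ ≤ ρ) :
    ENNReal.ofReal ((1 - C * ‖A (z - a)‖) * ‖A (z - a)‖) ≤
      riemannianEDist (𝓡 2) ((extChartAt (𝓡 2) x₀).symm a) ((extChartAt (𝓡 2) x₀).symm z) ∧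
    riemannianEDist (𝓡 2) ((extChartAt (𝓡 2) x₀).symm a) ((extChartAt (𝓡 2) x₀).symm z) ≤
      ENNReal.ofReal ((1 + C * ‖A (z - a)‖) * ‖A (z - a)‖) := by
  set s := ‖A (z - a)‖ with hs
  have hs0 : 0 ≤ s := norm_nonneg _
  have hCs : C * s ≤ 1 / 2 := (mul_le_mul_of_nonneg_left hz hC).trans hCρ
  constructor
  · by_contra hlt
    rw [not_le] at hlt
    rcases hs0.eq_or_lt with h0 | h0
    · rw [← h0] at hlt; simp at hlt
    -- The disk is chosen with radius exactly s = ‖A(z − a)‖: a distance below (1 − Cs)s would force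
    -- ‖A(z − a)‖ < s.
    have := (norm_sub_lt_of_riemannianEDist_lt (A := A) (k := 1 - C * s) h0 (by linarith)
      (fun y hy => (hnear y (hy.trans hz)).1) (fun y hy w => ?_) hlt).2
    · rw [(extChartAt (𝓡 2) x₀).right_inv (hnear z hz).1] at this
      exact lt_irrefl _ this
    · refine le_trans ?_ ((hnear y (hy.trans hz)).2 w).1
      gcongr
  · refine riemannianEDist_symm_le (convex_setOf_norm_le A a s)
      (fun y hy => (hnear y (le_trans (show ‖A (y - a)‖ ≤ s from hy) hz)).1)
      (k := 1 + C * s) (fun y hy w => ?_) ?_ ?_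
    · have hy' : ‖A (y - a)‖ ≤ s := hy
      refine ((hnear y (hy'.trans hz)).2 w).2.trans ?_
      gcongr
    · change ‖A (a - a)‖ ≤ s
      simpa using hs0
    · exact (le_refl s : ‖A (z - a)‖ ≤ s)

/-- On the disk Cρ ≤ 1/2 keeps the metric above half of the Euclidean one, so coordinates are
controlled by twice the distance. -/
theorem mem_source_of_riemannianEDist_lt {x₀ : M} {a : Plane} {A : Plane ≃L[ℝ] Plane} {C ρ : ℝ}
    (hC : 0 ≤ C) (hCρ : C * ρ ≤ 1 / 2)
    (hnear : ∀ z, ‖A (z - a)‖ ≤ ρ → z ∈ (extChartAt (𝓡 2) x₀).target ∧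
        ∀ w, (1 - C * ‖A (z - a)‖) * ‖A w‖ ≤ ‖chartLin x₀ z w‖ ∧
          ‖chartLin x₀ z w‖ ≤ (1 + C * ‖A (z - a)‖) * ‖A w‖) {q : M} {s : ℝ} (hs : s ≤ ρ)
    (hs0 : 0 < s)
    (hq : riemannianEDist (𝓡 2) ((extChartAt (𝓡 2) x₀).symm a) q < ENNReal.ofReal (s / 2)) :
    q ∈ (extChartAt (𝓡 2) x₀).source ∧ ‖A (extChartAt (𝓡 2) x₀ q - a)‖ < s := by
  refine norm_sub_lt_of_riemannianEDist_lt (k := 1 / 2) hs0 (by norm_num)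
    (fun y hy => (hnear y (hy.trans hs)).1) (fun y hy w => ?_) (by rwa [div_eq_inv_mul, ← one_div] at hq)
  refine le_trans ?_ ((hnear y (hy.trans hs)).2 w).1
  gcongr
  have := (mul_le_mul_of_nonneg_left (hy.trans hs) hC).trans hCρ
  linarith

/-- A point at a small given distance of `p` on an almost minimizing path from `p` to `p₀`. -/
theorem exists_point_toward [CompactSpace M] {p p₀ : M} {s η : ℝ} (hη : 0 < η)
    (hfin : riemannianEDist (𝓡 2) p p₀ ≠ ⊤)
    (hsd : ENNReal.ofReal s ≤ riemannianEDist (𝓡 2) p p₀) :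
    ∃ q : M, riemannianEDist (𝓡 2) p q = ENNReal.ofReal s ∧
      riemannianEDist (𝓡 2) p q + riemannianEDist (𝓡 2) q p₀ ≤
        riemannianEDist (𝓡 2) p p₀ + ENNReal.ofReal η := by
  have : riemannianEDist (𝓡 2) p p₀ < riemannianEDist (𝓡 2) p p₀ + ENNReal.ofReal η :=
    ENNReal.lt_add_right hfin (by simpa using hη)
  obtain ⟨γ, hγ0, hγ1, hγs, hγ, -⟩ := exists_lt_locally_constant_of_riemannianEDist_lt this
    zero_lt_one
  haveI : IsContinuousRiemannianBundle Plane (fun x : M => TangentSpace (𝓡 2) x) :=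
    isContinuousRiemannianBundle
  haveI : IsManifold (𝓡 2) 1 M := IsManifold.of_le (n := ∞) (by simp)
  -- This metric structure induces the given topology, so the distance to `p` is continuous along
  -- the path and takes the value `s` by the intermediate value theorem.
  letI : PseudoEMetricSpace M := PseudoEMetricSpace.ofRiemannianMetric (𝓡 2) M
  have hcont : Continuous fun t => riemannianEDist (𝓡 2) p (γ t) := by
    change Continuous fun t => edist p (γ t)
    exact continuous_const.edist hγs.continuous
  have hiv := intermediate_value_Icc (zero_le_one' ℝ) hcont.continuousOn
  simp only [hγ0, hγ1, riemannianEDist_self] at hiv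
  obtain ⟨t, ht, hts⟩ := hiv ⟨zero_le, hsd⟩
  refine ⟨γ t, hts, ?_⟩
  calc _ ≤ pathELength (𝓡 2) γ 0 t + pathELength (𝓡 2) γ t 1 := by
        refine add_le_add ?_ ?_
        · exact riemannianEDist_le_pathELength hγs.contMDiffOn hγ0 rfl ht.1
        · exact riemannianEDist_le_pathELength hγs.contMDiffOn rfl hγ1 ht.2
    _ = pathELength (𝓡 2) γ 0 1 := pathELength_add ht.1 ht.2
    _ ≤ _ := hγ.le

end

/-! ### The eikonal equation. -/

section

variable {M : Type*} [TopologicalSpace M] [ChartedSpace Plane M] [IsManifold (𝓡 2) ∞ M]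
  [RiemannianBundle (fun x : M => TangentSpace (𝓡 2) x)]
  [IsContMDiffRiemannianBundle (𝓡 2) ∞ Plane (fun x : M => TangentSpace (𝓡 2) x)]
  [T2Space M]

/-- The distance to `p₀`. -/
def distTo (p₀ q : M) : ℝ := (riemannianEDist (𝓡 2) q p₀).toReal

theorem distTo_nonneg (p₀ q : M) : 0 ≤ distTo p₀ q := ENNReal.toReal_nonneg

theorem riemannianEDist_ne_top_of_le {p q p₀ : M} {c : ℝ}
    (hp : riemannianEDist (𝓡 2) p p₀ ≠ ⊤) (h : riemannianEDist (𝓡 2) p q ≤ ENNReal.ofReal c) :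
    riemannianEDist (𝓡 2) q p₀ ≠ ⊤ := by
  have h1 := riemannianEDist_triangle (I := 𝓡 2) (x := q) (y := p) (z := p₀)
  rw [riemannianEDist_comm (x := q) (y := p)] at h1
  exact ((h1.trans (add_le_add_left h _)).trans_lt
    (ENNReal.add_lt_top.2 ⟨ENNReal.ofReal_lt_top, hp.lt_top⟩)).ne

theorem abs_distTo_sub_le {p q p₀ : M} {c : ℝ} (hc : 0 ≤ c)
    (hp : riemannianEDist (𝓡 2) p p₀ ≠ ⊤) (h : riemannianEDist (𝓡 2) p q ≤ ENNReal.ofReal c) :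
    |distTo p₀ q - distTo p₀ p| ≤ c := by
  have hq := riemannianEDist_ne_top_of_le hp h
  have h1 := riemannianEDist_triangle (I := 𝓡 2) (x := q) (y := p) (z := p₀)
  have h2 := riemannianEDist_triangle (I := 𝓡 2) (x := p) (y := q) (z := p₀)
  rw [riemannianEDist_comm (x := q) (y := p)] at h1
  have h1' := ENNReal.toReal_mono (ENNReal.add_ne_top.2 ⟨ENNReal.ofReal_ne_top, hp⟩)
    (h1.trans (add_le_add_left h _))
  have h2' := ENNReal.toReal_mono (ENNReal.add_ne_top.2 ⟨ENNReal.ofReal_ne_top, hq⟩)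
    (h2.trans (add_le_add_left h _))
  rw [ENNReal.toReal_add ENNReal.ofReal_ne_top hp, ENNReal.toReal_ofReal hc] at h1'
  rw [ENNReal.toReal_add ENNReal.ofReal_ne_top hq, ENNReal.toReal_ofReal hc] at h2'
  rw [abs_le]
  unfold distTo
  constructor <;> linarith

/-- The eikonal equation: the distance function has a gradient of length one wherever it is
differentiable. -/
theorem norm_grad_distTo [CompactSpace M] {p p₀ : M} (hfin : riemannianEDist (𝓡 2) p p₀ ≠ ⊤)
    (hpos : 0 < distTo p₀ p) (hd : MDifferentiableAt (𝓡 2) 𝓘(ℝ, ℝ) (distTo p₀) p) :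
    ‖grad (distTo p₀) p‖ = 1 := by
  obtain ⟨x₀, z, hz, rfl⟩ := exists_chart_point p
  set φ := extChartAt (𝓡 2) x₀ with hφ
  obtain ⟨A, C, ρ, hC, hρ, hCρ, hA, -, hnear⟩ := exists_near_isometry hz
  have hF := ((mdifferentiableAt_iff_chart hz).1 hd).hasFDerivAt
  set D := fderiv ℝ (distTo p₀ ∘ φ.symm) z with hD
  set G : Plane → ℝ := fun u => distTo p₀ (φ.symm (z + A.symm u)) with hG
  set H : Plane →L[ℝ] ℝ := D ∘L (A.symm : Plane →L[ℝ] Plane) with hH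
  have hGd : HasFDerivAt G H 0 := by
    have h1 : HasFDerivAt (fun u => z + A.symm u) (A.symm : Plane →L[ℝ] Plane) 0 :=
      A.symm.hasFDerivAt.const_add z
    have h2 : HasFDerivAt (distTo p₀ ∘ φ.symm) D (z + A.symm 0) := by
      rw [map_zero, add_zero]; exact hF
    exact h2.comp 0 h1
  have hG0 : G 0 = distTo p₀ (φ.symm z) := by simp [hG]
  have hball : ∀ u : Plane, ‖u‖ ≤ ρ → ‖A (z + A.symm u - z)‖ ≤ ρ := fun u hu => by simpa using hu
  have hAu : ∀ u, ‖A (z + A.symm u - z)‖ = ‖u‖ := fun u => by simp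
  have hup : ∀ u : Plane, ‖u‖ ≤ ρ → |G u - G 0| ≤ (1 + C * ‖u‖) * ‖u‖ := by
    intro u hu
    have := (riemannianEDist_near hC hCρ hnear (hball u hu)).2
    rw [hAu] at this
    rw [hG0]
    exact abs_distTo_sub_le (by positivity) hfin this
  -- The distance is 1-Lipschitz and the coordinates are isometric to first order, so difference
  -- quotients at the centre are at most 1 + C‖u‖.
  have hle : ‖H‖ ≤ 1 := by
    refine le_of_forall_pos_le_add fun κ hκ => ?_
    refine hGd.le_of_lip' (by positivity) ?_
    have hκ' : 0 < min ρ (κ / (C + 1)) := by positivity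
    filter_upwards [Metric.ball_mem_nhds (0 : Plane) hκ'] with u hu
    rw [mem_ball_zero_iff] at hu
    rw [sub_zero, Real.norm_eq_abs]
    refine (hup u (hu.le.trans (min_le_left _ _))).trans ?_
    gcongr
    have h3 := hu.le.trans (min_le_right _ _)
    rw [le_div_iff₀ (by positivity)] at h3
    nlinarith only [norm_nonneg u, h3]
  -- An almost minimizing path contains a point `q` at distance `s` from the base point where the
  -- distance to `p₀` has dropped by at least s − s². A derivative of norm below one does not allow
  -- such a drop; no minimizing geodesic is needed.
  have hge : 1 ≤ ‖H‖ := by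
    by_contra hlt
    rw [not_le] at hlt
    set κ := (1 - ‖H‖) / 2 with hκ
    have hκ0 : 0 < κ := by rw [hκ]; linarith
    have h1 := hGd.isLittleO.def hκ0
    obtain ⟨r, hr, h2⟩ := Metric.eventually_nhds_iff_ball.1 h1
    -- The bounds keep `q` in the nearly isometric disk and within the range of the first-order
    -- expansion, do not overshoot `p₀`, and make the total error (2C + 1)s at most κ/2.
    set s := min (min (ρ / 4) (r / 4)) (min (distTo p₀ (φ.symm z)) (κ / (2 * (2 * C + 1)))) with hs
    have hs0 : 0 < s := by positivity
    have hs1 : s ≤ ρ / 4 := (min_le_left _ _).trans (min_le_left _ _)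
    have hs2 : s ≤ r / 4 := (min_le_left _ _).trans (min_le_right _ _)
    have hs3 : s ≤ distTo p₀ (φ.symm z) := (min_le_right _ _).trans (min_le_left _ _)
    have hs4 : s ≤ κ / (2 * (2 * C + 1)) := (min_le_right _ _).trans (min_le_right _ _)
    rw [le_div_iff₀ (by positivity)] at hs4
    obtain ⟨q, hq1, hq2⟩ := exists_point_toward (s := s) (pow_pos hs0 2) hfin
      (by rw [ENNReal.ofReal_le_iff_le_toReal hfin]; exact hs3)
    obtain ⟨hqs, hqσ⟩ := mem_source_of_riemannianEDist_lt hC hCρ hnear (s := 4 * s)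
      (by linarith) (by positivity)
      (by rw [hq1]; exact (ENNReal.ofReal_lt_ofReal_iff (by positivity)).2 (by linarith))
    set u := A (φ q - z) with hu
    have hGu : G u = distTo p₀ q := by
      simp only [hG, hu, A.symm_apply_apply, add_sub_cancel]
      rw [φ.left_inv hqs]
    have hσρ : ‖u‖ ≤ ρ := by linarith
    obtain ⟨hd1, hd2⟩ := riemannianEDist_near hC hCρ hnear hσρ
    rw [φ.left_inv hqs, hq1, ENNReal.ofReal_le_ofReal_iff hs0.le, ← hu] at hd1
    have hdec : distTo p₀ q ≤ distTo p₀ (φ.symm z) - s + s ^ 2 := by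
      have hqf := riemannianEDist_ne_top_of_le hfin hq1.le
      have := ENNReal.toReal_mono (ENNReal.add_ne_top.2 ⟨hfin, ENNReal.ofReal_ne_top⟩) hq2
      rw [hq1, ENNReal.toReal_add hfin ENNReal.ofReal_ne_top,
        ENNReal.toReal_add ENNReal.ofReal_ne_top hqf, ENNReal.toReal_ofReal hs0.le,
        ENNReal.toReal_ofReal (by positivity)] at this
      unfold distTo
      linarith
    have h3 := h2 u (by rw [mem_ball_zero_iff]; linarith)
    rw [sub_zero, Real.norm_eq_abs, hGu, hG0] at h3
    have h4 := (abs_le.1 h3).1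
    have h5 := (abs_le.1 ((Real.norm_eq_abs _).symm.trans_le (H.le_opNorm u))).1
    set σ := ‖u‖ with hσ
    have hσ0 : 0 ≤ σ := norm_nonneg _
    have hCσ : C * σ ≤ 1 / 2 := (mul_le_mul_of_nonneg_left hσρ hC).trans hCρ
    have hσs : σ ≤ 2 * s := by nlinarith only [hd1, hCσ, hσ0]
    have hCs : 0 ≤ C * s := mul_nonneg hC hs0.le
    have hs5 : s ≤ 1 / 4 := by linarith [norm_nonneg H]
    have hs6 : s ^ 2 ≤ s / 4 := by rw [pow_two]; nlinarith only [hs5, hs0]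
    have hσpos : 0 < σ := by
      rcases hσ0.eq_or_lt with h0 | h0
      · rw [← h0] at hd1 h5 h4
        linarith
      · exact h0
    have h6 : s - s ^ 2 ≤ (‖H‖ + κ) * σ := by linarith
    have h7 : (1 - C * σ) * (1 - s) * σ ≤ (‖H‖ + κ) * σ := by
      have hs1' : 0 ≤ 1 - s := by linarith
      have := mul_le_mul_of_nonneg_right hd1 hs1'
      linarith
    have h8 := le_of_mul_le_mul_right h7 hσpos
    have h9 := mul_nonneg (mul_nonneg hC hσ0) hs0.le
    have h10 := mul_le_mul_of_nonneg_left hσs hC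
    linarith
  -- `A` carries the norm of the tangent space to the Euclidean one, so the operator norm of `H` is
  -- the length of the gradient.
  refine le_antisymm ?_ ?_
  · refine le_trans ?_ hle
    obtain ⟨w, hw⟩ := (chartLin_bijective hz).2 (grad (distTo p₀) (φ.symm z))
    have h1 := inner_grad_chartLin hz hd w
    rw [hw, real_inner_self_eq_norm_sq] at h1
    have h2 : D w = H (A w) := by simp [hH]
    have h3 := (le_abs_self _).trans ((Real.norm_eq_abs _).symm.trans_le (H.le_opNorm (A w)))
    rw [hA, hw, ← h2, ← h1] at h3
    rcases (norm_nonneg (grad (distTo p₀) (φ.symm z))).eq_or_lt with h0 | h0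
    · rw [← h0]; exact norm_nonneg _
    · nlinarith only [h3, h0]
  · refine hge.trans ?_
    refine ContinuousLinearMap.opNorm_le_bound _ (norm_nonneg _) fun u => ?_
    have h1 := inner_grad_chartLin hz hd (A.symm u)
    have h2 : H u = D (A.symm u) := rfl
    rw [h2, hD, ← h1, Real.norm_eq_abs]
    refine (abs_real_inner_le_norm _ _).trans ?_
    rw [← hA, A.apply_symm_apply]

end

/-! ### Mollification, and weak gradients of Lipschitz functions in a chart. -/

section

variable {M : Type*} [TopologicalSpace M] [ChartedSpace Plane M] [IsManifold (𝓡 2) ∞ M]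
  [RiemannianBundle (fun x : M => TangentSpace (𝓡 2) x)]
  [IsContMDiffRiemannianBundle (𝓡 2) ∞ Plane (fun x : M => TangentSpace (𝓡 2) x)]
  [T2Space M]

open scoped Convolution NNReal in
/-- The derivative of a mollification of a Lipschitz function is the mollification of its
derivative. -/
theorem hasFDerivAt_normed_convolution {K : ℝ≥0} {g : Plane → ℝ} (hg : LipschitzWith K g)
    (χ : ContDiffBump (0 : Plane)) (y : Plane) :
    HasFDerivAt (χ.normed volume ⋆[ContinuousLinearMap.lsmul ℝ ℝ, volume] g)
      ((χ.normed volume ⋆[ContinuousLinearMap.lsmul ℝ ℝ, volume] fderiv ℝ g) y) y := by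
  set k := χ.normed (volume : Measure Plane) with hk
  have hkc : Continuous k := χ.continuous_normed
  have hks : HasCompactSupport k := χ.hasCompactSupport_normed
  have hint : ∀ y, Continuous fun t => k t * g (y - t) := fun y =>
    hkc.mul (hg.continuous.comp (continuous_const.sub continuous_id))
  -- Rademacher's theorem; the reflection t ↦ y − t preserves null sets.
  have hae : ∀ᵐ t : Plane, DifferentiableAt ℝ g (y - t) :=
    (quasiMeasurePreserving_sub_left volume y).ae hg.ae_differentiableAt
  have := (hasFDerivAt_integral_of_dominated_loc_of_lip (μ := (volume : Measure Plane)) (x₀ := y)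
    (s := univ) (F := fun y t => k t * g (y - t)) (F' := fun t => k t • fderiv ℝ g (y - t))
    (bound := fun t => K * k t) univ_mem
    (Eventually.of_forall fun y => (hint y).aestronglyMeasurable)
    ((hint y).integrable_of_hasCompactSupport (hks.mul_right))
    (hkc.measurable.aestronglyMeasurable.smul
      ((measurable_fderiv ℝ g).comp (measurable_const.sub measurable_id)).aestronglyMeasurable)
    (Eventually.of_forall fun t => ?_) ((hkc.integrable_of_hasCompactSupport hks).const_mul _)
    ?_).2
  · exact this
  · refine LipschitzWith.lipschitzOnWith (LipschitzWith.of_dist_le_mul fun z z' => ?_)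
    have hkt : 0 ≤ k t := χ.nonneg_normed t
    rw [Real.dist_eq, ← mul_sub, abs_mul, abs_of_nonneg hkt, Real.coe_nnabs,
      abs_of_nonneg (mul_nonneg K.coe_nonneg hkt)]
    have := hg.dist_le_mul (z - t) (z' - t)
    rw [Real.dist_eq, dist_sub_right] at this
    calc _ ≤ k t * (K * dist z z') := mul_le_mul_of_nonneg_left this hkt
      _ = _ := by ring
  · filter_upwards [hae] with t ht
    have h1 : HasFDerivAt (fun z => g (z - t)) (fderiv ℝ g (y - t)) y := by
      have := ht.hasFDerivAt.comp y ((hasFDerivAt_id y).sub_const t)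
      exact this
    exact h1.const_mul (k t)

open scoped Convolution NNReal in
/-- Mollification of Lipschitz functions. -/
theorem exists_smooth_approx {K : ℝ≥0} {g : Plane → ℝ} (hg : LipschitzWith K g) {δ : ℝ}
    (hδ : 0 < δ) :
    ∃ G : ℕ → Plane → ℝ, (∀ n, ContDiff ℝ ∞ (G n)) ∧
      (∀ n y, |G n y - g y| ≤ K * (δ / (n + 1))) ∧
      (∀ n y, (∀ z ∈ Metric.ball y δ, g z = 0) → G n y = 0) ∧
      (∀ n y, ‖fderiv ℝ (G n) y‖ ≤ K) ∧
      ∀ᵐ y, Tendsto (fun n => fderiv ℝ (G n) y) atTop (𝓝 (fderiv ℝ g y)) := by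
  set χ : ℕ → ContDiffBump (0 : Plane) := fun n =>
    ⟨δ / (n + 1) / 2, δ / (n + 1), by positivity, half_lt_self (by positivity)⟩ with hχ
  have hr : ∀ n, (χ n).rOut = δ / (n + 1) := fun n => rfl
  have hrδ : ∀ n, (χ n).rOut ≤ δ := fun n => by
    rw [hr, div_le_iff₀ (by positivity)]
    nlinarith [(Nat.cast_nonneg n : (0 : ℝ) ≤ n)]
  have hm := hg.continuous.aestronglyMeasurable (μ := (volume : Measure Plane))
  refine ⟨fun n => (χ n).normed volume ⋆[ContinuousLinearMap.lsmul ℝ ℝ, volume] g,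
    fun n => ?_, fun n y => ?_, fun n y h => ?_, fun n y => ?_, ?_⟩
  · exact (χ n).hasCompactSupport_normed.contDiff_convolution_left _ (χ n).contDiff_normed
      hg.continuous.locallyIntegrable
  · rw [← Real.dist_eq]
    refine (χ n).dist_normed_convolution_le hm fun z hz => (hg.dist_le_mul z y).trans ?_
    gcongr
    exact hz.le
  · have h0 : g y = 0 := h y (Metric.mem_ball_self hδ)
    have := (χ n).dist_normed_convolution_le (x₀ := y) (ε := 0) hm fun z hz => by
      rw [h z (Metric.ball_subset_ball (hrδ n) hz), h0, dist_self]
    rw [h0] at this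
    exact dist_le_zero.1 this
  · rw [(hasFDerivAt_normed_convolution hg (χ n) y).fderiv]
    calc _ ≤ ∫ t, (χ n).normed volume t * K := by
          refine norm_integral_le_of_norm_le
            (((χ n).integrable_normed).mul_const _) (Eventually.of_forall fun t => ?_)
          rw [ContinuousLinearMap.lsmul_apply, norm_smul, Real.norm_of_nonneg ((χ n).nonneg_normed t)]
          exact mul_le_mul_of_nonneg_left (norm_fderiv_le_of_lipschitz ℝ hg) ((χ n).nonneg_normed t)
      _ = K := by rw [integral_mul_const, (χ n).integral_normed, one_mul]
  · have hloc : LocallyIntegrable (fderiv ℝ g) (volume : Measure Plane) := by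
      refine (locallyIntegrable_const (K : ℝ)).mono (measurable_fderiv ℝ g).aestronglyMeasurable
        (Eventually.of_forall fun y => ?_)
      exact (norm_fderiv_le_of_lipschitz ℝ hg).trans (le_abs_self _)
    have ht : Tendsto (fun n => (χ n).rOut) atTop (𝓝 0) := by
      simp only [hr]
      exact tendsto_const_nhds.div_atTop
        (tendsto_atTop_add_const_right _ _ tendsto_natCast_atTop_atTop)
    -- Lebesgue differentiation: the gradient is locally integrable, and its mollifications converge
    -- to it almost everywhere.
    filter_upwards [ContDiffBump.ae_convolution_tendsto_right_of_locallyIntegrable ht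
      (K := 2) (Eventually.of_forall fun n => by
        change δ / (n + 1) ≤ 2 * (δ / (n + 1) / 2)
        linarith) hloc] with y hy
    refine hy.congr fun n => ?_
    exact (hasFDerivAt_normed_convolution hg (χ n) y).fderiv.symm

/-- A uniform bound gives uniform integrability on a finite measure space, so Vitali's theorem
applies. -/
theorem tendsto_eLpNorm_two_of_bounded {α : Type*} [MeasurableSpace α] {μ : Measure α}
    [IsFiniteMeasure μ] {f : ℕ → α → ℝ} {c : ℝ} (hm : ∀ n, AEStronglyMeasurable (f n) μ)
    (hb : ∀ n x, |f n x| ≤ c) (h : ∀ᵐ x ∂μ, Tendsto (fun n => f n x) atTop (𝓝 0)) :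
    Tendsto (fun n => eLpNorm (f n) 2 μ) atTop (𝓝 0) := by
  have hu : UnifIntegrable f 2 μ := by
    refine unifIntegrable_of (by norm_num) (by norm_num) hm fun ε _ => ⟨Real.nnabs c + 1, fun n => ?_⟩
    have : {x | Real.nnabs c + 1 ≤ ‖f n x‖₊} = ∅ := by
      refine eq_empty_iff_forall_notMem.2 fun x hx => ?_
      have h1 : Real.nnabs c + 1 ≤ ‖f n x‖₊ := hx
      rw [← NNReal.coe_le_coe] at h1
      push_cast at h1
      have h2 := hb n x
      rw [Real.norm_eq_abs] at h1
      linarith [le_abs_self c]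
    rw [this]
    simp
  have := tendsto_Lp_finite_of_tendsto_ae (p := 2) (by norm_num) (by norm_num) hm
    (g := 0) (MemLp.zero) hu h
  simpa using this

/-- A function of the coordinates of the chart around `x₀`, extended by zero. -/
def chartExt (x₀ : M) (g : Plane → ℝ) : M → ℝ :=
  (extChartAt (𝓡 2) x₀).source.indicator (g ∘ extChartAt (𝓡 2) x₀)

theorem chartExt_of_mem {x₀ x : M} (hx : x ∈ (extChartAt (𝓡 2) x₀).source) (g : Plane → ℝ) :
    chartExt x₀ g x = g (extChartAt (𝓡 2) x₀ x) := indicator_of_mem hx _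

theorem chartExt_symm {x₀ : M} {y : Plane} (hy : y ∈ (extChartAt (𝓡 2) x₀).target)
    (g : Plane → ℝ) : chartExt x₀ g ((extChartAt (𝓡 2) x₀).symm y) = g y := by
  rw [chartExt_of_mem ((extChartAt (𝓡 2) x₀).map_target hy), (extChartAt (𝓡 2) x₀).right_inv hy]

theorem chartExt_comp_symm_eventuallyEq {x₀ : M} {y : Plane}
    (hy : y ∈ (extChartAt (𝓡 2) x₀).target) (g : Plane → ℝ) :
    chartExt x₀ g ∘ (extChartAt (𝓡 2) x₀).symm =ᶠ[𝓝 y] g := by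
  filter_upwards [(isOpen_target x₀).mem_nhds hy] with z hz
  exact chartExt_symm hz g

/-- The function is carried by a closed coordinate ball whose image is compact, hence closed in the
Hausdorff space `M`; extension by zero is therefore locally zero outside the chart ball, and creates
no singularity at the edge of the chart. -/
theorem chartExt_eventuallyEq_zero {x₀ : M} {y₀ : Plane} {r' r : ℝ} (hr : r' < r)
    (hB : Metric.ball y₀ r ⊆ (extChartAt (𝓡 2) x₀).target) {g : Plane → ℝ}
    (hg : ∀ y, r' ≤ dist y y₀ → g y = 0) {x : M}
    (hx : x ∉ (extChartAt (𝓡 2) x₀).source ∩ extChartAt (𝓡 2) x₀ ⁻¹' Metric.ball y₀ r) :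
    chartExt x₀ g =ᶠ[𝓝 x] fun _ => 0 := by
  set φ := extChartAt (𝓡 2) x₀
  have hcB : Metric.closedBall y₀ r' ⊆ Metric.ball y₀ r := Metric.closedBall_subset_ball hr
  have hcl : IsClosed (φ.symm '' Metric.closedBall y₀ r') :=
    ((isCompact_closedBall y₀ r').image_of_continuousOn
      ((continuousOn_extChartAt_symm x₀).mono (hcB.trans hB))).isClosed
  have hxK : x ∉ φ.symm '' Metric.closedBall y₀ r' := by
    rintro ⟨y, hy, rfl⟩
    refine hx ⟨φ.map_target (hB (hcB hy)), ?_⟩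
    rw [mem_preimage, φ.right_inv (hB (hcB hy))]
    exact hcB hy
  filter_upwards [hcl.isOpen_compl.mem_nhds hxK] with z hz
  by_cases hzs : z ∈ φ.source
  · rw [chartExt_of_mem hzs]
    refine hg _ (not_lt.1 fun hlt => hz ⟨φ z, ?_, φ.left_inv hzs⟩)
    exact hlt.le
  · exact indicator_of_notMem hzs _

theorem contMDiff_chartExt {x₀ : M} {y₀ : Plane} {r' r : ℝ} (hr : r' < r)
    (hB : Metric.ball y₀ r ⊆ (extChartAt (𝓡 2) x₀).target) {g : Plane → ℝ}
    (hg : ∀ y, r' ≤ dist y y₀ → g y = 0) (hgs : ContDiff ℝ ∞ g) :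
    ContMDiff (𝓡 2) 𝓘(ℝ, ℝ) ∞ (chartExt x₀ g) := by
  intro x
  by_cases hx : x ∈ (extChartAt (𝓡 2) x₀).source ∩ extChartAt (𝓡 2) x₀ ⁻¹' Metric.ball y₀ r
  · have h1 : ContMDiffAt (𝓡 2) 𝓘(ℝ, Plane) ∞ (extChartAt (𝓡 2) x₀) x :=
      contMDiffAt_extChartAt' (by rw [← extChartAt_source (𝓡 2)]; exact hx.1)
    have h2 := (hgs.contMDiff.contMDiffAt (x := extChartAt (𝓡 2) x₀ x)).comp x h1
    refine h2.congr_of_eventuallyEq ?_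
    filter_upwards [(isOpen_extChartAt_source x₀).mem_nhds hx.1] with z hz
    exact chartExt_of_mem hz g
  · exact contMDiffAt_const.congr_of_eventuallyEq (chartExt_eventuallyEq_zero hr hB hg hx)

/-- No differentiability is assumed: where `g` is not differentiable, both the gradient and `fderiv`
take the default value zero. -/
theorem inner_grad_chartExt {x₀ : M} {y : Plane} (hy : y ∈ (extChartAt (𝓡 2) x₀).target)
    (g : Plane → ℝ) (w : Plane) :
    inner ℝ (grad (chartExt x₀ g) ((extChartAt (𝓡 2) x₀).symm y)) (chartLin x₀ y w) =
      fderiv ℝ g y w := by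
  have he := chartExt_comp_symm_eventuallyEq hy g
  by_cases hd : DifferentiableAt ℝ g y
  · rw [inner_grad_chartLin hy ((mdifferentiableAt_iff_chart hy).2 (hd.congr_of_eventuallyEq he)),
      he.fderiv_eq]
  · rw [grad_of_not_mdifferentiableAt, inner_zero_left, fderiv_zero_of_not_differentiableAt hd]
    · rfl
    · rw [mdifferentiableAt_iff_chart hy]
      exact fun h => hd (h.congr_of_eventuallyEq he.symm)

variable [MeasurableSpace M] [BorelSpace M]

/-- Measurability of the length of a vector field, from its components in a chart. -/
theorem measurable_norm_of_chart {x₀ : M} {B : Set Plane} (hBm : MeasurableSet B)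
    (hB : B ⊆ (extChartAt (𝓡 2) x₀).target) {Y : ∀ x : M, TangentSpace (𝓡 2) x}
    (hY : ∀ x ∉ (extChartAt (𝓡 2) x₀).source ∩ extChartAt (𝓡 2) x₀ ⁻¹' B, Y x = 0)
    {b : Fin 2 → Plane → ℝ} (hb : ∀ i, Measurable (b i))
    (hYb : ∀ y ∈ B, ∀ i, inner ℝ (Y ((extChartAt (𝓡 2) x₀).symm y)) (coordVec x₀ y i) = b i y) :
    Measurable fun x => ‖Y x‖ := by
  classical
  set φ := extChartAt (𝓡 2) x₀ with hφ
  set Φ : M → Plane := φ.source.piecewise φ (fun _ => 0) with hΦ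
  have hΦm : Measurable Φ :=
    (continuousOn_extChartAt x₀).measurable_piecewise continuousOn_const (measurableSet_source x₀)
  set G : Fin 2 → Fin 2 → Plane → ℝ := fun i j =>
    φ.target.piecewise (fun y => metricMatrix x₀ y i j) (fun _ => 0) with hG
  have hGm : ∀ i j, Measurable (G i j) := fun i j =>
    (contDiffOn_metricMatrix x₀ i j).continuousOn.measurable_piecewise continuousOn_const
      (measurableSet_target x₀)
  set H : Plane → ℝ := fun y => Real.sqrt ((G 1 1 y * b 0 y ^ 2 - 2 * G 0 1 y * (b 0 y * b 1 y)
    + G 0 0 y * b 1 y ^ 2) / (G 0 0 y * G 1 1 y - G 0 1 y ^ 2)) with hH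
  have hHm : Measurable H := by
    have := hGm 0 0; have := hGm 0 1; have := hGm 1 1; have := hb 0; have := hb 1
    exact Measurable.sqrt (by fun_prop)
  have heq : (fun x => ‖Y x‖) = (φ.source ∩ φ ⁻¹' B).indicator (H ∘ Φ) := by
    funext x
    by_cases hx : x ∈ φ.source ∩ φ ⁻¹' B
    · rw [indicator_of_mem hx]
      obtain ⟨y, hy, rfl⟩ : ∃ y ∈ B, φ.symm y = x := ⟨φ x, hx.2, φ.left_inv hx.1⟩
      have hyt := hB hy
      have hΦy : Φ (φ.symm y) = y := by
        rw [hΦ, piecewise_eq_of_mem _ _ _ hx.1, φ.right_inv hyt]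
      have hGy : ∀ i j, G i j y = metricMatrix x₀ y i j := fun i j =>
        piecewise_eq_of_mem _ _ _ hyt
      simp only [Function.comp, hΦy, hH, hGy]
      have := det_mul_norm_sq hyt (Y (φ.symm y))
      rw [hYb y hy, hYb y hy] at this
      rw [← this, ← det_metricMatrix, mul_div_cancel_left₀ _ (det_metricMatrix_pos hyt).ne',
        Real.sqrt_sq (norm_nonneg _)]
    · rw [indicator_of_notMem hx, hY x hx, norm_zero]
  rw [heq]
  exact (hHm.comp hΦm).indicator (measurableSet_source_inter x₀ hBm)

open scoped NNReal in
/-- A Lipschitz function supported in a chart has its pointwise gradient as weak gradient. -/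
theorem hasWeakGrad_chartExt [CompactSpace M] {x₀ : M} {y₀ : Plane} {r' r C : ℝ} (hr : r' < r)
    (hB : Metric.ball y₀ r ⊆ (extChartAt (𝓡 2) x₀).target) (hC0 : 0 ≤ C)
    (hC : ∀ y ∈ Metric.ball y₀ r, ∀ v : TangentSpace (𝓡 2) ((extChartAt (𝓡 2) x₀).symm y),
      ‖v‖ ≤ C * (|inner ℝ v (coordVec x₀ y 0)| + |inner ℝ v (coordVec x₀ y 1)|))
    {g : Plane → ℝ} (hg : ∀ y, r' ≤ dist y y₀ → g y = 0) {K : ℝ≥0} (hgl : LipschitzWith K g) :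
    HasWeakGrad (chartExt x₀ g) (grad (chartExt x₀ g)) := by
  set φ := extChartAt (𝓡 2) x₀ with hφ
  set W := φ.source ∩ φ ⁻¹' Metric.ball y₀ r with hW
  have hBm : MeasurableSet (Metric.ball y₀ r) := Metric.isOpen_ball.measurableSet
  have hWm : MeasurableSet W := measurableSet_source_inter x₀ hBm
  -- Mollifying at scale (r − r')/2 keeps the supports within a radius smaller than `r`.
  obtain ⟨G, hGs, hGc, hG0, hGd, hGt⟩ := exists_smooth_approx hgl (δ := (r - r') / 2) (by linarith)
  have hr'' : r' + (r - r') / 2 < r := by linarith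
  have hG0' : ∀ n y, r' + (r - r') / 2 ≤ dist y y₀ → G n y = 0 := fun n y hy =>
    hG0 n y fun z hz => hg z (by
      have := dist_triangle y z y₀
      have h2 : dist z y < (r - r') / 2 := hz
      rw [dist_comm z y] at h2
      linarith)
  have hg' : ∀ y, r' + (r - r') / 2 ≤ dist y y₀ → g y = 0 := fun y hy => hg y (by linarith)
  have hzero : ∀ n, ∀ x ∉ W, grad (chartExt x₀ (G n)) x - grad (chartExt x₀ g) x = 0 := by
    intro n x hx
    rw [grad_eq_of_eventuallyEq (chartExt_eventuallyEq_zero hr'' hB (hG0' n) hx),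
      grad_eq_of_eventuallyEq (chartExt_eventuallyEq_zero hr'' hB hg' hx), sub_self]
  have hin : ∀ n, ∀ y ∈ Metric.ball y₀ r, ∀ i,
      inner ℝ (grad (chartExt x₀ (G n)) (φ.symm y) - grad (chartExt x₀ g) (φ.symm y))
        (coordVec x₀ y i) =
      fderiv ℝ (G n) y (EuclideanSpace.single i 1) - fderiv ℝ g y (EuclideanSpace.single i 1) := by
    intro n y hy i
    rw [inner_sub_left, coordVec_eq, inner_grad_chartExt (hB hy), inner_grad_chartExt (hB hy)]
  have hm : ∀ n, Measurable fun x => ‖grad (chartExt x₀ (G n)) x - grad (chartExt x₀ g) x‖ :=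
    fun n => measurable_norm_of_chart hBm hB (hzero n)
      (fun i => (measurable_fderiv_apply_const ℝ (G n) _).sub (measurable_fderiv_apply_const ℝ g _))
      (hin n)
  have hbd : ∀ n, ∀ y ∈ Metric.ball y₀ r,
      ‖grad (chartExt x₀ (G n)) (φ.symm y) - grad (chartExt x₀ g) (φ.symm y)‖ ≤
        2 * C * ‖fderiv ℝ (G n) y - fderiv ℝ g y‖ := by
    intro n y hy
    refine (hC y hy _).trans ?_
    rw [hin n y hy, hin n y hy]
    have key : ∀ i : Fin 2, |fderiv ℝ (G n) y (EuclideanSpace.single i 1)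
        - fderiv ℝ g y (EuclideanSpace.single i 1)| ≤ ‖fderiv ℝ (G n) y - fderiv ℝ g y‖ := by
      intro i
      have := (fderiv ℝ (G n) y - fderiv ℝ g y).le_opNorm (EuclideanSpace.single i 1)
      rw [PiLp.norm_single, norm_one, mul_one] at this
      exact this
    calc _ ≤ C * (‖fderiv ℝ (G n) y - fderiv ℝ g y‖ + ‖fderiv ℝ (G n) y - fderiv ℝ g y‖) := by
          gcongr
          · exact key 0
          · exact key 1
      _ = _ := by ring
  have hcont : ∀ n, Continuous (chartExt x₀ (G n)) := fun n =>
    (contMDiff_chartExt hr'' hB (hG0' n) (hGs n)).continuous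
  have hunif : ∀ n x, |chartExt x₀ (G n) x - chartExt x₀ g x| ≤ K * ((r - r') / 2 / (n + 1)) := by
    intro n x
    by_cases hx : x ∈ φ.source
    · rw [chartExt_of_mem hx, chartExt_of_mem hx]
      exact hGc n _
    · rw [chartExt, chartExt, indicator_of_notMem hx, indicator_of_notMem hx, sub_self, abs_zero]
      have : 0 ≤ (r - r') / 2 := by linarith
      positivity
  have hlim : Tendsto (fun n : ℕ => (K : ℝ) * ((r - r') / 2 / (n + 1))) atTop (𝓝 0) := by
    have := (tendsto_const_nhds (x := (r - r') / 2)).div_atTop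
      (tendsto_atTop_add_const_right _ (1 : ℝ) tendsto_natCast_atTop_atTop)
    simpa using this.const_mul (K : ℝ)
  have hpt : ∀ x, Tendsto (fun n => chartExt x₀ (G n) x - chartExt x₀ g x) atTop (𝓝 0) :=
    fun x => squeeze_zero_norm (fun n => hunif n x) hlim
  have hmg : Measurable (chartExt x₀ g) := by
    refine measurable_of_tendsto_metrizable (fun n => (hcont n).measurable) (tendsto_pi_nhds.2 fun x => ?_)
    simpa using (hpt x).add_const (chartExt x₀ g x)
  refine ⟨hmg.aestronglyMeasurable, fun n => chartExt x₀ (G n),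
    fun n => contMDiff_chartExt hr'' hB (hG0' n) (hGs n), fun n => (hm n).aestronglyMeasurable, ?_, ?_⟩
  · refine tendsto_eLpNorm_two_of_bounded (c := K * ((r - r') / 2))
      (fun n => ((hcont n).measurable.sub hmg).aestronglyMeasurable) (fun n x => ?_)
      (Eventually.of_forall hpt)
    refine (hunif n x).trans ?_
    refine mul_le_mul_of_nonneg_left ?_ K.coe_nonneg
    exact div_le_self (by linarith) (by have := (Nat.cast_nonneg n : (0 : ℝ) ≤ n); linarith)
  · refine tendsto_eLpNorm_two_of_bounded (c := 2 * C * (K + K))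
      (fun n => (hm n).aestronglyMeasurable) (fun n x => ?_) ?_
    · rw [abs_norm]
      by_cases hx : x ∈ W
      · obtain ⟨y, hy, rfl⟩ : ∃ y ∈ Metric.ball y₀ r, φ.symm y = x := ⟨φ x, hx.2, φ.left_inv hx.1⟩
        refine (hbd n y hy).trans ?_
        gcongr
        exact (norm_sub_le _ _).trans (add_le_add (hGd n y) (norm_fderiv_le_of_lipschitz ℝ hgl))
      · rw [hzero n x hx, norm_zero]
        positivity
    · rw [← Measure.restrict_univ (μ := vol M), ← union_compl_self W, ae_restrict_union_iff]
      constructor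
      · refine ae_chart_of_ae x₀ hBm hB ?_
        filter_upwards [ae_restrict_of_ae hGt, ae_restrict_mem hBm] with y hy hyB
        refine squeeze_zero (fun n => norm_nonneg _) (fun n => hbd n y hyB) ?_
        have := (tendsto_iff_norm_sub_tendsto_zero.1 hy).const_mul (2 * C)
        simpa using this
      · filter_upwards [ae_restrict_mem hWm.compl] with x hx
        simp only [hzero _ x hx, norm_zero]
        exact tendsto_const_nhds

end

/-! ### Coordinates adapted to the distance from a point. -/

section

variable {M : Type*} [TopologicalSpace M] [ChartedSpace Plane M] [IsManifold (𝓡 2) ∞ M]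
  [RiemannianBundle (fun x : M => TangentSpace (𝓡 2) x)]
  [IsContMDiffRiemannianBundle (𝓡 2) ∞ Plane (fun x : M => TangentSpace (𝓡 2) x)]
  [T2Space M]

/-- Linear coordinates around `p₀` in which the distance to `p₀` and the volume density are
Euclidean up to a relative error that is linear in the distance. -/
structure DistChart (p₀ : M) where
  /-- The linear change of coordinates. -/
  A : Plane ≃L[ℝ] Plane
  /-- The error constant. -/
  C : ℝ
  /-- The radius of the coordinate disk. -/
  ρ : ℝ
  /-- The radius of a ball of the chart that contains the coordinate disk. -/
  r : ℝ
  C_nonneg : 0 ≤ C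
  ρ_pos : 0 < ρ
  r_pos : 0 < r
  det_pos : 0 < LinearMap.det (A : Plane →ₗ[ℝ] Plane)
  ball_subset : Metric.ball (extChartAt (𝓡 2) p₀ p₀) r ⊆ (extChartAt (𝓡 2) p₀).target
  norm_le : ∀ y ∈ Metric.ball (extChartAt (𝓡 2) p₀ p₀) r,
    ∀ v : TangentSpace (𝓡 2) ((extChartAt (𝓡 2) p₀).symm y),
      ‖v‖ ≤ C * (|inner ℝ v (coordVec p₀ y 0)| + |inner ℝ v (coordVec p₀ y 1)|)
  dist_lt : ∀ y, ‖A (y - extChartAt (𝓡 2) p₀ p₀)‖ ≤ ρ → dist y (extChartAt (𝓡 2) p₀ p₀) < r / 2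
  dens_le : ∀ y, ‖A (y - extChartAt (𝓡 2) p₀ p₀)‖ ≤ ρ →
    |dens p₀ y - LinearMap.det (A : Plane →ₗ[ℝ] Plane)| ≤
      C * ‖A (y - extChartAt (𝓡 2) p₀ p₀)‖ ∧
    dens p₀ y ≤ 2 * LinearMap.det (A : Plane →ₗ[ℝ] Plane) ∧
    LinearMap.det (A : Plane →ₗ[ℝ] Plane) ≤ 2 * dens p₀ y
  edist_ne_top : ∀ y, ‖A (y - extChartAt (𝓡 2) p₀ p₀)‖ ≤ ρ →
    riemannianEDist (𝓡 2) ((extChartAt (𝓡 2) p₀).symm y) p₀ ≠ ⊤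
  distTo_le : ∀ y, ‖A (y - extChartAt (𝓡 2) p₀ p₀)‖ ≤ ρ →
    |distTo p₀ ((extChartAt (𝓡 2) p₀).symm y) - ‖A (y - extChartAt (𝓡 2) p₀ p₀)‖| ≤
      C * ‖A (y - extChartAt (𝓡 2) p₀ p₀)‖ ^ 2 ∧
    distTo p₀ ((extChartAt (𝓡 2) p₀).symm y) ≤ 2 * ‖A (y - extChartAt (𝓡 2) p₀ p₀)‖ ∧
    ‖A (y - extChartAt (𝓡 2) p₀ p₀)‖ ≤ 2 * distTo p₀ ((extChartAt (𝓡 2) p₀).symm y)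
  distTo_sub_le : ∀ y z, ‖A (y - extChartAt (𝓡 2) p₀ p₀)‖ ≤ ρ →
    ‖A (z - extChartAt (𝓡 2) p₀ p₀)‖ ≤ ρ →
    |distTo p₀ ((extChartAt (𝓡 2) p₀).symm y) - distTo p₀ ((extChartAt (𝓡 2) p₀).symm z)| ≤
      2 * ‖A (y - z)‖
  mem_source : ∀ q s, 0 < s → 2 * s ≤ ρ →
    riemannianEDist (𝓡 2) q p₀ < ENNReal.ofReal s →
    q ∈ (extChartAt (𝓡 2) p₀).source ∧
      ‖A (extChartAt (𝓡 2) p₀ q - extChartAt (𝓡 2) p₀ p₀)‖ < 2 * s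

theorem nonempty_distChart (p₀ : M) : Nonempty (DistChart p₀) := by
  set φ := extChartAt (𝓡 2) p₀ with hφ
  set a := φ p₀ with ha
  have hat : a ∈ φ.target := mem_extChartAt_target p₀
  have hpa : φ.symm a = p₀ := extChartAt_to_inv p₀
  obtain ⟨A, C, ρ, hC, hρ, hCρ, -, hdet, hnear⟩ := exists_near_isometry hat
  obtain ⟨r, hr, C', hC', hB, hbd⟩ := exists_chart_bounds p₀
  have hd0 : 0 < dens p₀ a := dens_pos hat
  obtain ⟨κ, hκ0, hκ⟩ : ∃ κ > 0, ∀ w, ‖w‖ ≤ κ * ‖A w‖ := by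
    refine ⟨‖(A.symm : Plane →L[ℝ] Plane)‖ + 1, by positivity, fun w => ?_⟩
    have := (A.symm : Plane →L[ℝ] Plane).le_opNorm (A w)
    simp only [ContinuousLinearEquiv.coe_coe, ContinuousLinearEquiv.symm_apply_apply] at this
    linarith [norm_nonneg (A w)]
  obtain ⟨c, hc0, hc⟩ : ∃ c : ℝ, 0 ≤ c ∧ ∀ᶠ y in 𝓝 a, |dens p₀ y - dens p₀ a| ≤ c * ‖y - a‖ := by
    have hd : DifferentiableAt ℝ (dens p₀) a := by
      have h1 : DifferentiableAt ℝ (fun y => (metricMatrix p₀ y).det) a := by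
        have h := fun i j => ((contDiffOn_metricMatrix p₀ i j).contDiffAt
          ((isOpen_target p₀).mem_nhds hat)).differentiableAt (by simp)
        simp only [det_metricMatrix]
        exact ((h 0 0).mul (h 1 1)).sub ((h 0 1).pow 2)
      exact h1.sqrt (det_metricMatrix_pos hat).ne'
    obtain ⟨c, hc, h⟩ := hd.isBigO_sub.exists_nonneg
    exact ⟨c, hc, h.bound⟩
  -- The radius ρ' below keeps the disk inside the nearly isometric one, inside the half ball of the
  -- chart, inside the range of the linear bound on the density, and small enough that the density
  -- varies by at most half of its value at `p₀`.
  obtain ⟨r₁, hr₁, hball⟩ := Metric.eventually_nhds_iff_ball.1 hc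
  set ρ' := min (min ρ (r / (4 * κ))) (min (r₁ / (2 * κ)) (dens p₀ a / (2 * (c * κ + 1)))) with hρ'
  have hρ'0 : 0 < ρ' := by positivity
  have h1 : ρ' ≤ ρ := (min_le_left _ _).trans (min_le_left _ _)
  have h2 : ρ' * (4 * κ) ≤ r := by
    rw [← le_div_iff₀ (by positivity)]
    exact (min_le_left _ _).trans (min_le_right _ _)
  have h3 : ρ' * (2 * κ) ≤ r₁ := by
    rw [← le_div_iff₀ (by positivity)]
    exact (min_le_right _ _).trans (min_le_left _ _)
  have h4 : ρ' * (2 * (c * κ + 1)) ≤ dens p₀ a := by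
    rw [← le_div_iff₀ (by positivity)]
    exact (min_le_right _ _).trans (min_le_right _ _)
  have hnear2 : ∀ y, ‖A (y - a)‖ ≤ ρ → (1 - C * ‖A (y - a)‖) * ‖A (y - a)‖ ≤ distTo p₀ (φ.symm y) ∧
      distTo p₀ (φ.symm y) ≤ (1 + C * ‖A (y - a)‖) * ‖A (y - a)‖ ∧
      riemannianEDist (𝓡 2) (φ.symm y) p₀ ≠ ⊤ := by
    intro y hy
    obtain ⟨l1, l2⟩ := riemannianEDist_near hC hCρ hnear hy
    rw [← hφ, hpa, riemannianEDist_comm] at l1 l2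
    have hfin := (l2.trans_lt ENNReal.ofReal_lt_top).ne
    refine ⟨(ENNReal.ofReal_le_iff_le_toReal hfin).1 l1, ?_, hfin⟩
    exact ENNReal.toReal_le_of_le_ofReal (by positivity) l2
  have hCs : ∀ y, ‖A (y - a)‖ ≤ ρ → C * ‖A (y - a)‖ ≤ 1 / 2 := fun y hy =>
    (mul_le_mul_of_nonneg_left hy hC).trans hCρ
  have e1 : C ≤ C + C' + c * κ := by nlinarith [mul_nonneg hc0 hκ0.le]
  have e2 : C' ≤ C + C' + c * κ := by nlinarith [mul_nonneg hc0 hκ0.le]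
  have e3 : c * κ ≤ C + C' + c * κ := by linarith
  refine ⟨⟨A, C + C' + c * κ, ρ', r, by positivity, hρ'0, hr, by rw [hdet]; exact hd0, hB, ?_, ?_, ?_, ?_,
    ?_, ?_, ?_⟩⟩
  · intro y hy v
    refine ((hbd y hy).2.2.2 v).trans ?_
    gcongr
  · intro y hy
    rw [dist_eq_norm]
    have := hκ (y - a)
    nlinarith only [this, hy, hκ0, h2, hr]
  · intro y hy
    have hyκ := hκ (y - a)
    have hyr : y ∈ Metric.ball a r₁ := by
      rw [mem_ball_iff_norm]
      nlinarith only [hyκ, hy, hκ0, h3, hr₁]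
    have hb := hball y hyr
    have hb2 : |dens p₀ y - dens p₀ a| ≤ c * κ * ‖A (y - a)‖ := by
      refine hb.trans ?_
      rw [mul_assoc]
      gcongr
    have hb3 : c * κ * ‖A (y - a)‖ ≤ dens p₀ a / 2 := by
      have : c * κ * ‖A (y - a)‖ ≤ c * κ * ρ' := by gcongr
      linarith
    rw [hdet]
    obtain ⟨b1, b2⟩ := abs_le.1 (hb2.trans hb3)
    refine ⟨hb2.trans ?_, by linarith, by linarith⟩
    gcongr
  · exact fun y hy => (hnear2 y (hy.trans h1)).2.2
  · intro y hy
    obtain ⟨l1, l2, -⟩ := hnear2 y (hy.trans h1)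
    have l3 := hCs y (hy.trans h1)
    have l4 := norm_nonneg (A (y - a))
    have l5 : C * ‖A (y - a)‖ ^ 2 ≤ (C + C' + c * κ) * ‖A (y - a)‖ ^ 2 := by gcongr
    refine ⟨?_, ?_, ?_⟩
    · rw [abs_le]
      constructor <;> linarith
    · nlinarith only [l2, l3, l4]
    · nlinarith only [l1, l3, l4]
  · intro y z hy hz
    have hy' := hy.trans h1
    have hz' := hz.trans h1
    have := riemannianEDist_symm_le (A := A) (convex_setOf_norm_le A a ρ)
      (fun y hy => (hnear y hy).1) (k := 2) (fun x hx w => ?_) hz' hy'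
    · exact abs_distTo_sub_le (by positivity) (hnear2 z hz').2.2 this
    · refine ((hnear x hx).2 w).2.trans ?_
      gcongr
      have := hCs x hx
      linarith
  · intro q s hs hsρ hq
    rw [riemannianEDist_comm, ← hpa] at hq
    refine mem_source_of_riemannianEDist_lt hC hCρ hnear (s := 2 * s) (by linarith)
      (by positivity) ?_
    rwa [mul_div_cancel_left₀ _ two_ne_zero]

end

/-! ### Radial integrals and energy densities. -/

section

variable {M : Type*} [TopologicalSpace M] [ChartedSpace Plane M] [IsManifold (𝓡 2) ∞ M]
  [RiemannianBundle (fun x : M => TangentSpace (𝓡 2) x)]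
  [IsContMDiffRiemannianBundle (𝓡 2) ∞ Plane (fun x : M => TangentSpace (𝓡 2) x)]

theorem image_affine_eq_ball (A : Plane ≃L[ℝ] Plane) (a : Plane) (R : ℝ) :
    (fun y => A (y - a)) '' {y | ‖A (y - a)‖ < R} = Metric.ball 0 R := by
  ext x
  constructor
  · rintro ⟨y, hy, rfl⟩
    exact mem_ball_zero_iff.2 hy
  · intro hx
    exact ⟨A.symm x + a, by simpa using hx, by simp⟩

theorem measurableSet_norm_lt (A : Plane ≃L[ℝ] Plane) (a : Plane) (R : ℝ) :
    MeasurableSet {y | ‖A (y - a)‖ < R} :=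
  (isOpen_lt (A.continuous.comp (continuous_id.sub continuous_const)).norm
    continuous_const).measurableSet

theorem hasFDerivAt_affine (A : Plane ≃L[ℝ] Plane) (a y : Plane) :
    HasFDerivAt (fun y => A (y - a)) (A : Plane →L[ℝ] Plane) y :=
  A.hasFDerivAt.comp y ((hasFDerivAt_id y).sub_const a)

theorem injective_affine (A : Plane ≃L[ℝ] Plane) (a : Plane) :
    Function.Injective fun y => A (y - a) :=
  fun _ _ h => sub_left_injective (A.injective h)

/-- Integration in polar coordinates. -/
theorem det_mul_integral_radial {A : Plane ≃L[ℝ] Plane}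
    (hA : 0 < LinearMap.det (A : Plane →ₗ[ℝ] Plane)) (a : Plane) (h : ℝ → ℝ) (R : ℝ) :
    LinearMap.det (A : Plane →ₗ[ℝ] Plane) * ∫ y in {y | ‖A (y - a)‖ < R}, h ‖A (y - a)‖ =
      2 * Real.pi * ∫ t in Ioo 0 R, t * h t := by
  have h1 := integral_image_eq_integral_abs_det_fderiv_smul volume (measurableSet_norm_lt A a R)
    (fun y _ => (hasFDerivAt_affine A a y).hasFDerivWithinAt) (injective_affine A a).injOn
    (fun x => h ‖x‖)
  have hdet : ((A : Plane →L[ℝ] Plane)).det = LinearMap.det (A : Plane →ₗ[ℝ] Plane) := rfl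
  rw [image_affine_eq_ball, hdet, abs_of_pos hA, integral_smul, smul_eq_mul] at h1
  rw [← h1, ← integral_indicator Metric.isOpen_ball.measurableSet]
  have h2 : (Metric.ball (0 : Plane) R).indicator (fun x => h ‖x‖) =
      fun x => (Iio R).indicator h ‖x‖ := by
    funext x
    by_cases hx : ‖x‖ < R <;> simp [indicator, hx]
  rw [h2, integral_fun_norm_addHaar volume ((Iio R).indicator h)]
  have h3 : (volume : Measure Plane).real (Metric.ball 0 1) = Real.pi := by
    rw [Measure.real, EuclideanSpace.volume_ball_fin_two]
    simp [Real.pi_nonneg]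
  rw [finrank_euclideanSpace_fin, h3, nsmul_eq_mul, smul_eq_mul, ← mul_assoc]
  congr 1
  rw [← integral_indicator measurableSet_Ioi, ← integral_indicator measurableSet_Ioo]
  congr 1
  funext t
  by_cases h0 : 0 < t <;> by_cases hR : t < R <;> simp [indicator, h0, hR]

theorem integrableOn_radial {A : Plane ≃L[ℝ] Plane}
    (hA : 0 < LinearMap.det (A : Plane →ₗ[ℝ] Plane)) (a : Plane) {h : ℝ → ℝ} {R : ℝ} (hi : IntegrableOn (fun t => t * h t) (Ioo 0 R)) :
    IntegrableOn (fun y => h ‖A (y - a)‖) {y | ‖A (y - a)‖ < R} := by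
  have h1 := integrableOn_image_iff_integrableOn_abs_det_fderiv_smul volume
    (measurableSet_norm_lt A a R)
    (fun y _ => (hasFDerivAt_affine A a y).hasFDerivWithinAt) (injective_affine A a).injOn
    (fun x => h ‖x‖)
  have hdet : ((A : Plane →L[ℝ] Plane)).det = LinearMap.det (A : Plane →ₗ[ℝ] Plane) := rfl
  rw [image_affine_eq_ball, hdet, abs_of_pos hA, integrableOn_fun_norm_addHaar,
    finrank_euclideanSpace_fin] at h1
  have h2 := h1.1 (by simpa using hi)
  have h3 := Integrable.const_mul h2 (LinearMap.det (A : Plane →ₗ[ℝ] Plane))⁻¹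
  refine h3.congr (Eventually.of_forall fun y => ?_)
  change (LinearMap.det (A : Plane →ₗ[ℝ] Plane))⁻¹ * (LinearMap.det (A : Plane →ₗ[ℝ] Plane) * _) = _
  rw [inv_mul_cancel_left₀ hA.ne']

/-- The polar Jacobian cancels the singularity. This function dominates the error terms in the
energy and in the mean of the bubble. -/
theorem integrableOn_inv_radial {A : Plane ≃L[ℝ] Plane}
    (hA : 0 < LinearMap.det (A : Plane →ₗ[ℝ] Plane)) (a : Plane) (R : ℝ) :
    IntegrableOn (fun y => ‖A (y - a)‖⁻¹) {y | ‖A (y - a)‖ < R} := by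
  refine integrableOn_radial hA a (h := fun t => t⁻¹) ?_
  refine (integrableOn_const (C := (1 : ℝ)) (by simp)).congr_fun (fun t ht => ?_) measurableSet_Ioo
  exact (mul_inv_cancel₀ ht.1.ne').symm

/-- In polar coordinates 8(ln(ε² + t²) + ε²/(ε² + t²)) is an antiderivative. The term −2 ln ε from
the lower endpoint is the source of 32π ln(1/ε). -/
theorem integral_radial_energy {A : Plane ≃L[ℝ] Plane}
    (hA : 0 < LinearMap.det (A : Plane →ₗ[ℝ] Plane)) (a : Plane) {R ε : ℝ} (hR : 0 < R) (hε : 0 < ε) :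
    IntegrableOn (fun y => 16 * ‖A (y - a)‖ ^ 2 / (ε ^ 2 + ‖A (y - a)‖ ^ 2) ^ 2)
      {y | ‖A (y - a)‖ < R} ∧
    LinearMap.det (A : Plane →ₗ[ℝ] Plane) * ∫ y in {y | ‖A (y - a)‖ < R},
        16 * ‖A (y - a)‖ ^ 2 / (ε ^ 2 + ‖A (y - a)‖ ^ 2) ^ 2 =
      16 * Real.pi * (Real.log (ε ^ 2 + R ^ 2) - 2 * Real.log ε + ε ^ 2 / (ε ^ 2 + R ^ 2) - 1) := by
  set f : ℝ → ℝ := fun t => t * (16 * t ^ 2 / (ε ^ 2 + t ^ 2) ^ 2) with hf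
  have hc : Continuous f := by
    refine continuous_id.mul (Continuous.div (by fun_prop) (by fun_prop) fun t => ?_)
    positivity
  refine ⟨integrableOn_radial hA a (h := fun t => 16 * t ^ 2 / (ε ^ 2 + t ^ 2) ^ 2)
    ((hc.integrableOn_Icc).mono_set Ioo_subset_Icc_self), ?_⟩
  rw [det_mul_integral_radial hA a (fun t => 16 * t ^ 2 / (ε ^ 2 + t ^ 2) ^ 2),
    ← integral_Ioc_eq_integral_Ioo, ← intervalIntegral.integral_of_le hR.le]
  have hd : ∀ t ∈ uIcc 0 R, HasDerivAt
      (fun t => 8 * (Real.log (ε ^ 2 + t ^ 2) + ε ^ 2 / (ε ^ 2 + t ^ 2))) (f t) t := by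
    intro t _
    have hp : 0 < ε ^ 2 + t ^ 2 := by positivity
    have h1 : HasDerivAt (fun t => ε ^ 2 + t ^ 2) (2 * t) t := by
      simpa using (hasDerivAt_pow 2 t).const_add (ε ^ 2)
    have h2 := ((h1.log hp.ne').add ((hasDerivAt_const t (ε ^ 2)).div h1 hp.ne')).const_mul 8
    refine h2.congr_deriv ?_
    simp only [hf]
    field_simp
    ring
  rw [intervalIntegral.integral_eq_sub_of_hasDerivAt hd (hc.intervalIntegrable 0 R)]
  have h0 : Real.log (ε ^ 2 + 0 ^ 2) = 2 * Real.log ε := by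
    rw [zero_pow two_ne_zero, add_zero, Real.log_pow]; norm_num
  have h1 : ε ^ 2 / (ε ^ 2 + 0 ^ 2) = 1 := by
    rw [zero_pow two_ne_zero, add_zero, div_self (by positivity)]
  rw [h0, h1]
  ring

/-- By scaling, the mass over the whole plane is π for every ε; the correction is the tail beyond
radius `R`. -/
theorem integral_radial_mass {A : Plane ≃L[ℝ] Plane}
    (hA : 0 < LinearMap.det (A : Plane →ₗ[ℝ] Plane)) (a : Plane) {R ε : ℝ} (hR : 0 < R) (hε : 0 < ε) :
    IntegrableOn (fun y => ε ^ 2 / (ε ^ 2 + ‖A (y - a)‖ ^ 2) ^ 2) {y | ‖A (y - a)‖ < R} ∧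
    LinearMap.det (A : Plane →ₗ[ℝ] Plane) * ∫ y in {y | ‖A (y - a)‖ < R},
        ε ^ 2 / (ε ^ 2 + ‖A (y - a)‖ ^ 2) ^ 2 =
      Real.pi * (1 - ε ^ 2 / (ε ^ 2 + R ^ 2)) := by
  set f : ℝ → ℝ := fun t => t * (ε ^ 2 / (ε ^ 2 + t ^ 2) ^ 2) with hf
  have hc : Continuous f := by
    refine continuous_id.mul (Continuous.div (by fun_prop) (by fun_prop) fun t => ?_)
    positivity
  refine ⟨integrableOn_radial hA a (h := fun t => ε ^ 2 / (ε ^ 2 + t ^ 2) ^ 2)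
    ((hc.integrableOn_Icc).mono_set Ioo_subset_Icc_self), ?_⟩
  rw [det_mul_integral_radial hA a (fun t => ε ^ 2 / (ε ^ 2 + t ^ 2) ^ 2),
    ← integral_Ioc_eq_integral_Ioo, ← intervalIntegral.integral_of_le hR.le]
  have hd : ∀ t ∈ uIcc 0 R, HasDerivAt
      (fun t => -(1 / 2) * (ε ^ 2 / (ε ^ 2 + t ^ 2))) (f t) t := by
    intro t _
    have hp : 0 < ε ^ 2 + t ^ 2 := by positivity
    have h1 : HasDerivAt (fun t => ε ^ 2 + t ^ 2) (2 * t) t := by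
      simpa using (hasDerivAt_pow 2 t).const_add (ε ^ 2)
    have h2 := ((hasDerivAt_const t (ε ^ 2)).div h1 hp.ne').const_mul (-(1 / 2))
    refine h2.congr_deriv ?_
    simp only [hf]
    field_simp
    ring
  rw [intervalIntegral.integral_eq_sub_of_hasDerivAt hd (hc.intervalIntegrable 0 R)]
  have h1 : ε ^ 2 / (ε ^ 2 + 0 ^ 2) = 1 := by
    rw [zero_pow two_ne_zero, add_zero, div_self (by positivity)]
  rw [h1]
  ring

/-- The energy densities of a bubble at comparable radii are close. -/
theorem abs_energy_density_sub_le {C ε s t : ℝ} (hC : 0 ≤ C) (hs : 0 < s) (hts : s ≤ 2 * t)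
    (h : |t - s| ≤ C * s ^ 2) :
    |16 * t ^ 2 / (ε ^ 2 + t ^ 2) ^ 2 - 16 * s ^ 2 / (ε ^ 2 + s ^ 2) ^ 2| ≤ 96 * C * s⁻¹ := by
  have ht : 0 < t := by linarith
  have ps : 0 < ε ^ 2 + s ^ 2 := by positivity
  have pt : 0 < ε ^ 2 + t ^ 2 := by positivity
  -- As a difference of squares of t/(ε² + t²): the sum of the two terms is at most 3/s and their
  -- difference at most 2C, both uniformly in ε.
  have e : 16 * t ^ 2 / (ε ^ 2 + t ^ 2) ^ 2 - 16 * s ^ 2 / (ε ^ 2 + s ^ 2) ^ 2 =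
      16 * ((t / (ε ^ 2 + t ^ 2) - s / (ε ^ 2 + s ^ 2)) *
        (t / (ε ^ 2 + t ^ 2) + s / (ε ^ 2 + s ^ 2))) := by
    field_simp
    ring
  have h1 : t / (ε ^ 2 + t ^ 2) ≤ 2 * s⁻¹ := by
    rw [div_le_iff₀ pt, ← div_eq_mul_inv, div_mul_eq_mul_div, le_div_iff₀ hs]
    nlinarith [sq_nonneg ε]
  have h2 : s / (ε ^ 2 + s ^ 2) ≤ s⁻¹ := by
    rw [div_le_iff₀ ps, inv_mul_eq_div, le_div_iff₀ hs]
    nlinarith [sq_nonneg ε]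
  have h3 : |t / (ε ^ 2 + t ^ 2) - s / (ε ^ 2 + s ^ 2)| ≤ 2 * C := by
    have e2 : t / (ε ^ 2 + t ^ 2) - s / (ε ^ 2 + s ^ 2) =
        (t - s) * (ε ^ 2 - t * s) / ((ε ^ 2 + t ^ 2) * (ε ^ 2 + s ^ 2)) := by
      field_simp
      ring
    rw [e2, abs_div, abs_mul, abs_of_pos (mul_pos pt ps), div_le_iff₀ (mul_pos pt ps)]
    have hp : 0 < t * s := mul_pos ht hs
    have h4 : |ε ^ 2 - t * s| ≤ ε ^ 2 + t * s := by
      rw [abs_le]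
      constructor <;> nlinarith [sq_nonneg ε]
    have h5 : (ε ^ 2 + t * s) * (t * s) ≤ (ε ^ 2 + t ^ 2) * (ε ^ 2 + s ^ 2) := by
      nlinarith [mul_nonneg (sq_nonneg ε) (sq_nonneg (t - s)), mul_nonneg (sq_nonneg ε) hp.le,
        sq_nonneg (ε ^ 2)]
    have h6 : s ^ 2 ≤ 2 * (t * s) := by nlinarith
    calc |t - s| * |ε ^ 2 - t * s| ≤ (C * s ^ 2) * (ε ^ 2 + t * s) := by gcongr
      _ ≤ (C * (2 * (t * s))) * (ε ^ 2 + t * s) := by gcongr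
      _ = 2 * C * ((ε ^ 2 + t * s) * (t * s)) := by ring
      _ ≤ _ := by gcongr
  have h7 : 0 ≤ t / (ε ^ 2 + t ^ 2) + s / (ε ^ 2 + s ^ 2) := by positivity
  rw [e, abs_mul, abs_mul, abs_of_nonneg h7, abs_of_pos (by norm_num : (0 : ℝ) < 16)]
  calc _ ≤ 16 * (2 * C * (2 * s⁻¹ + s⁻¹)) := by gcongr
    _ = _ := by ring

theorem energy_density_le {ε s : ℝ} (hs : 0 < s) :
    16 * s ^ 2 / (ε ^ 2 + s ^ 2) ^ 2 ≤ 16 / s ^ 2 := by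
  rw [div_le_div_iff₀ (by positivity) (by positivity)]
  nlinarith [mul_nonneg (sq_nonneg ε) (sq_nonneg s), sq_nonneg (ε ^ 2)]

end

/-! ### The bubble as a Lipschitz function of the truncated distance, and its gradient. -/

section

variable {M : Type*} [TopologicalSpace M] [ChartedSpace Plane M] [IsManifold (𝓡 2) ∞ M]
  [RiemannianBundle (fun x : M => TangentSpace (𝓡 2) x)]
  [IsContMDiffRiemannianBundle (𝓡 2) ∞ Plane (fun x : M => TangentSpace (𝓡 2) x)]
  [T2Space M]

/-- The bubble as a function of the distance. -/
def profile (ε t : ℝ) : ℝ := Real.log (ε ^ 2 / (ε ^ 2 + t ^ 2) ^ 2)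

theorem profile_eq {ε : ℝ} (hε : 0 < ε) (t : ℝ) :
    profile ε t = 2 * Real.log ε - 2 * Real.log (ε ^ 2 + t ^ 2) := by
  rw [profile, Real.log_div (by positivity) (by positivity), Real.log_pow, Real.log_pow]
  norm_num

theorem hasDerivAt_profile {ε : ℝ} (hε : 0 < ε) (t : ℝ) :
    HasDerivAt (profile ε) (-(4 * t / (ε ^ 2 + t ^ 2))) t := by
  have e : profile ε = fun t => 2 * Real.log ε - 2 * Real.log (ε ^ 2 + t ^ 2) :=
    funext (profile_eq hε)
  rw [e]
  have hp : 0 < ε ^ 2 + t ^ 2 := by positivity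
  have h1 : HasDerivAt (fun t => ε ^ 2 + t ^ 2) (2 * t) t := by
    simpa using (hasDerivAt_pow 2 t).const_add (ε ^ 2)
  refine (((h1.log hp.ne').const_mul 2).const_sub _).congr_deriv ?_
  ring

theorem lipschitzWith_profile {ε : ℝ} (hε : 0 < ε) :
    LipschitzWith (Real.toNNReal (2 / ε)) (profile ε) := by
  refine lipschitzWith_of_nnnorm_deriv_le (fun t => (hasDerivAt_profile hε t).differentiableAt)
    fun t => ?_
  rw [← NNReal.coe_le_coe, coe_nnnorm, (hasDerivAt_profile hε t).deriv, norm_neg,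
    Real.norm_eq_abs, Real.coe_toNNReal _ (by positivity), abs_div,
    abs_of_pos (by positivity : 0 < ε ^ 2 + t ^ 2), div_le_div_iff₀ (by positivity) hε, abs_mul,
    abs_of_pos (by norm_num : (0 : ℝ) < 4)]
  nlinarith [sq_nonneg (ε - |t|), sq_abs t]

theorem profile_le_profile {ε s t : ℝ} (hε : 0 < ε) (hs : 0 ≤ s) (hst : s ≤ t) :
    profile ε t ≤ profile ε s := by
  rw [profile_eq hε, profile_eq hε]
  have : Real.log (ε ^ 2 + s ^ 2) ≤ Real.log (ε ^ 2 + t ^ 2) :=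
    Real.log_le_log (by positivity) (by gcongr)
  linarith

/-- The distance to `p₀`, truncated at `r₀`. -/
def truncDist (p₀ : M) (r₀ : ℝ) (q : M) : ℝ :=
  if riemannianEDist (𝓡 2) q p₀ < ENNReal.ofReal r₀ then distTo p₀ q else r₀

theorem bubbleV_eq [MeasurableSpace M] (p₀ : M) (r₀ ε : ℝ) (q : M) :
    bubbleV p₀ r₀ ε q = profile ε (truncDist p₀ r₀ q) := by
  unfold bubbleV truncDist
  split_ifs <;> rfl

theorem truncDist_nonneg {r₀ : ℝ} (hr₀ : 0 < r₀) (p₀ q : M) : 0 ≤ truncDist p₀ r₀ q := by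
  unfold truncDist
  split_ifs
  · exact distTo_nonneg _ _
  · exact hr₀.le

theorem truncDist_le {r₀ : ℝ} (hr₀ : 0 < r₀) (p₀ q : M) : truncDist p₀ r₀ q ≤ r₀ := by
  unfold truncDist
  split_ifs with h
  · exact ENNReal.toReal_le_of_le_ofReal hr₀.le h.le
  · exact le_rfl

namespace DistChart

variable {p₀ : M} (D : DistChart p₀)

/-- The Euclidean radius in the linear coordinates. -/
def rad (y : Plane) : ℝ := ‖D.A (y - extChartAt (𝓡 2) p₀ p₀)‖

theorem rad_nonneg (y : Plane) : 0 ≤ D.rad y := norm_nonneg _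

theorem rad_le (y z : Plane) : D.rad y ≤ D.rad z + ‖D.A (y - z)‖ := by
  have : y - extChartAt (𝓡 2) p₀ p₀ = (z - extChartAt (𝓡 2) p₀ p₀) + (y - z) := by abel
  unfold rad
  rw [this, map_add]
  exact norm_add_le _ _

theorem mem_ball {y : Plane} (hy : D.rad y ≤ D.ρ) :
    y ∈ Metric.ball (extChartAt (𝓡 2) p₀ p₀) D.r := by
  have := D.dist_lt y hy
  have := D.r_pos
  rw [Metric.mem_ball]
  linarith

theorem mem_target {y : Plane} (hy : D.rad y ≤ D.ρ) : y ∈ (extChartAt (𝓡 2) p₀).target :=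
  D.ball_subset (D.mem_ball hy)

theorem truncDist_symm {r₀ : ℝ} {y : Plane} (hy : D.rad y ≤ D.ρ) :
    truncDist p₀ r₀ ((extChartAt (𝓡 2) p₀).symm y) =
      min (distTo p₀ ((extChartAt (𝓡 2) p₀).symm y)) r₀ := by
  unfold truncDist
  have hiff := ENNReal.lt_ofReal_iff_toReal_lt (b := r₀) (D.edist_ne_top y hy)
  split_ifs with h <;> rw [hiff] at h
  · exact (min_eq_left (le_of_lt h)).symm
  · exact (min_eq_right (not_lt.1 h)).symm

/-- The truncated distance in the chart. -/
def trunc (r₀ : ℝ) (y : Plane) : ℝ :=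
  if D.rad y ≤ D.ρ then truncDist p₀ r₀ ((extChartAt (𝓡 2) p₀).symm y) else r₀

variable {r₀ : ℝ}

theorem trunc_of_le {y : Plane} (hy : D.rad y ≤ D.ρ) :
    D.trunc r₀ y = min (distTo p₀ ((extChartAt (𝓡 2) p₀).symm y)) r₀ := by
  rw [trunc, if_pos hy, D.truncDist_symm hy]

theorem trunc_of_lt {y : Plane} (hy : D.ρ < D.rad y) : D.trunc r₀ y = r₀ := by
  rw [trunc, if_neg (not_le.2 hy)]

theorem trunc_le (y : Plane) : D.trunc r₀ y ≤ r₀ := by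
  rcases le_or_gt (D.rad y) D.ρ with h | h
  · rw [D.trunc_of_le h]; exact min_le_right _ _
  · rw [D.trunc_of_lt h]

theorem trunc_nonneg (hr₀ : 0 < r₀) (y : Plane) : 0 ≤ D.trunc r₀ y := by
  rcases le_or_gt (D.rad y) D.ρ with h | h
  · rw [D.trunc_of_le h]; exact le_min (distTo_nonneg _ _) hr₀.le
  · rw [D.trunc_of_lt h]; exact hr₀.le

theorem trunc_eq_of_two_mul_le {y : Plane} (hy : 2 * r₀ ≤ D.rad y) : D.trunc r₀ y = r₀ := by
  rcases le_or_gt (D.rad y) D.ρ with h | h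
  · rw [D.trunc_of_le h]
    have h1 : D.rad y ≤ 2 * _ := (D.distTo_le y h).2.2
    exact min_eq_right (by linarith)
  · exact D.trunc_of_lt h

/-- Beyond coordinate radius ρ the value `r₀` is imposed by definition. This is consistent, because
a point within distance `r₀` of `p₀` has coordinate radius below 2r₀ < ρ. -/
theorem trunc_extChartAt (hr₀ : 0 < r₀) (hr : 4 * r₀ < D.ρ) {q : M}
    (hq : q ∈ (extChartAt (𝓡 2) p₀).source) :
    D.trunc r₀ (extChartAt (𝓡 2) p₀ q) = truncDist p₀ r₀ q := by
  rcases le_or_gt (D.rad (extChartAt (𝓡 2) p₀ q)) D.ρ with h | h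
  · rw [trunc, if_pos h, (extChartAt (𝓡 2) p₀).left_inv hq]
  · rw [D.trunc_of_lt h, truncDist, if_neg]
    intro hlt
    have : D.rad (extChartAt (𝓡 2) p₀ q) < 2 * r₀ :=
      (D.mem_source q r₀ hr₀ (by linarith) hlt).2
    linarith

theorem truncDist_of_notMem (hr₀ : 0 < r₀) (hr : 4 * r₀ < D.ρ) {q : M}
    (hq : q ∉ (extChartAt (𝓡 2) p₀).source ∩ extChartAt (𝓡 2) p₀ ⁻¹' {y | D.rad y < 2 * r₀}) :
    truncDist p₀ r₀ q = r₀ := by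
  rw [truncDist, if_neg]
  intro hlt
  exact hq (D.mem_source q r₀ hr₀ (by linarith) hlt)

/-- The truncation is already constant on the annulus between radii 2r₀ and ρ, so the cutoff at ρ
makes no jump. If one point is inside radius 2r₀ and the other beyond ρ > 4r₀, they are more than
2r₀ apart while the values differ by at most `r₀`. -/
theorem abs_trunc_sub_le (hr₀ : 0 < r₀) (hr : 4 * r₀ < D.ρ) (y z : Plane) :
    |D.trunc r₀ y - D.trunc r₀ z| ≤ 2 * ‖D.A (y - z)‖ := by
  have key : ∀ y z, D.rad y ≤ D.ρ → D.ρ < D.rad z →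
      |D.trunc r₀ y - D.trunc r₀ z| ≤ 2 * ‖D.A (y - z)‖ := by
    intro y z hy hz
    have h0 := norm_nonneg (D.A (y - z))
    rcases le_or_gt (2 * r₀) (D.rad y) with h | h
    · rw [D.trunc_eq_of_two_mul_le h, D.trunc_of_lt hz, sub_self, abs_zero]
      positivity
    · rw [D.trunc_of_lt hz, abs_sub_comm, abs_of_nonneg (sub_nonneg.2 (D.trunc_le y))]
      have h1 := D.trunc_nonneg hr₀ y
      have h2 := D.rad_le z y
      rw [← norm_neg, ← map_neg, neg_sub] at h2
      linarith
  rcases le_or_gt (D.rad y) D.ρ with hy | hy <;> rcases le_or_gt (D.rad z) D.ρ with hz | hz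
  · rw [D.trunc_of_le hy, D.trunc_of_le hz]
    refine (abs_min_sub_min_le_max _ _ _ _).trans ?_
    rw [sub_self, abs_zero, max_eq_left (abs_nonneg _)]
    exact D.distTo_sub_le y z hy hz
  · exact key y z hy hz
  · rw [abs_sub_comm, ← norm_neg, ← map_neg, neg_sub]
    exact key z y hz hy
  · rw [D.trunc_of_lt hy, D.trunc_of_lt hz, sub_self, abs_zero]
    positivity

theorem lipschitzWith_trunc (hr₀ : 0 < r₀) (hr : 4 * r₀ < D.ρ) :
    LipschitzWith (2 * ‖(D.A : Plane →L[ℝ] Plane)‖₊) (D.trunc r₀) := by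
  refine LipschitzWith.of_dist_le_mul fun y z => ?_
  rw [Real.dist_eq, dist_eq_norm]
  refine (D.abs_trunc_sub_le hr₀ hr y z).trans ?_
  have := (D.A : Plane →L[ℝ] Plane).le_opNorm (y - z)
  push_cast
  rw [mul_assoc]
  exact mul_le_mul_of_nonneg_left this zero_le_two

/-- The bubble in the chart, normalized to vanish away from `p₀`. -/
def bump (r₀ ε : ℝ) (y : Plane) : ℝ := profile ε (D.trunc r₀ y) - profile ε r₀

/-- Removing the constant outer value makes the bubble compactly supported in the chart. The double
minus sign matches the shape of `HasWeakGrad.sub_const`. -/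
theorem chartExt_bump [MeasurableSpace M] (hr₀ : 0 < r₀) (hr : 4 * r₀ < D.ρ) (ε : ℝ) (q : M) :
    chartExt p₀ (D.bump r₀ ε) q - -profile ε r₀ = bubbleV p₀ r₀ ε q := by
  rw [bubbleV_eq]
  by_cases hq : q ∈ (extChartAt (𝓡 2) p₀).source
  · rw [chartExt_of_mem hq, bump, D.trunc_extChartAt hr₀ hr hq]
    ring
  · rw [chartExt, indicator_of_notMem hq, D.truncDist_of_notMem hr₀ hr fun h => hq h.1]
    ring

theorem bump_of_le {ε : ℝ} {y : Plane} (hy : D.r / 2 ≤ dist y (extChartAt (𝓡 2) p₀ p₀)) :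
    D.bump r₀ ε y = 0 := by
  rw [bump, D.trunc_of_lt, sub_self]
  by_contra h
  exact absurd (D.dist_lt y (not_lt.1 h)) (not_lt.2 hy)

theorem hasWeakGrad_bubbleV [MeasurableSpace M] [BorelSpace M] [CompactSpace M] (hr₀ : 0 < r₀)
    (hr : 4 * r₀ < D.ρ) {ε : ℝ} (hε : 0 < ε) :
    HasWeakGrad (bubbleV p₀ r₀ ε) (grad (chartExt p₀ (D.bump r₀ ε))) := by
  have hl : LipschitzWith (Real.toNNReal (2 / ε) * (2 * ‖(D.A : Plane →L[ℝ] Plane)‖₊) + 0)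
      (D.bump r₀ ε) :=
    ((lipschitzWith_profile hε).comp (D.lipschitzWith_trunc hr₀ hr)).sub (LipschitzWith.const _)
  have := (hasWeakGrad_chartExt (half_lt_self D.r_pos) D.ball_subset D.C_nonneg D.norm_le
    (fun y hy => D.bump_of_le hy) hl).sub_const (-profile ε r₀)
  rwa [funext (D.chartExt_bump hr₀ hr ε)] at this

/-- Where the truncation is inactive, this is the chain rule with |∇d| = 1. Elsewhere the
nonnegative function `bump` attains its minimum 0, so its derivative vanishes; this includes the
sphere of radius `r₀`. -/
theorem norm_sq_grad_chartExt_bump [CompactSpace M] (hr₀ : 0 < r₀) {ε : ℝ} (hε : 0 < ε)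
    {y : Plane} (hy : y ∈ (extChartAt (𝓡 2) p₀).target)
    (hya : y ≠ extChartAt (𝓡 2) p₀ p₀) (hd : DifferentiableAt ℝ (D.trunc r₀) y)
    (hc : Continuous (D.trunc r₀)) :
    ‖grad (chartExt p₀ (D.bump r₀ ε)) ((extChartAt (𝓡 2) p₀).symm y)‖ ^ 2 =
      if D.trunc r₀ y < r₀ then
        16 * D.trunc r₀ y ^ 2 / (ε ^ 2 + D.trunc r₀ y ^ 2) ^ 2 else 0 := by
  set φ := extChartAt (𝓡 2) p₀ with hφ
  split_ifs with h
  · have hev : distTo p₀ ∘ φ.symm =ᶠ[𝓝 y] D.trunc r₀ := by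
      filter_upwards [(isOpen_lt hc continuous_const).mem_nhds h] with z hz
      have hzρ : D.rad z ≤ D.ρ := by
        by_contra h'
        rw [not_le] at h'
        exact (show D.trunc r₀ z < r₀ from hz).ne (D.trunc_of_lt h')
      have hz' : D.trunc r₀ z < r₀ := hz
      rw [D.trunc_of_le hzρ] at hz' ⊢
      rcases min_lt_iff.1 hz' with h1 | h1
      · exact (min_eq_left h1.le).symm
      · exact absurd h1 (lt_irrefl _)
    have hyρ : D.rad y ≤ D.ρ := by
      by_contra h'
      rw [not_le] at h'
      exact h.ne (D.trunc_of_lt h')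
    have hdy : distTo p₀ (φ.symm y) = D.trunc r₀ y := hev.self_of_nhds
    have hpos : 0 < distTo p₀ (φ.symm y) := by
      have h1 : D.rad y ≤ 2 * distTo p₀ (φ.symm y) := (D.distTo_le y hyρ).2.2
      have h2 : 0 < D.rad y := norm_pos_iff.2 fun h0 =>
        hya (sub_eq_zero.1 ((map_eq_zero_iff D.A D.A.injective).1 h0))
      linarith
    have hm : MDifferentiableAt (𝓡 2) 𝓘(ℝ, ℝ) (distTo p₀) (φ.symm y) :=
      (mdifferentiableAt_iff_chart hy).2 (hd.congr_of_eventuallyEq hev)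
    have h1 := norm_grad_distTo (D.edist_ne_top y hyρ) hpos hm
    have hg : grad (chartExt p₀ (D.bump r₀ ε)) (φ.symm y) =
        (-(4 * D.trunc r₀ y / (ε ^ 2 + D.trunc r₀ y ^ 2))) • grad (distTo p₀) (φ.symm y) := by
      refine eq_of_inner_chartLin hy fun w => ?_
      rw [inner_grad_chartExt hy, real_inner_smul_left, inner_grad_chartLin hy hm,
        hev.fderiv_eq]
      have := ((hasDerivAt_profile hε (D.trunc r₀ y)).comp_hasFDerivAt y hd.hasFDerivAt).sub_const
        (profile ε r₀)
      have e : fderiv ℝ (D.bump r₀ ε) y = _ := this.fderiv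
      rw [e]
      rfl
    rw [hg, norm_smul, h1, mul_one, norm_neg, Real.norm_eq_abs, sq_abs, div_pow]
    ring
  · have hle : ∀ z, 0 ≤ D.bump r₀ ε z := fun z =>
      sub_nonneg.2 (profile_le_profile hε (D.trunc_nonneg hr₀ z) (D.trunc_le z))
    have h0 : D.bump r₀ ε y = 0 := by
      rw [bump, le_antisymm (D.trunc_le y) (not_lt.1 h), sub_self]
    have hmin : IsLocalMin (D.bump r₀ ε) y := Eventually.of_forall fun z => by
      rw [h0]; exact hle z
    have hg : grad (chartExt p₀ (D.bump r₀ ε)) (φ.symm y) = 0 := by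
      refine eq_of_inner_chartLin hy fun w => ?_
      rw [inner_grad_chartExt hy, hmin.fderiv_eq_zero, inner_zero_left]
      rfl
    rw [hg]
    simp

/-- Rademacher's theorem for the truncated distance supplies differentiability almost everywhere in
the chart, the centre is a null set, and outside the chart ball the bubble is locally constant. -/
theorem ae_norm_sq_grad [MeasurableSpace M] [BorelSpace M] [CompactSpace M] (hr₀ : 0 < r₀)
    (hr : 4 * r₀ < D.ρ) {ε : ℝ} (hε : 0 < ε) :
    ∀ᵐ q ∂(vol M), ‖grad (chartExt p₀ (D.bump r₀ ε)) q‖ ^ 2 =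
      if truncDist p₀ r₀ q < r₀ then
        16 * truncDist p₀ r₀ q ^ 2 / (ε ^ 2 + truncDist p₀ r₀ q ^ 2) ^ 2 else 0 := by
  set φ := extChartAt (𝓡 2) p₀ with hφ
  set W := φ.source ∩ φ ⁻¹' Metric.ball (φ p₀) D.r with hW
  have hBm : MeasurableSet (Metric.ball (φ p₀) D.r) := Metric.isOpen_ball.measurableSet
  have hWm : MeasurableSet W := measurableSet_source_inter p₀ hBm
  rw [← Measure.restrict_univ (μ := vol M), ← union_compl_self W, ae_restrict_union_iff]
  constructor
  · refine ae_chart_of_ae p₀ hBm D.ball_subset ?_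
    filter_upwards [ae_restrict_mem hBm,
      ae_restrict_of_ae (D.lipschitzWith_trunc hr₀ hr).ae_differentiableAt,
      ae_restrict_of_ae (measure_eq_zero_iff_ae_notMem.1
        (measure_singleton (μ := (volume : Measure Plane)) (φ p₀)))] with y hy hd hya
    have hyt := D.ball_subset hy
    rw [D.norm_sq_grad_chartExt_bump hr₀ hε hyt hya hd (D.lipschitzWith_trunc hr₀ hr).continuous]
    have e : D.trunc r₀ y = truncDist p₀ r₀ (φ.symm y) := by
      rw [← D.trunc_extChartAt hr₀ hr (φ.map_target hyt), φ.right_inv hyt]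
    rw [e]
  · filter_upwards [ae_restrict_mem hWm.compl] with q hq
    rw [grad_eq_of_eventuallyEq (chartExt_eventuallyEq_zero (half_lt_self D.r_pos) D.ball_subset
      (fun y hy => D.bump_of_le hy) hq), grad_const, norm_zero, D.truncDist_of_notMem hr₀ hr,
      if_neg (lt_irrefl _), zero_pow two_ne_zero]
    rintro ⟨h1, h2⟩
    refine hq ⟨h1, D.mem_ball ?_⟩
    have h3 : D.rad (φ q) < 2 * r₀ := h2
    linarith

end DistChart

end

/-! ### The Dirichlet energy of the bubble. -/

section

variable {M : Type*} [TopologicalSpace M] [ChartedSpace Plane M] [IsManifold (𝓡 2) ∞ M]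
  [RiemannianBundle (fun x : M => TangentSpace (𝓡 2) x)]
  [IsContMDiffRiemannianBundle (𝓡 2) ∞ Plane (fun x : M => TangentSpace (𝓡 2) x)]
  [T2Space M] [MeasurableSpace M] [BorelSpace M]

theorem exp_profile {ε : ℝ} (hε : 0 < ε) (t : ℝ) :
    Real.exp (profile ε t) = ε ^ 2 / (ε ^ 2 + t ^ 2) ^ 2 :=
  Real.exp_log (by positivity)

namespace DistChart

variable {p₀ : M} (D : DistChart p₀) {r₀ : ℝ}

/-- The coordinate disk of radius `2 r₀`. -/
def disk (r₀ : ℝ) : Set Plane := {y | D.rad y < 2 * r₀}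

/-- The region of `M` covered by the coordinate disk of radius `2 r₀`. -/
def region (r₀ : ℝ) : Set M :=
  (extChartAt (𝓡 2) p₀).source ∩ extChartAt (𝓡 2) p₀ ⁻¹' D.disk r₀

theorem measurableSet_disk (r₀ : ℝ) : MeasurableSet (D.disk r₀) :=
  measurableSet_norm_lt D.A _ _

theorem measurableSet_region (r₀ : ℝ) : MeasurableSet (D.region r₀) :=
  measurableSet_source_inter p₀ (D.measurableSet_disk r₀)

/-- The determinant of the linear change of coordinates. -/
def det : ℝ := LinearMap.det (D.A : Plane →ₗ[ℝ] Plane)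

theorem det_pos' : 0 < D.det := D.det_pos

theorem rad_le_of_mem_disk (hr₀ : 0 < r₀) (hr : 4 * r₀ < D.ρ) {y : Plane} (hy : y ∈ D.disk r₀) :
    D.rad y ≤ D.ρ := by
  have : D.rad y < 2 * r₀ := hy
  linarith

theorem disk_subset_target (hr₀ : 0 < r₀) (hr : 4 * r₀ < D.ρ) :
    D.disk r₀ ⊆ (extChartAt (𝓡 2) p₀).target := fun _ hy =>
  D.mem_target (D.rad_le_of_mem_disk hr₀ hr hy)

theorem measurable_truncDist (hr₀ : 0 < r₀) (hr : 4 * r₀ < D.ρ) :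
    Measurable (truncDist p₀ r₀) := by
  classical
  have h : truncDist p₀ r₀ = (extChartAt (𝓡 2) p₀).source.piecewise
      (D.trunc r₀ ∘ extChartAt (𝓡 2) p₀) (fun _ => r₀) := by
    funext q
    by_cases hq : q ∈ (extChartAt (𝓡 2) p₀).source
    · rw [piecewise_eq_of_mem _ _ _ hq]
      exact (D.trunc_extChartAt hr₀ hr hq).symm
    · rw [piecewise_eq_of_notMem _ _ _ hq]
      exact D.truncDist_of_notMem hr₀ hr fun h => hq h.1
  rw [h]
  exact ((D.lipschitzWith_trunc hr₀ hr).continuous.comp_continuousOn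
    (continuousOn_extChartAt p₀)).measurable_piecewise continuousOn_const (measurableSet_source p₀)

theorem setIntegral_region (hr₀ : 0 < r₀) (hr : 4 * r₀ < D.ρ) {h : ℝ → ℝ} (hh : Measurable h) :
    ∫ q in D.region r₀, h (truncDist p₀ r₀ q) ∂(vol M) =
      ∫ y in D.disk r₀, dens p₀ y * h (D.trunc r₀ y) := by
  rw [region, integral_chart p₀ (D.measurableSet_disk r₀) (D.disk_subset_target hr₀ hr)
    (f := fun q => h (truncDist p₀ r₀ q)) (hh.comp (D.measurable_truncDist hr₀ hr)).aestronglyMeasurable]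
  refine setIntegral_congr_fun (D.measurableSet_disk r₀) fun y hy => ?_
  have hyt := D.disk_subset_target hr₀ hr hy
  change _ * h (truncDist p₀ r₀ ((extChartAt (𝓡 2) p₀).symm y)) = _
  rw [← D.trunc_extChartAt hr₀ hr ((extChartAt (𝓡 2) p₀).map_target hyt),
    (extChartAt (𝓡 2) p₀).right_inv hyt]

theorem setIntegral_compl_region (hr₀ : 0 < r₀) (hr : 4 * r₀ < D.ρ) (h : ℝ → ℝ) :
    ∫ q in (D.region r₀)ᶜ, h (truncDist p₀ r₀ q) ∂(vol M) =
      (vol M).real (D.region r₀)ᶜ * h r₀ := by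
  rw [setIntegral_congr_fun (g := fun _ => h r₀) (D.measurableSet_region r₀).compl
    fun q hq => by simp only [D.truncDist_of_notMem hr₀ hr hq], setIntegral_const, smul_eq_mul]

theorem trunc_bounds (hr₀ : 0 < r₀) (hr : 4 * r₀ < D.ρ) {y : Plane} (hy : y ∈ D.disk r₀) :
    D.rad y ≤ 2 * D.trunc r₀ y ∧ D.trunc r₀ y ≤ 2 * D.rad y := by
  have hy' : D.rad y < 2 * r₀ := hy
  have hρ := D.rad_le_of_mem_disk hr₀ hr hy
  obtain ⟨-, h1, h2⟩ := D.distTo_le y hρ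
  rw [D.trunc_of_le hρ]
  change _ ≤ 2 * D.rad y at h1
  change D.rad y ≤ _ at h2
  refine ⟨?_, (min_le_left _ _).trans h1⟩
  have : D.rad y / 2 ≤ min (distTo p₀ ((extChartAt (𝓡 2) p₀).symm y)) r₀ :=
    le_min (by linarith) (by linarith)
  linarith

theorem aestronglyMeasurable_dens_mul (hr₀ : 0 < r₀) (hr : 4 * r₀ < D.ρ) {h : ℝ → ℝ}
    (hh : Measurable h) :
    AEStronglyMeasurable (fun y => dens p₀ y * h (D.trunc r₀ y)) (volume.restrict (D.disk r₀)) := by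
  refine AEStronglyMeasurable.mul ?_
    (hh.comp (D.lipschitzWith_trunc hr₀ hr).continuous.measurable).aestronglyMeasurable
  exact (((continuousOn_dens p₀).mono (D.disk_subset_target hr₀ hr)).aestronglyMeasurable
    (D.measurableSet_disk r₀))

/-- The energy of the bubble, as an integral over the coordinate disk. -/
theorem dirichlet_bubbleV [CompactSpace M] (hr₀ : 0 < r₀) (hr : 4 * r₀ < D.ρ) {ε : ℝ}
    (hε : 0 < ε) :
    dirichlet (bubbleV p₀ r₀ ε) = ∫ y in D.disk r₀, dens p₀ y *
      (if D.trunc r₀ y < r₀ then 16 * D.trunc r₀ y ^ 2 / (ε ^ 2 + D.trunc r₀ y ^ 2) ^ 2 else 0) := by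
  set F : ℝ → ℝ := fun t => if t < r₀ then 16 * t ^ 2 / (ε ^ 2 + t ^ 2) ^ 2 else 0 with hF
  have hFm : Measurable F :=
    Measurable.ite measurableSet_Iio (by fun_prop) measurable_const
  rw [(D.hasWeakGrad_bubbleV hr₀ hr hε).dirichlet_eq,
    integral_congr_ae (D.ae_norm_sq_grad hr₀ hr hε)]
  change ∫ q, F (truncDist p₀ r₀ q) ∂(vol M) = ∫ y in D.disk r₀, dens p₀ y * F (D.trunc r₀ y)
  rw [← D.setIntegral_region hr₀ hr hFm,
    setIntegral_eq_integral_of_forall_compl_eq_zero fun q hq => ?_]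
  rw [D.truncDist_of_notMem hr₀ hr hq]
  simp [hF]

/-- The energy densities are of size O(1/σ²) at coordinate radius σ, while distance and volume
density carry relative errors O(σ), so the difference is O(1/σ) uniformly in ε. The term with 1/r₀
covers the part of the disk where the truncation is active: there σ ≥ r₀/2, so 1/σ² ≤ 2/(r₀σ). -/
theorem abs_energy_sub_le (hr₀ : 0 < r₀) (hr : 4 * r₀ < D.ρ) (ε : ℝ) {y : Plane}
    (hy : y ∈ D.disk r₀) :
    |dens p₀ y * (if D.trunc r₀ y < r₀ then
        16 * D.trunc r₀ y ^ 2 / (ε ^ 2 + D.trunc r₀ y ^ 2) ^ 2 else 0)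
      - D.det * (16 * D.rad y ^ 2 / (ε ^ 2 + D.rad y ^ 2) ^ 2)| ≤
      (192 * D.det * D.C + 16 * D.C + 32 * D.det / r₀) * (D.rad y)⁻¹ := by
  have hd0 := D.det_pos'
  have hC := D.C_nonneg
  have hρ := D.rad_le_of_mem_disk hr₀ hr hy
  obtain ⟨hb1, hb2⟩ := D.trunc_bounds hr₀ hr hy
  -- At the centre both densities vanish, so the bound holds with the convention 0⁻¹ = 0.
  rcases (D.rad_nonneg y).eq_or_lt with h0 | h0
  · have ht : D.trunc r₀ y = 0 := le_antisymm (by linarith) (D.trunc_nonneg hr₀ y)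
    rw [ht, ← h0]
    simp
  obtain ⟨he1, he2, -⟩ := D.dens_le y hρ
  change |_ - D.det| ≤ D.C * D.rad y at he1
  change _ ≤ 2 * D.det at he2
  have hden : 0 < dens p₀ y := dens_pos (D.mem_target hρ)
  set σ := D.rad y with hσ
  set τ := D.trunc r₀ y with hτ
  have hFσ := energy_density_le (ε := ε) h0
  have hFσ0 : 0 ≤ 16 * σ ^ 2 / (ε ^ 2 + σ ^ 2) ^ 2 := by positivity
  have e1 : 16 / σ ^ 2 = 16 * (σ⁻¹ * σ⁻¹) := by field_simp
  have hσi : 0 < σ⁻¹ := inv_pos.2 h0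
  split_ifs with hlt
  · have hτd : τ = distTo p₀ ((extChartAt (𝓡 2) p₀).symm y) := by
      rw [hτ, D.trunc_of_le hρ] at hlt ⊢
      rcases min_lt_iff.1 hlt with h1 | h1
      · exact min_eq_left h1.le
      · exact absurd h1 (lt_irrefl _)
    have hcl : |τ - σ| ≤ D.C * σ ^ 2 := by rw [hτd]; exact (D.distTo_le y hρ).1
    have h1 := abs_energy_density_sub_le (ε := ε) hC h0 hb1 hcl
    have e : dens p₀ y * (16 * τ ^ 2 / (ε ^ 2 + τ ^ 2) ^ 2)
        - D.det * (16 * σ ^ 2 / (ε ^ 2 + σ ^ 2) ^ 2) =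
        dens p₀ y * (16 * τ ^ 2 / (ε ^ 2 + τ ^ 2) ^ 2 - 16 * σ ^ 2 / (ε ^ 2 + σ ^ 2) ^ 2)
        + (dens p₀ y - D.det) * (16 * σ ^ 2 / (ε ^ 2 + σ ^ 2) ^ 2) := by ring
    rw [e]
    refine (abs_add_le _ _).trans ?_
    rw [abs_mul, abs_mul, abs_of_pos hden, abs_of_nonneg hFσ0]
    calc _ ≤ (2 * D.det) * (96 * D.C * σ⁻¹) + (D.C * σ) * (16 * (σ⁻¹ * σ⁻¹)) := by
          rw [← e1]
          gcongr
      _ = (192 * D.det * D.C + 16 * D.C) * σ⁻¹ := by field_simp; ring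
      _ ≤ _ := by
        refine mul_le_mul_of_nonneg_right ?_ hσi.le
        have : 0 ≤ 32 * D.det / r₀ := by positivity
        linarith
  · have hτ2 : τ = r₀ := le_antisymm (D.trunc_le y) (not_lt.1 hlt)
    rw [mul_zero, zero_sub, abs_neg, abs_of_nonneg (by positivity)]
    have h1 : σ⁻¹ ≤ 2 / r₀ := by
      rw [inv_le_comm₀ h0 (by positivity), inv_div]
      linarith
    calc _ ≤ D.det * (16 * (σ⁻¹ * σ⁻¹)) := by rw [← e1]; gcongr
      _ ≤ D.det * (16 * (2 / r₀ * σ⁻¹)) := by gcongr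
      _ = 32 * D.det / r₀ * σ⁻¹ := by ring
      _ ≤ _ := by
        gcongr
        have : 0 ≤ 192 * D.det * D.C + 16 * D.C := by positivity
        linarith

/-- The pointwise error has an integrable majorant independent of ε, and the Euclidean radial energy
is explicit; its remaining terms are bounded for ε ≤ 1. -/
theorem exists_abs_dirichlet_sub_le [CompactSpace M] (hr₀ : 0 < r₀) (hr : 4 * r₀ < D.ρ) :
    ∃ K, ∀ ε, 0 < ε → ε ≤ 1 →
      |dirichlet (bubbleV p₀ r₀ ε) - 32 * Real.pi * Real.log (1 / ε)| ≤ K := by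
  set E := 192 * D.det * D.C + 16 * D.C + 32 * D.det / r₀ with hE
  have hR : 0 < 2 * r₀ := by positivity
  have hinv : IntegrableOn (fun y => E * (D.rad y)⁻¹) (D.disk r₀) :=
    (integrableOn_inv_radial D.det_pos (extChartAt (𝓡 2) p₀ p₀) (2 * r₀)).const_mul E
  refine ⟨(∫ y in D.disk r₀, E * (D.rad y)⁻¹) + 16 * Real.pi *
    (|Real.log ((2 * r₀) ^ 2)| + |Real.log (1 + (2 * r₀) ^ 2)| + 1), fun ε hε hε1 => ?_⟩
  obtain ⟨hi, hint⟩ := integral_radial_energy D.det_pos (extChartAt (𝓡 2) p₀ p₀) hR hε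
  change IntegrableOn (fun y => 16 * D.rad y ^ 2 / (ε ^ 2 + D.rad y ^ 2) ^ 2) (D.disk r₀) at hi
  change D.det * ∫ y in D.disk r₀, 16 * D.rad y ^ 2 / (ε ^ 2 + D.rad y ^ 2) ^ 2 = _ at hint
  set F : ℝ → ℝ := fun t => if t < r₀ then 16 * t ^ 2 / (ε ^ 2 + t ^ 2) ^ 2 else 0 with hF
  have hFm : Measurable F :=
    Measurable.ite measurableSet_Iio (by fun_prop) measurable_const
  have hcmp : ∀ᵐ y ∂(volume.restrict (D.disk r₀)),
      ‖dens p₀ y * F (D.trunc r₀ y) - D.det * (16 * D.rad y ^ 2 / (ε ^ 2 + D.rad y ^ 2) ^ 2)‖ ≤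
        E * (D.rad y)⁻¹ := by
    filter_upwards [ae_restrict_mem (D.measurableSet_disk r₀)] with y hy
    exact D.abs_energy_sub_le hr₀ hr ε hy
  have hi' := hi.const_mul D.det
  have hfi : Integrable (fun y => dens p₀ y * F (D.trunc r₀ y)) (volume.restrict (D.disk r₀)) := by
    have h1 : Integrable (fun y => dens p₀ y * F (D.trunc r₀ y)
        - D.det * (16 * D.rad y ^ 2 / (ε ^ 2 + D.rad y ^ 2) ^ 2)) (volume.restrict (D.disk r₀)) :=
      Integrable.mono' hinv ((D.aestronglyMeasurable_dens_mul hr₀ hr hFm).sub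
        hi'.aestronglyMeasurable) hcmp
    refine (h1.add hi').congr (Eventually.of_forall fun y => ?_)
    simp only [Pi.add_apply, sub_add_cancel]
  have h1 := norm_integral_le_of_norm_le hinv hcmp
  rw [integral_sub hfi hi', integral_const_mul, hint, Real.norm_eq_abs] at h1
  rw [D.dirichlet_bubbleV hr₀ hr hε]
  change |(∫ y in D.disk r₀, dens p₀ y * F (D.trunc r₀ y)) - _| ≤ _
  have hl1 : Real.log (1 / ε) = -Real.log ε := by rw [one_div, Real.log_inv]
  have hl2 : Real.log ((2 * r₀) ^ 2) ≤ Real.log (ε ^ 2 + (2 * r₀) ^ 2) :=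
    Real.log_le_log (by positivity) (by linarith [sq_nonneg ε])
  have hl3 : Real.log (ε ^ 2 + (2 * r₀) ^ 2) ≤ Real.log (1 + (2 * r₀) ^ 2) :=
    Real.log_le_log (by positivity) (by nlinarith)
  have hq0 : 0 ≤ ε ^ 2 / (ε ^ 2 + (2 * r₀) ^ 2) := by positivity
  have hq1 : ε ^ 2 / (ε ^ 2 + (2 * r₀) ^ 2) ≤ 1 := by
    rw [div_le_one (by positivity)]
    linarith [sq_nonneg (2 * r₀)]
  have hcorr : |16 * Real.pi * (Real.log (ε ^ 2 + (2 * r₀) ^ 2) - 2 * Real.log ε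
      + ε ^ 2 / (ε ^ 2 + (2 * r₀) ^ 2) - 1) - 32 * Real.pi * Real.log (1 / ε)| ≤
      16 * Real.pi * (|Real.log ((2 * r₀) ^ 2)| + |Real.log (1 + (2 * r₀) ^ 2)| + 1) := by
    have e : 16 * Real.pi * (Real.log (ε ^ 2 + (2 * r₀) ^ 2) - 2 * Real.log ε
      + ε ^ 2 / (ε ^ 2 + (2 * r₀) ^ 2) - 1) - 32 * Real.pi * Real.log (1 / ε) =
      16 * Real.pi * (Real.log (ε ^ 2 + (2 * r₀) ^ 2) + ε ^ 2 / (ε ^ 2 + (2 * r₀) ^ 2) - 1) := by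
      rw [hl1]; ring
    rw [e, abs_mul, abs_of_pos (by positivity : 0 < 16 * Real.pi)]
    refine mul_le_mul_of_nonneg_left ?_ (by positivity)
    have a1 := neg_abs_le (Real.log ((2 * r₀) ^ 2))
    have a2 := le_abs_self (Real.log (1 + (2 * r₀) ^ 2))
    have a3 := abs_nonneg (Real.log ((2 * r₀) ^ 2))
    have a4 := abs_nonneg (Real.log (1 + (2 * r₀) ^ 2))
    rw [abs_le]
    constructor <;> linarith
  exact (abs_sub_le _ _ _).trans (add_le_add h1 hcorr)

theorem integral_eq_add [CompactSpace M] (hr₀ : 0 < r₀) (hr : 4 * r₀ < D.ρ) {h : ℝ → ℝ}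
    (hh : Measurable h) (hi : Integrable (fun q => h (truncDist p₀ r₀ q)) (vol M)) :
    ∫ q, h (truncDist p₀ r₀ q) ∂(vol M) =
      (∫ y in D.disk r₀, dens p₀ y * h (D.trunc r₀ y)) + (vol M).real (D.region r₀)ᶜ * h r₀ := by
  rw [← integral_add_compl (D.measurableSet_region r₀) hi, D.setIntegral_region hr₀ hr hh,
    D.setIntegral_compl_region hr₀ hr h]

theorem integrable_comp_truncDist [CompactSpace M] (hr₀ : 0 < r₀) (hr : 4 * r₀ < D.ρ) {h : ℝ → ℝ}
    (hh : Continuous h) : Integrable (fun q => h (truncDist p₀ r₀ q)) (vol M) := by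
  obtain ⟨c, hc⟩ := isCompact_Icc.exists_bound_of_continuousOn (s := Icc 0 r₀) hh.continuousOn
  exact Integrable.of_bound (hh.measurable.comp (D.measurable_truncDist hr₀ hr)).aestronglyMeasurable
    c (Eventually.of_forall fun q => hc _ ⟨truncDist_nonneg hr₀ p₀ q, truncDist_le hr₀ p₀ q⟩)

end DistChart

end

/-! ### The mean and the exponential integrals of the bubble. -/

section

variable {M : Type*} [TopologicalSpace M] [ChartedSpace Plane M] [IsManifold (𝓡 2) ∞ M]
  [RiemannianBundle (fun x : M => TangentSpace (𝓡 2) x)]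
  [IsContMDiffRiemannianBundle (𝓡 2) ∞ Plane (fun x : M => TangentSpace (𝓡 2) x)]
  [T2Space M] [MeasurableSpace M] [BorelSpace M] [CompactSpace M]

namespace DistChart

variable {p₀ : M} (D : DistChart p₀) {r₀ : ℝ}

/-- The bound from below comes from ln(1/t) ≤ 1/t − 1. The majorant is crude, but independent of ε
and integrable in the plane, which is all the mean requires. -/
theorem abs_log_le {ε t r₀ : ℝ} (hε : 0 < ε) (hε1 : ε ≤ 1) (ht : 0 < t) (htr : t ≤ r₀) :
    |Real.log (ε ^ 2 + t ^ 2)| ≤ r₀ ^ 2 + 2 * t⁻¹ := by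
  have hti : 0 < t⁻¹ := inv_pos.2 ht
  rw [abs_le]
  constructor
  · have h1 : Real.log (t ^ 2) ≤ Real.log (ε ^ 2 + t ^ 2) :=
      Real.log_le_log (by positivity) (by linarith [sq_nonneg ε])
    have h2 : Real.log t⁻¹ ≤ t⁻¹ - 1 := Real.log_le_sub_one_of_pos hti
    rw [Real.log_inv] at h2
    rw [Real.log_pow] at h1
    push_cast at h1
    nlinarith [sq_nonneg r₀]
  · have h1 := Real.log_le_sub_one_of_pos (by positivity : 0 < ε ^ 2 + t ^ 2)
    have h2 : t ^ 2 ≤ r₀ ^ 2 := by gcongr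
    have h3 : ε ^ 2 ≤ 1 := pow_le_one₀ hε.le hε1
    linarith

theorem integrableOn_const_disk (r₀ c : ℝ) : IntegrableOn (fun _ => c) (D.disk r₀) :=
  integrableOn_radial D.det_pos (extChartAt (𝓡 2) p₀ p₀) (h := fun _ => c) (R := 2 * r₀)
    ((Continuous.integrableOn_Icc (by fun_prop)).mono_set Ioo_subset_Icc_self)

/-- The mean of the bubble. -/
theorem exists_abs_integral_bubbleV_sub_le (hr₀ : 0 < r₀) (hr : 4 * r₀ < D.ρ) :
    ∃ K, ∀ ε, 0 < ε → ε ≤ 1 →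
      |∫ q, bubbleV p₀ r₀ ε q ∂(vol M) - 2 * area M * Real.log ε| ≤ K := by
  have hd0 := D.det_pos'
  have hinv : IntegrableOn (fun y => 2 * D.det * (r₀ ^ 2 + 4 * (D.rad y)⁻¹)) (D.disk r₀) := by
    refine Integrable.const_mul (Integrable.add ?_
      ((integrableOn_inv_radial D.det_pos (extChartAt (𝓡 2) p₀ p₀) (2 * r₀)).const_mul 4)) _
    exact D.integrableOn_const_disk r₀ _
  refine ⟨2 * ((∫ y in D.disk r₀, 2 * D.det * (r₀ ^ 2 + 4 * (D.rad y)⁻¹)) +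
    (vol M).real (D.region r₀)ᶜ * (r₀ ^ 2 + 2 * r₀⁻¹)), fun ε hε hε1 => ?_⟩
  set h : ℝ → ℝ := fun t => Real.log (ε ^ 2 + t ^ 2) with hh
  have hc : Continuous h := Continuous.log (by fun_prop) fun t => by positivity
  have hi := D.integrable_comp_truncDist hr₀ hr hc
  have e : ∫ q, bubbleV p₀ r₀ ε q ∂(vol M) =
      2 * area M * Real.log ε - 2 * ∫ q, h (truncDist p₀ r₀ q) ∂(vol M) := by
    simp only [bubbleV_eq, profile_eq hε]
    rw [integral_sub (integrable_const _) (hi.const_mul 2), integral_const, integral_const_mul,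
      smul_eq_mul, area]
    ring
  rw [e, sub_sub_cancel_left, abs_neg, abs_mul, abs_of_pos (by norm_num : (0 : ℝ) < 2),
    D.integral_eq_add hr₀ hr hc.measurable hi]
  refine mul_le_mul_of_nonneg_left ((abs_add_le _ _).trans (add_le_add ?_ ?_)) zero_le_two
  · rw [← Real.norm_eq_abs]
    refine norm_integral_le_of_norm_le hinv ?_
    filter_upwards [ae_restrict_mem (D.measurableSet_disk r₀),
      ae_restrict_of_ae (measure_eq_zero_iff_ae_notMem.1
        (measure_singleton (μ := (volume : Measure Plane)) (extChartAt (𝓡 2) p₀ p₀)))] with y hy hya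
    have hρ := D.rad_le_of_mem_disk hr₀ hr hy
    have hden : 0 < dens p₀ y := dens_pos (D.mem_target hρ)
    have h2 : 0 < D.rad y := norm_pos_iff.2 fun h0 =>
      hya (sub_eq_zero.1 ((map_eq_zero_iff D.A D.A.injective).1 h0))
    obtain ⟨hb1, hb2⟩ := D.trunc_bounds hr₀ hr hy
    have ht : 0 < D.trunc r₀ y := by linarith
    rw [norm_mul, Real.norm_eq_abs, Real.norm_eq_abs, abs_of_pos hden]
    have h3 : (D.trunc r₀ y)⁻¹ ≤ 2 * (D.rad y)⁻¹ := by
      rw [← div_eq_mul_inv, inv_le_comm₀ ht (by positivity), inv_div]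
      linarith
    have h4 := abs_log_le hε hε1 ht (D.trunc_le y)
    have h5 : dens p₀ y ≤ 2 * D.det := (D.dens_le y hρ).2.1
    gcongr
    change |Real.log _| ≤ _
    linarith
  · rw [abs_mul, abs_of_nonneg measureReal_nonneg]
    gcongr
    exact abs_log_le hε hε1 hr₀ le_rfl

/-- The mass of the bubble is bounded and bounded away from zero. -/
theorem exists_integral_exp_bubbleV_mem_Icc (hr₀ : 0 < r₀) (hr : 4 * r₀ < D.ρ) :
    ∃ c K : ℝ, 0 < c ∧ ∀ ε, 0 < ε → ε ≤ 1 → ε ≤ 2 * r₀ →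
      ∫ q, Real.exp (bubbleV p₀ r₀ ε q) ∂(vol M) ∈ Icc c K := by
  have hd0 := D.det_pos'
  have hR : 0 < 2 * r₀ := by positivity
  -- Radii comparable within a factor 2 change the integrand by at most 16 and the densities differ
  -- by at most 2, which gives 32; the condition ε ≤ 2r₀ leaves at least half of the mass π.
  refine ⟨Real.pi / 64, 32 * Real.pi + (vol M).real (D.region r₀)ᶜ * (1 / r₀ ^ 4), by positivity,
    fun ε hε hε1 hεr => ?_⟩
  set h : ℝ → ℝ := fun t => ε ^ 2 / (ε ^ 2 + t ^ 2) ^ 2 with hh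
  have hc : Continuous h := Continuous.div (by fun_prop) (by fun_prop) fun t => by positivity
  have hi := D.integrable_comp_truncDist hr₀ hr hc
  obtain ⟨hm, hint⟩ := integral_radial_mass D.det_pos (extChartAt (𝓡 2) p₀ p₀) hR hε
  change IntegrableOn (fun y => h (D.rad y)) (D.disk r₀) at hm
  change D.det * ∫ y in D.disk r₀, h (D.rad y) = _ at hint
  have hpos : ∀ t, 0 ≤ h t := fun t => by positivity
  have hbd : ∀ y ∈ D.disk r₀, D.det / 32 * h (D.rad y) ≤ dens p₀ y * h (D.trunc r₀ y) ∧
      dens p₀ y * h (D.trunc r₀ y) ≤ 32 * D.det * h (D.rad y) := by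
    intro y hy
    have hρ := D.rad_le_of_mem_disk hr₀ hr hy
    obtain ⟨hb1, hb2⟩ := D.trunc_bounds hr₀ hr hy
    obtain ⟨-, hd1, hd2⟩ := D.dens_le y hρ
    change _ ≤ 2 * D.det at hd1
    change D.det ≤ _ at hd2
    have hs0 := D.rad_nonneg y
    have ht0 := D.trunc_nonneg hr₀ y
    have hε2 := sq_nonneg ε
    have hden : 0 < dens p₀ y := dens_pos (D.mem_target hρ)
    have q1 : D.rad y ^ 2 ≤ 4 * D.trunc r₀ y ^ 2 := by nlinarith only [hb1, hs0, ht0]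
    have q2 : D.trunc r₀ y ^ 2 ≤ 4 * D.rad y ^ 2 := by nlinarith only [hb2, hs0, ht0]
    have k1 : h (D.rad y) / 16 ≤ h (D.trunc r₀ y) := by
      simp only [hh]
      rw [div_div]
      refine div_le_div_of_nonneg_left hε2 (by positivity) ?_
      have : ε ^ 2 + D.trunc r₀ y ^ 2 ≤ 4 * (ε ^ 2 + D.rad y ^ 2) := by linarith
      calc _ ≤ (4 * (ε ^ 2 + D.rad y ^ 2)) ^ 2 := by gcongr
        _ = _ := by ring
    have k2 : h (D.trunc r₀ y) / 16 ≤ h (D.rad y) := by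
      simp only [hh]
      rw [div_div]
      refine div_le_div_of_nonneg_left hε2 (by positivity) ?_
      have : ε ^ 2 + D.rad y ^ 2 ≤ 4 * (ε ^ 2 + D.trunc r₀ y ^ 2) := by linarith
      calc _ ≤ (4 * (ε ^ 2 + D.trunc r₀ y ^ 2)) ^ 2 := by gcongr
        _ = _ := by ring
    have p1 := hpos (D.rad y)
    have p2 := hpos (D.trunc r₀ y)
    constructor
    · calc D.det / 32 * h (D.rad y) = D.det / 2 * (h (D.rad y) / 16) := by ring
        _ ≤ dens p₀ y * h (D.trunc r₀ y) := by
          refine mul_le_mul (by linarith) k1 (by positivity) hden.le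
    · calc dens p₀ y * h (D.trunc r₀ y) ≤ (2 * D.det) * (16 * h (D.rad y)) := by
            refine mul_le_mul hd1 (by linarith) p2 (by positivity)
        _ = _ := by ring
  have hfi : IntegrableOn (fun y => dens p₀ y * h (D.trunc r₀ y)) (D.disk r₀) := by
    refine Integrable.mono' (hm.const_mul (32 * D.det))
      (D.aestronglyMeasurable_dens_mul hr₀ hr hc.measurable) ?_
    filter_upwards [ae_restrict_mem (D.measurableSet_disk r₀)] with y hy
    have hden : 0 < dens p₀ y := dens_pos (D.mem_target (D.rad_le_of_mem_disk hr₀ hr hy))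
    rw [Real.norm_of_nonneg (mul_nonneg hden.le (hpos _))]
    exact (hbd y hy).2
  have hlow := setIntegral_mono_on (hm.const_mul (D.det / 32)) hfi (D.measurableSet_disk r₀)
    fun y hy => (hbd y hy).1
  have hupp := setIntegral_mono_on hfi (hm.const_mul (32 * D.det)) (D.measurableSet_disk r₀)
    fun y hy => (hbd y hy).2
  rw [integral_const_mul] at hlow hupp
  have hq : ε ^ 2 / (ε ^ 2 + (2 * r₀) ^ 2) ≤ 1 / 2 := by
    rw [div_le_div_iff₀ (by positivity) two_pos]
    nlinarith
  have hq0 : 0 ≤ ε ^ 2 / (ε ^ 2 + (2 * r₀) ^ 2) := by positivity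
  have hpi := Real.pi_pos
  have e : ∫ q, Real.exp (bubbleV p₀ r₀ ε q) ∂(vol M) =
      ∫ q, h (truncDist p₀ r₀ q) ∂(vol M) := by
    simp only [bubbleV_eq, exp_profile hε, hh]
  rw [e, D.integral_eq_add hr₀ hr hc.measurable hi]
  have hv : 0 ≤ (vol M).real (D.region r₀)ᶜ := measureReal_nonneg
  have hl : D.det / 32 * ∫ y in D.disk r₀, h (D.rad y) =
      Real.pi / 32 * (1 - ε ^ 2 / (ε ^ 2 + (2 * r₀) ^ 2)) := by
    rw [div_mul_eq_mul_div, hint]; ring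
  have hu : 32 * D.det * ∫ y in D.disk r₀, h (D.rad y) =
      32 * Real.pi * (1 - ε ^ 2 / (ε ^ 2 + (2 * r₀) ^ 2)) := by
    rw [mul_assoc, hint]; ring
  rw [hl] at hlow
  rw [hu] at hupp
  constructor
  · have := mul_nonneg hv (hpos r₀)
    nlinarith
  · have h1 : h r₀ ≤ 1 / r₀ ^ 4 := by
      simp only [hh]
      rw [div_le_div_iff₀ (by positivity) (by positivity), one_mul]
      have : ε ^ 2 ≤ 1 := pow_le_one₀ hε.le hε1
      calc ε ^ 2 * r₀ ^ 4 ≤ 1 * r₀ ^ 4 := by gcongr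
        _ = (r₀ ^ 2) ^ 2 := by ring
        _ ≤ _ := by gcongr; linarith [sq_nonneg ε]
    refine add_le_add ?_ (mul_le_mul_of_nonneg_left h1 hv)
    nlinarith

/-- Since ε² e^{−v} = (ε² + t²)² with `t` the truncated distance, the integral lies between its
value at ε = 0, positive because t > 0 off the centre, and the bound from ε ≤ 1, t ≤ r₀. -/
theorem exists_integral_exp_neg_bubbleV_mem_Icc (hr₀ : 0 < r₀) (hr : 4 * r₀ < D.ρ) :
    ∃ c K : ℝ, 0 < c ∧ ∀ ε, 0 < ε → ε ≤ 1 →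
      ε ^ 2 * ∫ q, Real.exp (-bubbleV p₀ r₀ ε q) ∂(vol M) ∈ Icc c K := by
  have hd0 := D.det_pos'
  have hi : ∀ ε : ℝ, Integrable (fun q => (ε ^ 2 + truncDist p₀ r₀ q ^ 2) ^ 2) (vol M) := fun ε =>
    D.integrable_comp_truncDist hr₀ hr (h := fun t => (ε ^ 2 + t ^ 2) ^ 2) (by fun_prop)
  have hpos : 0 < ∫ q, (0 ^ 2 + truncDist p₀ r₀ q ^ 2) ^ 2 ∂(vol M) := by
    set h : ℝ → ℝ := fun t => (0 ^ 2 + t ^ 2) ^ 2 with hh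
    have hc : Continuous h := by fun_prop
    have hh0 : ∀ t, 0 ≤ h t := fun t => by positivity
    change 0 < ∫ q, h (truncDist p₀ r₀ q) ∂(vol M)
    rw [D.integral_eq_add hr₀ hr hc.measurable (hi 0)]
    refine add_pos_of_pos_of_nonneg ?_ (mul_nonneg measureReal_nonneg (hh0 _))
    have hfi : IntegrableOn (fun y => dens p₀ y * h (D.trunc r₀ y)) (D.disk r₀) := by
      refine Integrable.mono' (D.integrableOn_const_disk r₀ (2 * D.det * h r₀))
        (D.aestronglyMeasurable_dens_mul hr₀ hr hc.measurable) ?_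
      filter_upwards [ae_restrict_mem (D.measurableSet_disk r₀)] with y hy
      have hρ := D.rad_le_of_mem_disk hr₀ hr hy
      have hden : 0 < dens p₀ y := dens_pos (D.mem_target hρ)
      rw [Real.norm_of_nonneg (mul_nonneg hden.le (hh0 _))]
      have ht0 := D.trunc_nonneg hr₀ y
      have ht1 := D.trunc_le (r₀ := r₀) y
      have hd1 : dens p₀ y ≤ 2 * D.det := (D.dens_le y hρ).2.1
      refine mul_le_mul hd1 ?_ (hh0 _) (by positivity)
      simp only [hh]
      gcongr
    rw [setIntegral_pos_iff_support_of_nonneg_ae ?_ hfi]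
    · have hopen : IsOpen (D.disk r₀ \ {extChartAt (𝓡 2) p₀ p₀}) :=
        (isOpen_lt (D.A.continuous.comp (continuous_id.sub continuous_const)).norm
          continuous_const).sdiff isClosed_singleton
      have hsub : D.disk r₀ \ {extChartAt (𝓡 2) p₀ p₀} ⊆
          (Function.support fun y => dens p₀ y * h (D.trunc r₀ y)) ∩ D.disk r₀ := by
        rintro y ⟨hy, hya⟩
        refine ⟨?_, hy⟩
        have hden : 0 < dens p₀ y := dens_pos (D.mem_target (D.rad_le_of_mem_disk hr₀ hr hy))
        have h2 : 0 < D.rad y := norm_pos_iff.2 fun h0 =>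
          hya (sub_eq_zero.1 ((map_eq_zero_iff D.A D.A.injective).1 h0))
        have ht : 0 < D.trunc r₀ y := by linarith [(D.trunc_bounds hr₀ hr hy).1]
        have : 0 < h (D.trunc r₀ y) := by positivity
        exact (mul_pos hden this).ne'
      refine lt_of_lt_of_le (hopen.measure_pos _ ?_) (measure_mono hsub)
      refine ⟨extChartAt (𝓡 2) p₀ p₀ + D.A.symm (EuclideanSpace.single 0 r₀), ?_, ?_⟩
      · change ‖D.A (_ - _)‖ < _
        rw [add_sub_cancel_left, D.A.apply_symm_apply, PiLp.norm_single, Real.norm_of_nonneg hr₀.le]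
        linarith
      · simp [hr₀.ne']
    · filter_upwards [ae_restrict_mem (D.measurableSet_disk r₀)] with y hy
      exact mul_nonneg (dens_pos (D.mem_target (D.rad_le_of_mem_disk hr₀ hr hy))).le (hh0 _)
  refine ⟨_, (1 + r₀ ^ 2) ^ 2 * area M, hpos, fun ε hε hε1 => ?_⟩
  have e : ε ^ 2 * ∫ q, Real.exp (-bubbleV p₀ r₀ ε q) ∂(vol M) =
      ∫ q, (ε ^ 2 + truncDist p₀ r₀ q ^ 2) ^ 2 ∂(vol M) := by
    rw [← integral_const_mul]
    refine integral_congr_ae (Eventually.of_forall fun q => ?_)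
    simp only [bubbleV_eq, Real.exp_neg, exp_profile hε, inv_div]
    field_simp
  rw [e]
  constructor
  · refine integral_mono (hi 0) (hi ε) fun q => ?_
    change (0 ^ 2 + _) ^ 2 ≤ (_ + _) ^ 2
    gcongr
  · have h1 : ∫ q, (ε ^ 2 + truncDist p₀ r₀ q ^ 2) ^ 2 ∂(vol M) ≤
        ∫ _, (1 + r₀ ^ 2) ^ 2 ∂(vol M) := by
      refine integral_mono (hi ε) (integrable_const _) fun q => ?_
      have h1 := truncDist_le hr₀ p₀ q
      have h2 := truncDist_nonneg hr₀ p₀ q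
      have : ε ^ 2 ≤ 1 := pow_le_one₀ hε.le hε1
      change (_ + _) ^ 2 ≤ (_ + _) ^ 2
      gcongr
    rw [integral_const, smul_eq_mul, mul_comm] at h1
    exact h1

end DistChart

end

/-! ### Expansion of the functional along bubbles, and unboundedness below. -/

section

variable {M : Type*} [TopologicalSpace M] [ChartedSpace Plane M] [IsManifold (𝓡 2) ∞ M]
  [RiemannianBundle (fun x : M => TangentSpace (𝓡 2) x)]
  [IsContMDiffRiemannianBundle (𝓡 2) ∞ Plane (fun x : M => TangentSpace (𝓡 2) x)]
  [T2Space M] [MeasurableSpace M] [BorelSpace M] [CompactSpace M]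

variable {p₀ : M} {r₀ : ℝ}

theorem memE_bubble (D : DistChart p₀) (hA : 0 < area M) (hr₀ : 0 < r₀) (hr : 4 * r₀ < D.ρ) {ε : ℝ}
    (hε : 0 < ε) : MemE (bubble p₀ r₀ ε) := by
  have h := D.hasWeakGrad_bubbleV hr₀ hr hε
  refine ⟨⟨_, h.sub_const _⟩, ?_⟩
  have hi : Integrable (bubbleV p₀ r₀ ε) (vol M) := h.memLp.integrable (by norm_num)
  unfold bubble
  rw [integral_sub hi (integrable_const _), integral_const, smul_eq_mul]
  change _ - area M * _ = 0
  field_simp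
  ring

theorem dirichlet_bubble (D : DistChart p₀) (hr₀ : 0 < r₀) (hr : 4 * r₀ < D.ρ) {ε : ℝ}
    (hε : 0 < ε) : dirichlet (bubble p₀ r₀ ε) = dirichlet (bubbleV p₀ r₀ ε) := by
  have h := D.hasWeakGrad_bubbleV hr₀ hr hε
  rw [h.dirichlet_eq]
  exact (h.sub_const _).dirichlet_eq

/-- The subtracted mean, 2 ln ε + O(1), factors out of the exponential. Here it contributes 2
ln(1/ε); in the counterpart for −u it enters with the opposite sign and cancels the growth ε⁻² of
∫e^{−v}. -/
theorem log_mean_exp_bubble {p₀ : M} {r₀ ε : ℝ} (hA : 0 < area M)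
    (hP : 0 < ∫ q, Real.exp (bubbleV p₀ r₀ ε q) ∂(vol M)) :
    Real.log (1 / area M * ∫ q, Real.exp (bubble p₀ r₀ ε q) ∂(vol M)) =
      Real.log (∫ q, Real.exp (bubbleV p₀ r₀ ε q) ∂(vol M)) - Real.log (area M)
        - 1 / area M * ∫ q, bubbleV p₀ r₀ ε q ∂(vol M) := by
  simp only [bubble, sub_eq_add_neg, Real.exp_add]
  rw [integral_mul_const, Real.log_mul (by positivity) (by positivity),
    Real.log_mul (by positivity) (by positivity), Real.log_exp, one_div, Real.log_inv]
  ring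

theorem log_mean_exp_neg_bubble {p₀ : M} {r₀ ε : ℝ} (hA : 0 < area M)
    (hP : 0 < ∫ q, Real.exp (-bubbleV p₀ r₀ ε q) ∂(vol M)) :
    Real.log (1 / area M * ∫ q, Real.exp (-bubble p₀ r₀ ε q) ∂(vol M)) =
      Real.log (∫ q, Real.exp (-bubbleV p₀ r₀ ε q) ∂(vol M)) - Real.log (area M)
        + 1 / area M * ∫ q, bubbleV p₀ r₀ ε q ∂(vol M) := by
  simp only [bubble, sub_eq_add_neg, neg_add_rev, neg_neg, Real.exp_add]
  rw [integral_const_mul, Real.log_mul (by positivity) (by positivity),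
    Real.log_mul (by positivity) (by positivity), Real.log_exp, one_div, Real.log_inv]
  ring

theorem abs_log_le_of_mem_Icc {c K t : ℝ} (hc : 0 < c) (ht : t ∈ Icc c K) :
    |Real.log t| ≤ |Real.log c| + |Real.log K| := by
  have h1 := Real.log_le_log hc ht.1
  have h2 := Real.log_le_log (hc.trans_le ht.1) ht.2
  have a1 := neg_abs_le (Real.log c)
  have a2 := le_abs_self (Real.log K)
  have a3 := abs_nonneg (Real.log c)
  have a4 := abs_nonneg (Real.log K)
  rw [abs_le]
  constructor <;> linarith

/-- The ingredients of the functional along the bubbles. -/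
theorem exists_bubble_bounds (D : DistChart p₀) (hA : 0 < area M) (hr₀ : 0 < r₀)
    (hr : 4 * r₀ < D.ρ) :
    ∃ K, ∀ᶠ ε in 𝓝[>] (0 : ℝ),
      |dirichlet (bubble p₀ r₀ ε) - 32 * Real.pi * Real.log (1 / ε)| ≤ K ∧
      |Real.log (1 / area M * ∫ q, Real.exp (bubble p₀ r₀ ε q) ∂(vol M))
        - 2 * Real.log (1 / ε)| ≤ K ∧
      |Real.log (1 / area M * ∫ q, Real.exp (-bubble p₀ r₀ ε q) ∂(vol M))| ≤ K := by
  obtain ⟨K₁, h₁⟩ := D.exists_abs_dirichlet_sub_le hr₀ hr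
  obtain ⟨K₂, h₂⟩ := D.exists_abs_integral_bubbleV_sub_le hr₀ hr
  obtain ⟨c₃, K₃, hc₃, h₃⟩ := D.exists_integral_exp_bubbleV_mem_Icc hr₀ hr
  obtain ⟨c₄, K₄, hc₄, h₄⟩ := D.exists_integral_exp_neg_bubbleV_mem_Icc hr₀ hr
  set L := |Real.log (area M)| with hL
  set K := K₁ + (|Real.log c₃| + |Real.log K₃| + L + K₂ / area M) +
    (|Real.log c₄| + |Real.log K₄| + L + K₂ / area M) with hK
  refine ⟨K, ?_⟩
  filter_upwards [Ioo_mem_nhdsGT (lt_min one_pos (by positivity : 0 < 2 * r₀))] with ε hε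
  have hε0 : 0 < ε := hε.1
  have hε1 : ε ≤ 1 := hε.2.le.trans (min_le_left _ _)
  have hε2 : ε ≤ 2 * r₀ := hε.2.le.trans (min_le_right _ _)
  have b₁ := h₁ ε hε0 hε1
  have b₂ := h₂ ε hε0 hε1
  have b₃ := h₃ ε hε0 hε1 hε2
  have b₄ := h₄ ε hε0 hε1
  have hP : 0 < ∫ q, Real.exp (bubbleV p₀ r₀ ε q) ∂(vol M) := hc₃.trans_le b₃.1
  have hN' := hc₄.trans_le b₄.1
  have hN : 0 < ∫ q, Real.exp (-bubbleV p₀ r₀ ε q) ∂(vol M) :=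
    pos_of_mul_pos_right hN' (by positivity)
  have l₃ := abs_log_le_of_mem_Icc hc₃ b₃
  have l₄ := abs_log_le_of_mem_Icc hc₄ b₄
  rw [Real.log_mul (by positivity) hN.ne', Real.log_pow] at l₄
  push_cast at l₄
  have hm : |1 / area M * ∫ q, bubbleV p₀ r₀ ε q ∂(vol M) - 2 * Real.log ε| ≤ K₂ / area M := by
    have e : 1 / area M * ∫ q, bubbleV p₀ r₀ ε q ∂(vol M) - 2 * Real.log ε =
        (∫ q, bubbleV p₀ r₀ ε q ∂(vol M) - 2 * area M * Real.log ε) / area M := by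
      field_simp
    rw [e, abs_div, abs_of_pos hA]
    gcongr
  have hK₁ : 0 ≤ K₁ := (abs_nonneg _).trans b₁
  have hK₂ : 0 ≤ K₂ / area M := (abs_nonneg _).trans hm
  have a₁ := abs_nonneg (Real.log c₃)
  have a₂ := abs_nonneg (Real.log K₃)
  have a₃ := abs_nonneg (Real.log c₄)
  have a₄ := abs_nonneg (Real.log K₄)
  have a₅ : 0 ≤ L := abs_nonneg _
  obtain ⟨m1, m2⟩ := abs_le.1 hm
  obtain ⟨p1, p2⟩ := abs_le.1 l₃
  obtain ⟨n1, n2⟩ := abs_le.1 l₄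
  have s1 := neg_abs_le (Real.log (area M))
  have s2 := le_abs_self (Real.log (area M))
  have hlog : Real.log (1 / ε) = -Real.log ε := by rw [one_div, Real.log_inv]
  refine ⟨?_, ?_, ?_⟩
  · rw [dirichlet_bubble D hr₀ hr hε0]
    exact b₁.trans (by linarith)
  · rw [log_mean_exp_bubble hA hP, hlog, abs_le]
    constructor <;> linarith
  · rw [log_mean_exp_neg_bubble hA hN, abs_le]
    constructor <;> linarith

theorem isBigO_one_of_bound {f : ℝ → ℝ} {K : ℝ} (h : ∀ᶠ ε in 𝓝[>] (0 : ℝ), |f ε| ≤ K) :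
    f =O[𝓝[>] 0] (fun _ => (1 : ℝ)) :=
  Asymptotics.IsBigO.of_bound K (by simpa using h)

/-- The leading coefficients combine as ½ · 32π − 2l₁ = 2(8π − l₁); the second logarithm contributes
only to the bounded part. -/
theorem abs_energy_combination_le {d p n l L K l₁ l₂ : ℝ} (hd : |d - 32 * Real.pi * l| ≤ K)
    (hp : |p - 2 * l| ≤ K) (hn : |n| ≤ K) (hL : L = 2 * (8 * Real.pi - l₁) * l) :
    |1 / 2 * d - l₁ * p - l₂ * n - L| ≤ 1 / 2 * K + |l₁| * K + |l₂| * K := by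
  have e : 1 / 2 * d - l₁ * p - l₂ * n - L =
      1 / 2 * (d - 32 * Real.pi * l) - l₁ * (p - 2 * l) - l₂ * n := by rw [hL]; ring
  rw [e]
  refine (abs_sub _ _).trans (add_le_add ((abs_sub _ _).trans (add_le_add ?_ ?_)) ?_)
  · rw [abs_mul, abs_of_pos (by norm_num : (0 : ℝ) < 1 / 2)]
    gcongr
  · rw [abs_mul]; gcongr
  · rw [abs_mul]; gcongr

theorem functional_bubble_isBigO (D : DistChart p₀) (hA : 0 < area M) (hr₀ : 0 < r₀)
    (hr : 4 * r₀ < D.ρ) (l₁ l₂ : ℝ) :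
    (fun ε : ℝ => functional l₁ l₂ (bubble p₀ r₀ ε)
      - 2 * (8 * Real.pi - l₁) * Real.log (1 / ε)) =O[𝓝[>] 0] (fun _ => (1 : ℝ)) := by
  obtain ⟨K, hK⟩ := exists_bubble_bounds D hA hr₀ hr
  refine isBigO_one_of_bound (K := 1 / 2 * K + |l₁| * K + |l₂| * K) ?_
  filter_upwards [hK] with ε hε
  exact abs_energy_combination_le hε.1 hε.2.1 hε.2.2 rfl

/-- This symmetry reduces the expansion at −u_ε, and with it the case l₂ > 8π, to the one at u_ε. -/
theorem functional_neg {u : M → ℝ} (hu : MemH1 u) (l₁ l₂ : ℝ) :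
    functional l₁ l₂ (-u) = functional l₂ l₁ u := by
  have h : dirichlet (-u) = dirichlet u := dirichlet_neg hu
  simp only [functional, h, Pi.neg_apply, neg_neg]
  ring

theorem functional_neg_bubble_isBigO (D : DistChart p₀) (hA : 0 < area M) (hr₀ : 0 < r₀)
    (hr : 4 * r₀ < D.ρ) (l₁ l₂ : ℝ) :
    (fun ε : ℝ => functional l₁ l₂ (-bubble p₀ r₀ ε)
      - 2 * (8 * Real.pi - l₂) * Real.log (1 / ε)) =O[𝓝[>] 0] (fun _ => (1 : ℝ)) := by
  refine (functional_bubble_isBigO D hA hr₀ hr l₂ l₁).congr' ?_ EventuallyEq.rfl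
  filter_upwards [self_mem_nhdsWithin] with ε hε
  rw [functional_neg (memE_bubble D hA hr₀ hr hε).1]

theorem tendsto_atBot_of_isBigO {f : ℝ → ℝ} {c : ℝ} (hc : c < 0)
    (h : (fun ε => f ε - c * Real.log (1 / ε)) =O[𝓝[>] 0] (fun _ => (1 : ℝ))) :
    Tendsto f (𝓝[>] 0) atBot := by
  obtain ⟨K, hK⟩ := h.bound
  have hlog : Tendsto (fun ε : ℝ => Real.log (1 / ε)) (𝓝[>] 0) atTop := by
    simp only [one_div]
    exact Real.tendsto_log_atTop.comp tendsto_inv_nhdsGT_zero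
  refine tendsto_atBot_mono' _ ?_ (tendsto_atBot_add_const_right _ K (hlog.const_mul_atTop_of_neg hc))
  filter_upwards [hK] with ε hε
  have := (abs_le.1 ((Real.norm_eq_abs _).symm.trans_le hε)).2
  rw [norm_one, mul_one] at this
  linarith

theorem isUnboundedBelow_functional (D : DistChart p₀) (hA : 0 < area M) {l₁ l₂ : ℝ}
    (hl : 8 * Real.pi < max l₁ l₂) : IsUnboundedBelow (functional (M := M) l₁ l₂) := by
  intro B
  have hρ := D.ρ_pos
  have hr₀ : 0 < D.ρ / 8 := by positivity
  have hr : 4 * (D.ρ / 8) < D.ρ := by linarith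
  rcases lt_max_iff.1 hl with h | h
  · have ht := tendsto_atBot_of_isBigO (by linarith : 2 * (8 * Real.pi - l₁) < 0)
      (functional_bubble_isBigO D hA hr₀ hr l₁ l₂)
    obtain ⟨ε, hε, hε0⟩ := ((ht.eventually (eventually_lt_atBot B)).and self_mem_nhdsWithin).exists
    exact ⟨_, memE_bubble D hA hr₀ hr hε0, hε⟩
  · have ht := tendsto_atBot_of_isBigO (by linarith : 2 * (8 * Real.pi - l₂) < 0)
      (functional_neg_bubble_isBigO D hA hr₀ hr l₁ l₂)
    obtain ⟨ε, hε, hε0⟩ := ((ht.eventually (eventually_lt_atBot B)).and self_mem_nhdsWithin).exists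
    exact ⟨_, (memE_bubble D hA hr₀ hr hε0).neg, hε⟩

end

end

end MeanField

/-! ### Assembly of the theorem. -/

theorem proposition2 {M : Type*} [TopologicalSpace M] [T2Space M] [CompactSpace M]
    [ChartedSpace MeanField.Plane M] [IsManifold (𝓡 2) ∞ M]
    [RiemannianBundle (fun x : M => TangentSpace (𝓡 2) x)]
    [IsContMDiffRiemannianBundle (𝓡 2) ∞ MeanField.Plane (fun x : M => TangentSpace (𝓡 2) x)]
    [MeasurableSpace M] [BorelSpace M]
    (l₁ l₂ : ℝ) (hl : (l₁, l₂) ∈ MeanField.Lam M) :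
    -- the functional is well defined on `E`
    (∀ u : M → ℝ, MeanField.MemE u →
      Integrable (fun x => Real.exp (u x)) (MeanField.vol M) ∧
      Integrable (fun x => Real.exp (-u x)) (MeanField.vol M)) ∧
    -- mountain pass structure
    MeanField.IsStrictLocalMinAtZero (MeanField.functional (M := M) l₁ l₂) ∧
    MeanField.IsNondegenerateAtZero (MeanField.functional (M := M) l₁ l₂) ∧
    MeanField.IsUnboundedBelow (MeanField.functional (M := M) l₁ l₂) ∧
    MeanField.HasMountainPassGeometry (MeanField.functional (M := M) l₁ l₂) ∧
    -- the expansions along the bubbles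
    ∀ p₀ : M, ∃ R > 0, ∀ r₀ : ℝ, 0 < r₀ → r₀ < R →
      (∀ ε > 0, MeanField.MemE (MeanField.bubble p₀ r₀ ε)) ∧
      (fun ε : ℝ => MeanField.functional l₁ l₂ (MeanField.bubble p₀ r₀ ε)
          - 2 * (8 * Real.pi - l₁) * Real.log (1 / ε)) =O[𝓝[>] 0] (fun _ => (1 : ℝ)) ∧
      (fun ε : ℝ => MeanField.functional l₁ l₂ (-MeanField.bubble p₀ r₀ ε)
          - 2 * (8 * Real.pi - l₂) * Real.log (1 / ε)) =O[𝓝[>] 0] (fun _ => (1 : ℝ)) := by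
  obtain ⟨h₁, h₂, hs, hm⟩ := hl
  dsimp only at h₁ h₂ hs hm
  have harea : 0 ≤ MeanField.area M := measureReal_nonneg
  -- Membership in Λ forces μ₁|M| > 8π. Positivity of μ₁ and of the area, and nonemptiness of `M`,
  -- all come from here, with no connectedness assumption.
  have hpos : 0 < MeanField.mu1 M * MeanField.area M := by
    have h3 : max l₁ l₂ ≤ l₁ + l₂ := max_le (by linarith) (by linarith)
    have := Real.pi_pos
    linarith
  have hA : 0 < MeanField.area M := harea.lt_of_ne fun h => by simp [← h] at hpos
  have hmu : 0 < MeanField.mu1 M := pos_of_mul_pos_left hpos harea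
  have hne : Nonempty M := by
    by_contra h
    rw [not_nonempty_iff] at h
    have : MeanField.area M = 0 := by
      rw [MeanField.area, univ_eq_empty_iff.2 h, measureReal_empty]
    exact hA.ne' this
  obtain ⟨p⟩ := hne
  obtain ⟨D⟩ := MeanField.nonempty_distChart p
  have hnd := MeanField.isNondegenerateAtZero hmu hA h₁ h₂ hs
  have hub := MeanField.isUnboundedBelow_functional D hA hm
  refine ⟨fun u hu => ?_, hnd.isStrictLocalMinAtZero hmu, hnd, hub,
    hnd.hasMountainPassGeometry hub, fun p₀ => ?_⟩
  · obtain ⟨X, hX⟩ := hu.1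
    exact ⟨hX.integrable_exp, hX.integrable_exp_neg⟩
  · obtain ⟨D₀⟩ := MeanField.nonempty_distChart p₀
    have hρ := D₀.ρ_pos
    refine ⟨D₀.ρ / 4, by positivity, fun r₀ hr₀ hr => ?_⟩
    have hr' : 4 * r₀ < D₀.ρ := by linarith
    exact ⟨fun ε hε => MeanField.memE_bubble D₀ hA hr₀ hr' hε,
      MeanField.functional_bubble_isBigO D₀ hA hr₀ hr' l₁ l₂,
      MeanField.functional_neg_bubble_isBigO D₀ hA hr₀ hr' l₁ l₂⟩
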